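/- **Theorem.** Let $X$ be a metric space and $n\ge 0$ an integer. Then $X$ is a coarse $PD(n)$ space if and only if $X$ has an orientation pair of degree $n$. The terms are defined as follows; all coefficients are integral. *Coarse containment.* For subsets $A,B,C$ of a metric space let $N_R(A)$ be the set of points at distance less than $R$ from some point of $A$. Write $A\subset_c B$ if $A\subset N_R(B)$ for some $R$; bounded sets are also declared to be coarsely contained in the empty set. Write $A\cap_c B\subset_c C$ if $N_R(A)\cap N_R(B)\subset_c C$ for every $R$. *Supports.* A $k$-simplex of $X$ is a point of $X^{k+1}$. Let $X^\infty$ be the set of eventually constant sequences in $X$ with the sup metric; a simplex $(x_0,\dots,x_k)$ is viewed as the point $(x_0,\dots,x_k,x_k,x_k,\dots)$ of $X^\infty$. The support $|c|\subset X^\infty$ of a function $c:X^{k+1}\to\mathbb Z$ is the set of the simplices on which it is non-zero. For $A\subset X$ let $\Delta_A\subset X^\infty$ be the set of constant sequences with value in $A$, and put $\Delta=\Delta_X$. *Complexes.* $C^k(X)$ is the group of all functions $X^{k+1}\to\mathbb Z$, with the coboundary $d\phi(x_0,\dots,x_{k+1})=\sum_i(-1)^i\phi(x_0,\dots,\hat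 x_i,\dots,x_{k+1})$. $CX_k(X)$ is the group of the integral $k$-chains $c=\sum c_\sigma\sigma$ (infinite sums allowed) such that for every bounded $B\subset X$ only finitely many simplices $\sigma$ with $c_\sigma\ne0$ have a vertex in $B$, and such that $|c|\subset_c\Delta$; it has the usual boundary $\partial$. All these groups are zero for $k<0$. $HX_k(X)$ is the homology of $CX_*(X)$. For $A\subset X$, $CX^*(X-A)=\{\phi\in C^*(X): |\phi|\cap_c\Delta\subset_c\Delta_A\}$, with cohomology $HX^*(X-A)$. Let $C^n(X\otimes X)$ be the group of integral functions on the products $\sigma^k\otimes\tau^l$ of simplices of $X$ with $k+l=n$, with the coboundary dual to $\partial(\sigma^k\otimes\tau^l)=\partial\sigma\otimes\tau+(-1)^k\sigma\otimes\partial\tau$. The support $|\sigma\otimes\tau|$ of a product of $\sigma=(x_0,\dots,x_k)$ and $\tau=(y_0,\dots,y_l)$ is the element of $(X\times X)^{(k+1)(l+1)}$ with $(i,j)$ coordinate $(x_i,y_j)$, viewed as a point of $(X\times X)^\infty$ ($X\times X$ has the sup metric); $|\phi|$ is the set of the $|\sigma\otimes\tau|$ with $\phi(\sigma\otimes\tau)\neq0$.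 With $\delta(x)=(x,x)$, let $CX^*(X\otimes X-\delta(X))=\{\phi\in C^*(X\otimes X): |\phi|\cap_c\Delta_{X\times X}\subset_c\Delta_{\delta(X)}\}$, with cohomology $HX^*(X\otimes X-\delta(X))$. *Coarse $PD(n)$ spaces.* $X$ is a coarse $PD(n)$ space if there are chain maps $p:C^*(X)\to CX_{n-*}(X)$ and $q:CX_{n-*}(X)\to C^*(X)$ and chain homotopies $G:CX_*(X)\to CX_{*+1}(X)$ from $pq$ to the identity and $F:C^*(X)\to C^{*-1}(X)$ from $qp$ to the identity (that is, $pq-\mathrm{id}=\partial G+G\partial$ and $qp-\mathrm{id}=dF+Fd$), such that for all homogeneous $\phi\in C^*(X)$ and $c\in CX_*(X)$ $$|p(\phi)|\subset_c|\phi|,\qquad |F(\phi)|\cap_c\Delta\subset_c|\phi|,\qquad |q(c)|\cap_c\Delta\subset_c|c|,\qquad |G(c)|\subset_c|c|.$$ *Orientation pairs.* For $\phi\in CX^n(X\otimes X-\delta(X))$ and $c=\sum c_\sigma\sigma\in CX_k(X)$ the slant product $\phi/c\in C^{n-k}(X)=CX^{n-k}(X-X)$ is given by the finite sums $(\phi/c)(\tau)=\sum_\sigma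 c_\sigma\,\phi(\sigma\otimes\tau)$; it induces a slant product $HX^n(X\otimes X-\delta(X))\times HX_k(X)\to HX^{n-k}(X-X)$. An orientation pair of degree $n$ consists of classes $U\in HX^n(X\otimes X-\delta(X))$ (the diagonal class) and $[X]\in HX_n(X)$ (the fundamental class) with $U/[X]=1\in HX^0(X-X)$, where $1$ is the class of the constant function $1$ on $X$. -/

import Mathlib

namespace CoarsePD

open Metric Bornology

/-! ## Coarse containment -/

section Coarse

variable {M : Type*} [PseudoMetricSpace M]

/-- Coarse containment of subsets of a metric space: `A` lies in some metric neighbourhood of `B`.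
The empty set is declared to be coarsely equal to the bounded sets, whence the first alternative
(it is implied by the second one as soon as `B` is non-empty). -/
def CoarselyContained (A B : Set M) : Prop :=
  IsBounded A ∨ ∃ R : ℝ, A ⊆ thickening R B

/-- The coarse intersection of `A` and `B` is coarsely contained in `C`: for every `R`, the
intersection of the `R`-neighbourhoods of `A` and `B` is coarsely contained in `C`. -/
def CoarseInterContained (A B C : Set M) : Prop :=
  ∀ R : ℝ, CoarselyContained (thickening R A ∩ thickening R B) C

theorem CoarselyContained.mono {A A' B : Set M} (h : CoarselyContained A B) (hA : A' ⊆ A) :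
    CoarselyContained A' B := by
  rcases h with h | ⟨R, h⟩
  · exact Or.inl (h.subset hA)
  · exact Or.inr ⟨R, hA.trans h⟩

theorem CoarselyContained.exists_thickening {A B : Set M} (h : CoarselyContained A B)
    (hB : B.Nonempty) : ∃ R : ℝ, A ⊆ thickening R B := by
  rcases h with h | h
  · obtain ⟨b, hb⟩ := hB
    obtain ⟨R, hR⟩ := h.subset_ball b
    exact ⟨R, fun a ha => mem_thickening_iff.2 ⟨b, hb, hR ha⟩⟩
  · exact h

theorem CoarselyContained.union {A A' B : Set M} (h : CoarselyContained A B)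
    (h' : CoarselyContained A' B) : CoarselyContained (A ∪ A') B := by
  rcases B.eq_empty_or_nonempty with rfl | hB
  · left
    have key : ∀ S : Set M, CoarselyContained S ∅ → IsBounded S := by
      rintro S (hS | ⟨R, hS⟩)
      · exact hS
      · exact (isBounded_empty).subset (by simpa using hS)
    exact (key A h).union (key A' h')
  · obtain ⟨R, hR⟩ := h.exists_thickening hB
    obtain ⟨R', hR'⟩ := h'.exists_thickening hB
    exact Or.inr ⟨max R R', Set.union_subset
      (hR.trans (thickening_mono (le_max_left _ _) _))
      (hR'.trans (thickening_mono (le_max_right _ _) _))⟩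

theorem coarselyContained_empty (B : Set M) : CoarselyContained ∅ B :=
  Or.inl isBounded_empty

theorem CoarseInterContained.union {A A' B C : Set M} (h : CoarseInterContained A B C)
    (h' : CoarseInterContained A' B C) : CoarseInterContained (A ∪ A') B C := by
  intro R
  refine ((h R).union (h' R)).mono ?_
  rw [thickening_union, Set.union_inter_distrib_right]

theorem CoarseInterContained.mono {A A' B C : Set M} (h : CoarseInterContained A B C)
    (hA : A' ⊆ A) : CoarseInterContained A' B C := fun R =>
  (h R).mono (Set.inter_subset_inter_left _ (thickening_subset_of_subset R hA))

theorem coarseInterContained_empty (B C : Set M) : CoarseInterContained ∅ B C := by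
  intro R
  refine (coarselyContained_empty C).mono ?_
  simp

end Coarse

/-! ## Eventually constant sequences -/

/-- `X^∞`: the eventually constant sequences of points of `X`. -/
def EvConst (X : Type*) : Type _ := {s : ℕ → X // ∃ N, ∀ m, N ≤ m → s m = s N}

section EvConst

variable {X : Type*} [MetricSpace X]

theorem EvConst.bddAbove (s t : EvConst X) :
    BddAbove (Set.range fun m => dist (s.1 m) (t.1 m)) := by
  obtain ⟨N, hN⟩ := s.2
  obtain ⟨N', hN'⟩ := t.2
  refine (((Set.finite_Iic (max N N')).image fun m => dist (s.1 m) (t.1 m)).subset ?_).bddAbove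
  rintro _ ⟨m, rfl⟩
  rcases le_total m (max N N') with h | h
  · exact ⟨m, h, rfl⟩
  · refine ⟨max N N', Set.mem_Iic.2 le_rfl, ?_⟩
    simp only
    rw [hN m ((le_max_left _ _).trans h), hN' m ((le_max_right _ _).trans h),
      hN _ (le_max_left N N'), hN' _ (le_max_right N N')]

/-- The sup metric on `X^∞`. -/
noncomputable instance : MetricSpace (EvConst X) where
  dist s t := ⨆ m, dist (s.1 m) (t.1 m)
  dist_self s := by simp
  dist_comm s t := by simp [dist_comm]
  dist_triangle s t u := by
    refine ciSup_le fun m => (dist_triangle _ (t.1 m) _).trans ?_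
    exact add_le_add (le_ciSup (EvConst.bddAbove s t) m) (le_ciSup (EvConst.bddAbove t u) m)
  eq_of_dist_eq_zero := by
    intro s t h
    refine Subtype.ext (funext fun m => ?_)
    have h1 := le_ciSup (EvConst.bddAbove s t) m
    exact dist_le_zero.1 (h1.trans h.le)

theorem EvConst.dist_le_iff {s t : EvConst X} {R : ℝ} :
    dist s t ≤ R ↔ ∀ m, dist (s.1 m) (t.1 m) ≤ R :=
  ciSup_le_iff (EvConst.bddAbove s t)

/-- The constant sequence at `x`. -/
def EvConst.const (x : X) : EvConst X := ⟨fun _ => x, 0, fun _ _ => rfl⟩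

/-- For `A ⊆ X`, the part of the diagonal of `X^∞` lying over `A`. -/
def diag (A : Set X) : Set (EvConst X) := EvConst.const '' A

end EvConst

/-! ## Simplices, chains and cochains -/

/-- The simplices of all dimensions of `X`: a `k`-simplex is a `(k+1)`-tuple of points. -/
abbrev Simplex (X : Type*) : Type _ := Σ k : ℕ, (Fin (k + 1) → X)

/-- The `i`-th face of a `(k+1)`-simplex (the `i`-th vertex is omitted). -/
def face {X : Type*} {k : ℕ} (i : Fin (k + 2)) (σ : Fin (k + 2) → X) : Simplex X :=
  ⟨k, i.removeNth σ⟩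

/-- The `(k+1)`-simplex obtained from a `k`-simplex by inserting `x` as the `i`-th vertex. -/
def insertVertex {X : Type*} {k : ℕ} (i : Fin (k + 2)) (x : X) (τ : Fin (k + 1) → X) : Simplex X :=
  ⟨k + 1, i.insertNth (α := fun _ => X) x τ⟩

/-- The stabilization of a simplex: its last vertex is repeated for ever. -/
def stab {X : Type*} (σ : Simplex X) : EvConst X :=
  ⟨fun m => σ.2 ⟨min m σ.1, Nat.lt_succ_of_le (min_le_right _ _)⟩, σ.1, fun m hm => by
    simp [min_eq_right hm]⟩

/-- The stabilized support of an integral chain or cochain. -/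
def supp {X : Type*} (c : Simplex X → ℤ) : Set (EvConst X) := stab '' {σ | c σ ≠ 0}

/-- The Alexander--Spanier coboundary
`(dφ)(x₀, …, x_k) = ∑ i, (-1)^i φ(x₀, …, x̂_i, …, x_k)`, which is zero on `0`-simplices. -/
def coboundary {X : Type*} (φ : Simplex X → ℤ) : Simplex X → ℤ
  | ⟨0, _⟩ => 0
  | ⟨k + 1, σ⟩ => ∑ i : Fin (k + 2), (-1) ^ (i : ℕ) * φ (face i σ)

/-- The boundary of a (locally finite) chain, `∂(x₀, …, x_k) = ∑ i, (-1)^i (x₀, …, x̂_i, …, x_k)`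
on simplices. The coefficient of `τ` in `∂c` is the sum of `(-1)^i c_σ` over the pairs `(i, σ)`
such that `τ` is the `i`-th face of `σ`, that is, such that `σ` is `τ` with some `x` inserted as
the `i`-th vertex; for locally finite `c` only finitely many of these terms are non-zero. -/
noncomputable def boundary {X : Type*} (c : Simplex X → ℤ) : Simplex X → ℤ :=
  fun τ => ∑ i : Fin (τ.1 + 2), (-1) ^ (i : ℕ) * ∑ᶠ x : X, c (insertVertex i x τ.2)

/-- The set of vertices of a simplex. -/
def verts {X : Type*} (σ : Simplex X) : Set X := Set.range σ.2

theorem coboundary_ne_zero {X : Type*} {φ : Simplex X → ℤ} {σ : Simplex X}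
    (h : coboundary φ σ ≠ 0) :
    ∃ ρ, φ ρ ≠ 0 ∧ verts ρ ⊆ verts σ ∧ ρ.1 + 1 = σ.1 := by
  obtain ⟨_ | k, σ⟩ := σ
  · exact absurd rfl h
  · obtain ⟨i, -, hi⟩ := Finset.exists_ne_zero_of_sum_ne_zero h
    refine ⟨face i σ, fun h0 => hi (by rw [h0, mul_zero]), ?_, rfl⟩
    rintro _ ⟨j, rfl⟩
    exact ⟨i.succAbove j, rfl⟩

theorem face_insertVertex {X : Type*} {k : ℕ} (i : Fin (k + 2)) (x : X) (τ : Fin (k + 1) → X) :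
    face i (insertVertex i x τ).2 = ⟨k, τ⟩ := by
  simp [face, insertVertex]

theorem boundary_ne_zero {X : Type*} {c : Simplex X → ℤ} {τ : Simplex X}
    (h : boundary c τ ≠ 0) : ∃ i : Fin (τ.1 + 2), ∃ x : X, c (insertVertex i x τ.2) ≠ 0 := by
  obtain ⟨i, -, hi⟩ := Finset.exists_ne_zero_of_sum_ne_zero h
  have h2 : ∑ᶠ x : X, c (insertVertex i x τ.2) ≠ 0 := fun h0 => hi (by rw [h0, mul_zero])
  by_contra! h3
  exact h2 (by rw [finsum_congr (fun x => h3 i x), finsum_zero])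

theorem verts_subset_insertVertex {X : Type*} {k : ℕ} (i : Fin (k + 2)) (x : X) (τ : Fin (k + 1) → X) :
    verts ⟨k, τ⟩ ⊆ verts (insertVertex i x τ) := by
  rintro _ ⟨j, rfl⟩
  exact ⟨i.succAbove j, by simp [insertVertex]⟩

theorem coboundary_add {X : Type*} (φ ψ : Simplex X → ℤ) :
    coboundary (φ + ψ) = coboundary φ + coboundary ψ := by
  funext ⟨k, σ⟩
  cases k with
  | zero => simp [coboundary]
  | succ k => simp [coboundary, mul_add, Finset.sum_add_distrib]

theorem coboundary_zero {X : Type*} : coboundary (0 : Simplex X → ℤ) = 0 := by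
  simpa using coboundary_add (0 : Simplex X → ℤ) 0

/-! ### Supports -/

section Supp

variable {X : Type*}

theorem supp_zero : supp (0 : Simplex X → ℤ) = ∅ := by simp [supp]

theorem supp_add (c c' : Simplex X → ℤ) : supp (c + c') ⊆ supp c ∪ supp c' := by
  rintro _ ⟨σ, hσ, rfl⟩
  by_cases h : c σ = 0
  · exact Or.inr ⟨σ, fun h' => hσ (by simp [h, h']), rfl⟩
  · exact Or.inl ⟨σ, h, rfl⟩

theorem supp_neg (c : Simplex X → ℤ) : supp (-c) = supp c := by simp [supp]

variable [MetricSpace X]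

theorem dist_stab_const_le {σ : Simplex X} {x : X} {R : ℝ} :
    dist (stab σ) (EvConst.const x) ≤ R ↔ ∀ v ∈ verts σ, dist v x ≤ R := by
  rw [EvConst.dist_le_iff]
  constructor
  · rintro h _ ⟨i, rfl⟩
    have h1 := h i
    have h2 : (⟨min (i : ℕ) σ.1, Nat.lt_succ_of_le (min_le_right _ _)⟩ : Fin (σ.1 + 1)) = i :=
      Fin.ext (min_eq_left (Nat.le_of_lt_succ i.2))
    simp only [stab, EvConst.const, h2] at h1
    exact h1
  · intro h m
    exact h _ ⟨_, rfl⟩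

/-- A simplex whose vertices are among those of `σ` is close to `σ`, if `σ` is close to the
diagonal. -/
theorem exists_near {Y : Type*} [MetricSpace Y] {S S' : Set (Simplex Y)} {C : Set (EvConst Y)}
    (h : CoarseInterContained (stab '' S) (diag Set.univ) C)
    (hS : ∀ σ ∈ S', ∃ ρ ∈ S, verts ρ ⊆ verts σ) :
    CoarseInterContained (stab '' S') (diag Set.univ) C := by
  intro R
  refine (h (3 * R)).mono ?_
  rintro z ⟨hz1, hz2⟩
  obtain ⟨_, ⟨σ, hσ, rfl⟩, h1⟩ := mem_thickening_iff.1 hz1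
  obtain ⟨_, ⟨x, -, rfl⟩, h2⟩ := mem_thickening_iff.1 hz2
  obtain ⟨ρ, hρ, hv⟩ := hS σ hσ
  have hR : 0 < R := dist_nonneg.trans_lt h1
  have h3 : dist (stab σ) (EvConst.const x) ≤ 2 * R := by
    linarith [dist_triangle_left (stab σ) (EvConst.const x) z]
  have h4 : dist (stab ρ) (EvConst.const x) ≤ 2 * R :=
    dist_stab_const_le.2 fun v hvρ => dist_stab_const_le.1 h3 v (hv hvρ)
  refine ⟨mem_thickening_iff.2 ⟨_, ⟨ρ, hρ, rfl⟩, ?_⟩,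
    mem_thickening_iff.2 ⟨_, ⟨x, trivial, rfl⟩, by linarith⟩⟩
  linarith [dist_triangle_right z (stab ρ) (EvConst.const x)]

end Supp

/-! ## The complexes -/

/-- `C^k(X)`: all integral Alexander--Spanier `k`-cochains, that is, the functions supported on
the `k`-simplices (it is zero for `k < 0`). -/
def Cochain (X : Type*) (k : ℤ) : AddSubgroup (Simplex X → ℤ) where
  carrier := {φ | ∀ σ, φ σ ≠ 0 → (σ.1 : ℤ) = k}
  zero_mem' := fun _ h => absurd rfl h
  add_mem' := by
    intro a b ha hb σ h
    by_cases h0 : a σ = 0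
    · exact hb σ fun h' => h (by simp [h0, h'])
    · exact ha σ h0
  neg_mem' := by
    intro a ha σ h
    exact ha σ (by simpa using h)

theorem coboundary_mem {X : Type*} {k l : ℤ} (h : k + 1 = l) {φ : Simplex X → ℤ}
    (hφ : φ ∈ Cochain X k) : coboundary φ ∈ Cochain X l := by
  intro σ hσ
  obtain ⟨ρ, hρ, -, hd⟩ := coboundary_ne_zero hσ
  have := hφ ρ hρ
  omega

/-- The coboundary operator `d : C^k(X) → C^(k+1)(X)`. -/
def Cochain.d {X : Type*} (k l : ℤ) (h : k + 1 = l) : Cochain X k →+ Cochain X l where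
  toFun φ := ⟨coboundary φ.1, coboundary_mem h φ.2⟩
  map_zero' := Subtype.ext coboundary_zero
  map_add' _ _ := Subtype.ext (coboundary_add _ _)

section Complexes

variable (X : Type*) [MetricSpace X]

/-- `CX_k(X)`: the coarse `k`-chains, that is, the integral `k`-chains `c` such that
only finitely many simplices of `c` have a vertex in any given bounded set, and whose support is
coarsely contained in the diagonal. -/
def CoarseChain (k : ℤ) : AddSubgroup (Simplex X → ℤ) where
  carrier := {c | (∀ σ, c σ ≠ 0 → (σ.1 : ℤ) = k) ∧
    (∀ B : Set X, IsBounded B → {σ : Simplex X | c σ ≠ 0 ∧ ∃ i, σ.2 i ∈ B}.Finite) ∧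
    CoarselyContained (supp c) (diag Set.univ)}
  zero_mem' := ⟨(Cochain X k).zero_mem, fun B _ => by simp,
    by rw [supp_zero]; exact coarselyContained_empty _⟩
  add_mem' := by
    rintro a b ⟨ha1, ha2, ha3⟩ ⟨hb1, hb2, hb3⟩
    refine ⟨(Cochain X k).add_mem ha1 hb1, fun B hB => ?_, (ha3.union hb3).mono (supp_add a b)⟩
    refine ((ha2 B hB).union (hb2 B hB)).subset ?_
    rintro σ ⟨h, hi⟩
    by_cases h0 : a σ = 0
    · exact Or.inr ⟨fun h' => h (by simp [h0, h']), hi⟩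
    · exact Or.inl ⟨h0, hi⟩
  neg_mem' := by
    rintro a ⟨ha1, ha2, ha3⟩
    refine ⟨(Cochain X k).neg_mem ha1, fun B hB => ?_, by rwa [supp_neg]⟩
    simpa using ha2 B hB

variable {X}

theorem CoarseChain.finite_insertVertex {k : ℤ} {c : Simplex X → ℤ} (hc : c ∈ CoarseChain X k)
    {m : ℕ} (i : Fin (m + 2)) (τ : Fin (m + 1) → X) :
    (Function.support fun x => c (insertVertex i x τ)).Finite := by
  have h := hc.2.1 {τ 0} isBounded_singleton
  refine Set.Finite.of_finite_image (f := fun x => insertVertex i x τ) (h.subset ?_) ?_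
  · rintro _ ⟨x, hx, rfl⟩
    exact ⟨hx, i.succAbove 0, by simp [insertVertex]⟩
  · intro x _ y _ hxy
    have h1 : (i.insertNth (α := fun _ => X) x τ) = i.insertNth (α := fun _ => X) y τ := by
      simpa [insertVertex] using hxy
    simpa using congrFun h1 i

theorem boundary_add {k l : ℤ} {a b : Simplex X → ℤ} (ha : a ∈ CoarseChain X k)
    (hb : b ∈ CoarseChain X l) : boundary (a + b) = boundary a + boundary b := by
  funext τ
  simp only [boundary, Pi.add_apply]
  rw [← Finset.sum_add_distrib]
  refine Finset.sum_congr rfl fun i _ => ?_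
  rw [finsum_add_distrib (CoarseChain.finite_insertVertex ha i τ.2) (CoarseChain.finite_insertVertex hb i τ.2),
    mul_add]

theorem boundary_mem {k l : ℤ} (h : l + 1 = k) {c : Simplex X → ℤ}
    (hc : c ∈ CoarseChain X k) : boundary c ∈ CoarseChain X l := by
  refine ⟨fun τ hτ => ?_, fun B hB => ?_, ?_⟩
  · obtain ⟨i, x, hx⟩ := boundary_ne_zero hτ
    have h1 := hc.1 _ hx
    simp only [insertVertex] at h1
    push_cast at h1
    omega
  · have hfin := hc.2.1 B hB
    let f : Simplex X → Set (Simplex X) := fun σ =>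
      match σ with
      | ⟨0, _⟩ => ∅
      | ⟨_ + 1, s⟩ => Set.range fun i => face i s
    have hf : ∀ σ, (f σ).Finite := by
      rintro ⟨_ | m, s⟩
      · exact Set.finite_empty
      · exact Set.finite_range _
    refine (hfin.biUnion fun σ _ => hf σ).subset ?_
    rintro τ ⟨hτ, j, hj⟩
    obtain ⟨i, x, hx⟩ := boundary_ne_zero hτ
    refine Set.mem_biUnion (x := insertVertex i x τ.2) ⟨hx, ?_⟩ ⟨i, face_insertVertex i x τ.2⟩
    exact ⟨i.succAbove j, by simpa [insertVertex] using hj⟩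
  · rcases (supp c).eq_empty_or_nonempty with he | ⟨_, ⟨σ₀, hσ₀, rfl⟩⟩
    · refine (coarselyContained_empty _).mono ?_
      rintro _ ⟨τ, hτ, rfl⟩
      obtain ⟨i, x, hx⟩ := boundary_ne_zero hτ
      have : stab (insertVertex i x τ.2) ∈ supp c := ⟨_, hx, rfl⟩
      rw [he] at this
      exact this.elim
    · obtain ⟨R, hR⟩ := hc.2.2.exists_thickening ⟨_, σ₀.2 0, trivial, rfl⟩
      refine Or.inr ⟨R + 1, ?_⟩
      rintro _ ⟨τ, hτ, rfl⟩
      obtain ⟨i, x, hx⟩ := boundary_ne_zero hτ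
      obtain ⟨_, ⟨y, -, rfl⟩, hy⟩ := mem_thickening_iff.1 (hR ⟨_, hx, rfl⟩)
      refine mem_thickening_iff.2 ⟨_, ⟨y, trivial, rfl⟩, ?_⟩
      refine lt_of_le_of_lt (dist_stab_const_le.2 fun v hv => ?_) (lt_add_one R)
      exact dist_stab_const_le.1 hy.le v (verts_subset_insertVertex i x τ.2 hv)

/-- The boundary operator `∂ : CX_(k+1)(X) → CX_k(X)`. -/
noncomputable def CoarseChain.d (k l : ℤ) (h : l + 1 = k) :
    CoarseChain X k →+ CoarseChain X l where
  toFun c := ⟨boundary c.1, boundary_mem h c.2⟩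
  map_zero' := Subtype.ext (by funext τ; simp [boundary])
  map_add' a b := Subtype.ext (boundary_add a.2 b.2)

/-- `CX^k(X - A)`: the coarse `k`-cochains of the complement of `A` in `X`, that is, the
`k`-cochains for which the coarse intersection of the support with the diagonal is coarsely
contained in the part of the diagonal over `A`. -/
def ComplCochain (A : Set X) (k : ℤ) : AddSubgroup (Simplex X → ℤ) where
  carrier := {φ | (∀ σ, φ σ ≠ 0 → (σ.1 : ℤ) = k) ∧
    CoarseInterContained (supp φ) (diag Set.univ) (diag A)}
  zero_mem' := ⟨(Cochain X k).zero_mem, by rw [supp_zero]; exact coarseInterContained_empty _ _⟩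
  add_mem' := fun {a b} ha hb =>
    ⟨(Cochain X k).add_mem ha.1 hb.1, (ha.2.union hb.2).mono (supp_add a b)⟩
  neg_mem' := fun {a} ha => ⟨(Cochain X k).neg_mem ha.1, by rw [supp_neg]; exact ha.2⟩

/-- The coboundary operator `d : CX^k(X - A) → CX^(k+1)(X - A)`. -/
def ComplCochain.d (A : Set X) (k l : ℤ) (h : k + 1 = l) :
    ComplCochain A k →+ ComplCochain A l where
  toFun φ := ⟨coboundary φ.1, coboundary_mem h φ.2.1, exists_near φ.2.2 fun _ hσ => by
    obtain ⟨ρ, hρ, hv, -⟩ := coboundary_ne_zero hσ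
    exact ⟨ρ, hρ, hv⟩⟩
  map_zero' := Subtype.ext coboundary_zero
  map_add' _ _ := Subtype.ext (coboundary_add _ _)

theorem mem_complCochain_univ {k : ℤ} {φ : Simplex X → ℤ} (h : φ ∈ Cochain X k) :
    φ ∈ ComplCochain (Set.univ : Set X) k :=
  ⟨h, fun R => Or.inr ⟨R, Set.inter_subset_right⟩⟩

end Complexes

/-! ## Cochains on `X ⊗ X`

The complex of finite chains on `X ⊗ X` is the tensor product of the complexes of finite chains on
the two factors. It is free on the products `σ ⊗ τ` of simplices, so an `n`-cochain on `X ⊗ X` is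
a function on the pairs `(σ, τ)` with `dim σ + dim τ = n`. -/

/-- For a `k`-simplex `σ` and an `l`-simplex `τ`, the element of `(X × X)^((k+1)(l+1))`
whose `(i, j)` coordinate is `(σ i, τ j)`. -/
def grid {X : Type*} (s : Simplex X × Simplex X) : Simplex (X × X) :=
  ⟨s.1.1 * s.2.1 + s.1.1 + s.2.1, fun m =>
    (s.1.2 ⟨m / (s.2.1 + 1), (Nat.div_lt_iff_lt_mul (Nat.succ_pos _)).2 (by
      have := m.2; nlinarith)⟩,
     s.2.2 ⟨m % (s.2.1 + 1), Nat.mod_lt _ (Nat.succ_pos _)⟩)⟩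

theorem verts_grid {X : Type*} (s : Simplex X × Simplex X) :
    verts (grid s) = verts s.1 ×ˢ verts s.2 := by
  ext ⟨x, y⟩
  constructor
  · rintro ⟨m, hm⟩
    rw [← hm]
    exact ⟨⟨_, rfl⟩, ⟨_, rfl⟩⟩
  · rintro ⟨⟨i, rfl⟩, ⟨j, rfl⟩⟩
    have hj : (j : ℕ) < s.2.1 + 1 := j.2
    have hi : (i : ℕ) ≤ s.1.1 := Nat.le_of_lt_succ i.2
    refine ⟨⟨i * (s.2.1 + 1) + j, ?_⟩, ?_⟩
    · have : (i : ℕ) * (s.2.1 + 1) ≤ s.1.1 * (s.2.1 + 1) := Nat.mul_le_mul_right _ hi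
      simp only [grid]
      nlinarith
    · have h1 : ((i : ℕ) * (s.2.1 + 1) + j) / (s.2.1 + 1) = i := by
        rw [mul_comm, Nat.mul_add_div (Nat.succ_pos _), Nat.div_eq_of_lt hj, add_zero]
      have h2 : ((i : ℕ) * (s.2.1 + 1) + j) % (s.2.1 + 1) = j := by
        rw [mul_comm, Nat.mul_add_mod, Nat.mod_eq_of_lt hj]
      simp only [grid, h1, h2]

/-- The stabilized support, in `(X × X)^∞`, of a cochain on `X ⊗ X`. -/
def tensorSupp {X : Type*} (φ : Simplex X × Simplex X → ℤ) : Set (EvConst (X × X)) :=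
  stab '' (grid '' {s | φ s ≠ 0})

/-- The coboundary of a cochain on `X ⊗ X`, dual to
`∂(σ ⊗ τ) = ∂σ ⊗ τ + (-1)^(dim σ) σ ⊗ ∂τ`. -/
def tensorCoboundary {X : Type*} (φ : Simplex X × Simplex X → ℤ) : Simplex X × Simplex X → ℤ :=
  fun s => coboundary (fun σ => φ (σ, s.2)) s.1 +
    (-1) ^ s.1.1 * coboundary (fun τ => φ (s.1, τ)) s.2

theorem tensorSupp_zero {X : Type*} : tensorSupp (0 : Simplex X × Simplex X → ℤ) = ∅ := by
  simp [tensorSupp]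

theorem tensorSupp_neg {X : Type*} (φ : Simplex X × Simplex X → ℤ) :
    tensorSupp (-φ) = tensorSupp φ := by
  simp [tensorSupp]

theorem tensorSupp_add {X : Type*} (φ ψ : Simplex X × Simplex X → ℤ) :
    tensorSupp (φ + ψ) ⊆ tensorSupp φ ∪ tensorSupp ψ := by
  rintro _ ⟨_, ⟨s, hs, rfl⟩, rfl⟩
  by_cases h : φ s = 0
  · exact Or.inr ⟨_, ⟨s, fun h' => hs (by simp [h, h']), rfl⟩, rfl⟩
  · exact Or.inl ⟨_, ⟨s, h, rfl⟩, rfl⟩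

theorem tensorCoboundary_add {X : Type*} (φ ψ : Simplex X × Simplex X → ℤ) :
    tensorCoboundary (φ + ψ) = tensorCoboundary φ + tensorCoboundary ψ := by
  funext ⟨σ, τ⟩
  have h1 := congrFun (coboundary_add (fun σ => φ (σ, τ)) (fun σ => ψ (σ, τ))) σ
  have h2 := congrFun (coboundary_add (fun τ => φ (σ, τ)) (fun τ => ψ (σ, τ))) τ
  simp only [Pi.add_apply] at h1 h2
  have e1 : coboundary (fun σ => (φ + ψ) (σ, τ)) σ =
      coboundary (fun σ => φ (σ, τ)) σ + coboundary (fun σ => ψ (σ, τ)) σ := h1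
  have e2 : coboundary (fun τ => (φ + ψ) (σ, τ)) τ =
      coboundary (fun τ => φ (σ, τ)) τ + coboundary (fun τ => ψ (σ, τ)) τ := h2
  simp only [tensorCoboundary, Pi.add_apply] at e1 e2 ⊢
  rw [e1, e2]
  ring

theorem tensorCoboundary_ne_zero {X : Type*} {φ : Simplex X × Simplex X → ℤ}
    {s : Simplex X × Simplex X} (h : tensorCoboundary φ s ≠ 0) :
    ∃ r, φ r ≠ 0 ∧ verts (grid r) ⊆ verts (grid s) ∧ r.1.1 + r.2.1 + 1 = s.1.1 + s.2.1 := by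
  by_cases h1 : coboundary (fun σ => φ (σ, s.2)) s.1 = 0
  · have h2 : coboundary (fun τ => φ (s.1, τ)) s.2 ≠ 0 := fun h2 =>
      h (by simp [tensorCoboundary, h1, h2])
    obtain ⟨ρ, hρ, hv, hd⟩ := coboundary_ne_zero h2
    refine ⟨(s.1, ρ), hρ, ?_, by simp only; omega⟩
    rw [verts_grid, verts_grid]
    exact Set.prod_mono le_rfl hv
  · obtain ⟨ρ, hρ, hv, hd⟩ := coboundary_ne_zero h1
    refine ⟨(ρ, s.2), hρ, ?_, by simp only; omega⟩
    rw [verts_grid, verts_grid]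
    exact Set.prod_mono hv le_rfl

section Tensor

variable (X : Type*) [MetricSpace X]

/-- `CX^k(X ⊗ X - δ(X))`: the `k`-cochains on `X ⊗ X` for which the coarse intersection of the
support with the diagonal of `(X × X)^∞` is coarsely contained in the part of the diagonal over
`δ(X) = {(x, x)}`. -/
def TensorCochain (k : ℤ) : AddSubgroup (Simplex X × Simplex X → ℤ) where
  carrier := {φ | (∀ s, φ s ≠ 0 → (s.1.1 : ℤ) + s.2.1 = k) ∧
    CoarseInterContained (tensorSupp φ) (diag Set.univ) (diag (Set.range fun x : X => (x, x)))}
  zero_mem' := ⟨fun _ h => absurd rfl h,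
    by rw [tensorSupp_zero]; exact coarseInterContained_empty _ _⟩
  add_mem' := by
    rintro a b ⟨ha1, ha2⟩ ⟨hb1, hb2⟩
    refine ⟨fun s h => ?_, (ha2.union hb2).mono (tensorSupp_add a b)⟩
    by_cases h0 : a s = 0
    · exact hb1 s fun h' => h (by simp [h0, h'])
    · exact ha1 s h0
  neg_mem' := by
    rintro a ⟨ha1, ha2⟩
    exact ⟨fun s h => ha1 s (by simpa using h), by rw [tensorSupp_neg]; exact ha2⟩

variable {X}

/-- The coboundary operator `d : CX^k(X ⊗ X - δ(X)) → CX^(k+1)(X ⊗ X - δ(X))`. -/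
def TensorCochain.d (k l : ℤ) (h : k + 1 = l) : TensorCochain X k →+ TensorCochain X l where
  toFun φ := ⟨tensorCoboundary φ.1, fun s hs => by
      obtain ⟨r, hr, -, hd⟩ := tensorCoboundary_ne_zero hs
      have := φ.2.1 r hr
      omega,
    exists_near φ.2.2 fun _ hσ => by
      obtain ⟨s, hs, rfl⟩ := hσ
      obtain ⟨r, hr, hv, -⟩ := tensorCoboundary_ne_zero hs
      exact ⟨_, ⟨r, hr, rfl⟩, hv⟩⟩
  map_zero' := Subtype.ext (by
    simpa using tensorCoboundary_add (0 : Simplex X × Simplex X → ℤ) 0)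
  map_add' _ _ := Subtype.ext (tensorCoboundary_add _ _)

end Tensor

/-! ## (Co)homology groups -/

/-- The homology `ker g / im f` at the middle term of `A → B → C`. -/
abbrev Homology {A B C : Type*} [AddCommGroup A] [AddCommGroup B] [AddCommGroup C]
    (f : A →+ B) (g : B →+ C) : Type _ :=
  g.ker ⧸ f.range.addSubgroupOf g.ker

section Groups

variable (X : Type*) [MetricSpace X]

/-- `HX_k(X)`, the coarse homology of `X`. -/
abbrev CoarseHomology (k : ℤ) : Type _ :=
  Homology (CoarseChain.d (X := X) (k + 1) k rfl)
    (CoarseChain.d (X := X) k (k - 1) (sub_add_cancel k 1))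

/-- `HX^k(X ⊗ X - δ(X))`. -/
abbrev TensorCohomology (k : ℤ) : Type _ :=
  Homology (TensorCochain.d (X := X) (k - 1) k (sub_add_cancel k 1))
    (TensorCochain.d (X := X) k (k + 1) rfl)

variable {X}

/-- `HX^k(X - A)`, the coarse cohomology of the complement of `A` in `X`. -/
abbrev ComplCohomology (A : Set X) (k : ℤ) : Type _ :=
  Homology (ComplCochain.d A (k - 1) k (sub_add_cancel k 1)) (ComplCochain.d A k (k + 1) rfl)

end Groups

/-! ## The slant product -/

/-- The slant product of a cochain on `X ⊗ X` and a chain on `X`, the linear extension of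
`(φ/σ)(τ) = φ(σ ⊗ τ)`. The sum is finite when `φ` represents a cochain of `X ⊗ X - δ(X)` and `c` is
a coarse chain. -/
noncomputable def slant {X : Type*} (φ : Simplex X × Simplex X → ℤ) (c : Simplex X → ℤ) :
    Simplex X → ℤ :=
  fun τ => ∑ᶠ σ, c σ * φ (σ, τ)

section Adjoint

variable {X : Type*}

open Classical in
/-- The boundary on finite chains. -/
noncomputable def finiteBoundary : (Simplex X →₀ ℤ) →+ (Simplex X →₀ ℤ) :=
  Finsupp.liftAddHom fun σ => match σ with
    | ⟨0, _⟩ => 0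
    | ⟨k + 1, s⟩ => ∑ i : Fin (k + 2),
        (Finsupp.singleAddHom (face i s)).comp (AddMonoidHom.mulLeft ((-1) ^ (i : ℕ)))

theorem finsupp_finite_insertVertex (b : Simplex X →₀ ℤ)
    {m : ℕ} (i : Fin (m + 2)) (τ : Fin (m + 1) → X) :
    (Function.support fun x => b (insertVertex i x τ)).Finite := by
  refine Set.Finite.of_finite_image (f := fun x => insertVertex i x τ)
    (b.hasFiniteSupport.subset ?_) ?_
  · rintro _ ⟨x, hx, rfl⟩
    exact hx
  · intro x _ y _ hxy
    have h1 : (i.insertNth (α := fun _ => X) x τ) = i.insertNth (α := fun _ => X) y τ := by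
      simpa [insertVertex] using hxy
    simpa using congrFun h1 i

theorem boundary_finsupp (b : Simplex X →₀ ℤ) : boundary (⇑b) = ⇑(finiteBoundary b) := by
  classical
  induction b using Finsupp.induction_linear with
  | zero => funext τ; simp [boundary]
  | add f g hf hg =>
    rw [map_add, Finsupp.coe_add, Finsupp.coe_add, ← hf, ← hg]
    funext τ
    simp only [boundary, Pi.add_apply]
    rw [← Finset.sum_add_distrib]
    refine Finset.sum_congr rfl fun i _ => ?_
    rw [finsum_add_distrib (finsupp_finite_insertVertex f i τ.2)
      (finsupp_finite_insertVertex g i τ.2), mul_add]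
  | single s a =>
    funext ⟨m, t⟩
    obtain ⟨_ | k, s⟩ := s
    · have h : ∀ (i : Fin (m + 2)) (x : X), (⟨0, s⟩ : Simplex X) ≠ insertVertex i x t := by
        intro i x h
        have := congrArg Sigma.fst h
        simp [insertVertex] at this
      simp [boundary, finiteBoundary, h]
    · simp only [boundary, finiteBoundary, Finsupp.liftAddHom_apply_single,
        AddMonoidHom.finsetSum_apply, Finsupp.coe_finsetSum, Finset.sum_apply,
        AddMonoidHom.comp_apply, AddMonoidHom.coe_mulLeft, Finsupp.singleAddHom_apply]
      by_cases hm : m = k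
      · subst hm
        refine Finset.sum_congr rfl fun i _ => ?_
        rw [finsum_eq_single _ (s i)]
        · by_cases ht : i.removeNth s = t
          · subst ht
            simp [face, insertVertex]
          · have h1 : (⟨m + 1, s⟩ : Simplex X) ≠ insertVertex i (s i) t := by
              intro h
              have h2 : s = i.insertNth (α := fun _ => X) (s i) t := by
                simpa [insertVertex] using h
              exact ht (by rw [h2]; simp)
            have h3 : face i s ≠ ⟨m, t⟩ := by
              intro h
              exact ht (by simpa [face] using h)
            simp [h1, h3]
        · intro x hx
          have h1 : (⟨m + 1, s⟩ : Simplex X) ≠ insertVertex i x t := by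
            intro h
            have h2 : s = i.insertNth (α := fun _ => X) x t := by
              simpa [insertVertex] using h
            exact hx (by rw [h2]; simp)
          simp [h1]
      · have h : ∀ (i : Fin (m + 2)) (x : X), (⟨k + 1, s⟩ : Simplex X) ≠ insertVertex i x t := by
          intro i x h
          have := congrArg Sigma.fst h
          simp [insertVertex] at this
          exact hm this.symm
        have h' : ∀ i : Fin (k + 2), face i s ≠ ⟨m, t⟩ := by
          intro i h
          exact hm (congrArg Sigma.fst h).symm
        simp [h, h']

theorem finsum_finsupp_mul (b : Simplex X →₀ ℤ) (g : Simplex X → ℤ) :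
    ∑ᶠ σ, b σ * g σ = Finsupp.liftAddHom (fun σ => AddMonoidHom.mulRight (g σ)) b := by
  rw [Finsupp.liftAddHom_apply, Finsupp.sum]
  refine finsum_eq_finsetSum_of_support_subset _ ?_
  intro σ hσ
  have : b σ ≠ 0 := fun h => hσ (by simp [h])
  simpa using this

theorem finsum_boundary_mul_finsupp (b : Simplex X →₀ ℤ) (g : Simplex X → ℤ) :
    ∑ᶠ σ, boundary (⇑b) σ * g σ = ∑ᶠ σ, b σ * coboundary g σ := by
  rw [boundary_finsupp, finsum_finsupp_mul, finsum_finsupp_mul, ← AddMonoidHom.comp_apply]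
  congr 1
  refine Finsupp.addHom_ext fun σ a => ?_
  obtain ⟨_ | k, s⟩ := σ
  · simp [finiteBoundary, coboundary]
  · simp only [AddMonoidHom.comp_apply, finiteBoundary, Finsupp.liftAddHom_apply_single,
      AddMonoidHom.finsetSum_apply, map_sum, AddMonoidHom.coe_mulLeft,
      Finsupp.singleAddHom_apply, AddMonoidHom.coe_mulRight, coboundary]
    rw [Finset.mul_sum]
    exact Finset.sum_congr rfl fun i _ => by ring

/-- The boundary of chains is adjoint to the coboundary of cochains. -/
theorem finsum_boundary_mul {b g : Simplex X → ℤ}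
    (hfin : {σ | b σ ≠ 0 ∧ ∃ ρ, verts ρ ⊆ verts σ ∧ g ρ ≠ 0}.Finite) :
    ∑ᶠ σ, boundary b σ * g σ = ∑ᶠ σ, b σ * coboundary g σ := by
  classical
  set S := {σ | b σ ≠ 0 ∧ ∃ ρ, verts ρ ⊆ verts σ ∧ g ρ ≠ 0} with hS
  let b' : Simplex X →₀ ℤ := Finsupp.onFinset hfin.toFinset (fun σ => if σ ∈ S then b σ else 0)
    (fun σ h => by
      rw [Set.Finite.mem_toFinset]
      by_contra h'
      exact h (if_neg h'))
  have hb' : ∀ σ, (∃ ρ, verts ρ ⊆ verts σ ∧ g ρ ≠ 0) → b' σ = b σ := by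
    intro σ h
    change (if σ ∈ S then b σ else 0) = b σ
    by_cases h0 : b σ = 0
    · simp [h0]
    · exact if_pos ⟨h0, h⟩
  have e1 : ∑ᶠ σ, boundary b σ * g σ = ∑ᶠ σ, boundary (⇑b') σ * g σ := by
    refine finsum_congr fun ρ => ?_
    by_cases h0 : g ρ = 0
    · simp [h0]
    · congr 1
      refine Finset.sum_congr rfl fun i _ => ?_
      congr 1
      refine finsum_congr fun x => (hb' _ ⟨ρ, verts_subset_insertVertex i x ρ.2, h0⟩).symm
  have e2 : ∑ᶠ σ, b σ * coboundary g σ = ∑ᶠ σ, b' σ * coboundary g σ := by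
    refine finsum_congr fun σ => ?_
    by_cases h0 : coboundary g σ = 0
    · simp [h0]
    · obtain ⟨ρ, hρ, hv, -⟩ := coboundary_ne_zero h0
      rw [hb' σ ⟨ρ, hv, hρ⟩]
  rw [e1, e2, finsum_boundary_mul_finsupp]

end Adjoint

section Slant

variable {X : Type*} [MetricSpace X]

theorem slant_finite {n k : ℤ} {φ : Simplex X × Simplex X → ℤ} (hφ : φ ∈ TensorCochain X n)
    {c : Simplex X → ℤ} (hc : c ∈ CoarseChain X k) (τ : Simplex X) :
    {σ | c σ ≠ 0 ∧ ∃ ρ, verts ρ ⊆ verts σ ∧ φ (ρ, τ) ≠ 0}.Finite := by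
  obtain ⟨R₁, hR₁⟩ := hc.2.2.exists_thickening ⟨_, τ.2 0, trivial, rfl⟩
  obtain ⟨R₂, hR₂⟩ := (Set.finite_range fun i => dist (τ.2 i) (τ.2 0)).bddAbove
  have hR₂' : ∀ v ∈ verts τ, dist v (τ.2 0) ≤ R₂ := by
    rintro _ ⟨i, rfl⟩
    exact hR₂ ⟨i, rfl⟩
  have hR₂0 : 0 ≤ R₂ := dist_nonneg.trans (hR₂' _ ⟨0, rfl⟩)
  obtain ⟨R, hR⟩ := (hφ.2 (max R₁ R₂ + 1)).exists_thickening
    ⟨_, _, ⟨τ.2 0, rfl⟩, rfl⟩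
  refine (hc.2.1 (closedBall (τ.2 0) (2 * R)) isBounded_closedBall).subset ?_
  rintro σ ⟨hσ, ρ, hv, hρ⟩
  refine ⟨hσ, ?_⟩
  obtain ⟨_, ⟨x, -, rfl⟩, hx⟩ := mem_thickening_iff.1 (hR₁ ⟨σ, hσ, rfl⟩)
  have hx' := dist_stab_const_le.1 hx.le
  have hM : (0 : ℝ) < max R₁ R₂ + 1 := by
    have := le_max_right R₁ R₂
    linarith
  have h1 : stab (grid (ρ, τ)) ∈ thickening R (diag (Set.range fun x : X => (x, x))) := by
    refine hR ⟨self_subset_thickening hM _ ⟨_, ⟨_, hρ, rfl⟩, rfl⟩,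
      mem_thickening_iff.2 ⟨_, ⟨(x, τ.2 0), trivial, rfl⟩, ?_⟩⟩
    refine lt_of_le_of_lt (dist_stab_const_le.2 ?_) (lt_add_one _)
    rw [verts_grid]
    rintro ⟨v, w⟩ ⟨hvρ, hw⟩
    rw [Prod.dist_eq]
    exact max_le_max (hx' v (hv hvρ)) (hR₂' w hw)
  obtain ⟨_, ⟨_, ⟨z, rfl⟩, rfl⟩, hz⟩ := mem_thickening_iff.1 h1
  have hz' := dist_stab_const_le.1 hz.le (ρ.2 0, τ.2 0) (by
    rw [verts_grid]
    exact ⟨⟨0, rfl⟩, ⟨0, rfl⟩⟩)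
  rw [Prod.dist_eq, max_le_iff] at hz'
  obtain ⟨i, hi⟩ := hv ⟨0, rfl⟩
  refine ⟨i, ?_⟩
  rw [hi, mem_closedBall]
  have := dist_triangle_right (ρ.2 0) (τ.2 0) z
  linarith [hz'.1, hz'.2]

theorem slant_support_finite {n k : ℤ} {φ : Simplex X × Simplex X → ℤ}
    (hφ : φ ∈ TensorCochain X n) {c : Simplex X → ℤ} (hc : c ∈ CoarseChain X k) (τ : Simplex X) :
    (Function.support fun σ => c σ * φ (σ, τ)).Finite :=
  (slant_finite hφ hc τ).subset fun σ hσ =>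
    ⟨left_ne_zero_of_mul hσ, σ, subset_rfl, right_ne_zero_of_mul hσ⟩

theorem slant_mem {n k m : ℤ} (h : k + m = n) {φ : Simplex X × Simplex X → ℤ}
    (hφ : φ ∈ TensorCochain X n) {c : Simplex X → ℤ} (hc : c ∈ CoarseChain X k) :
    slant φ c ∈ ComplCochain (Set.univ : Set X) m := by
  refine mem_complCochain_univ fun τ hτ => ?_
  by_contra hm
  refine hτ ?_
  have : ∀ σ, c σ * φ (σ, τ) = 0 := by
    intro σ
    by_contra h0
    have h1 := hc.1 σ (left_ne_zero_of_mul h0)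
    have h2 := hφ.1 _ (right_ne_zero_of_mul h0)
    simp only at h2
    omega
  simp [slant, this]

theorem slant_add_left {n k : ℤ} {φ ψ : Simplex X × Simplex X → ℤ} (hφ : φ ∈ TensorCochain X n)
    (hψ : ψ ∈ TensorCochain X n) {c : Simplex X → ℤ} (hc : c ∈ CoarseChain X k) :
    slant (φ + ψ) c = slant φ c + slant ψ c := by
  funext τ
  simp only [slant, Pi.add_apply, mul_add]
  exact finsum_add_distrib (slant_support_finite hφ hc τ) (slant_support_finite hψ hc τ)

theorem slant_add_right {n k : ℤ} {φ : Simplex X × Simplex X → ℤ} (hφ : φ ∈ TensorCochain X n)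
    {a b : Simplex X → ℤ} (ha : a ∈ CoarseChain X k) (hb : b ∈ CoarseChain X k) :
    slant φ (a + b) = slant φ a + slant φ b := by
  funext τ
  simp only [slant, Pi.add_apply, add_mul]
  exact finsum_add_distrib (slant_support_finite hφ ha τ) (slant_support_finite hφ hb τ)

/-- The Leibniz rule `(dφ)/c = φ/∂c + (-1)^k d(φ/c)` for a chain `c` of degree `k`. -/
theorem slant_coboundary {n k : ℤ} {φ : Simplex X × Simplex X → ℤ} (hφ : φ ∈ TensorCochain X n)
    {c : Simplex X → ℤ} (hc : c ∈ CoarseChain X k) :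
    slant (tensorCoboundary φ) c =
      slant φ (boundary c) + (-1 : ℤ) ^ k.toNat • coboundary (slant φ c) := by
  funext τ
  have hsign : ∀ σ, c σ * (-1 : ℤ) ^ σ.1 = (-1 : ℤ) ^ k.toNat * c σ := by
    intro σ
    by_cases h0 : c σ = 0
    · simp [h0]
    · have h1 : σ.1 = k.toNat := by
        have := hc.1 σ h0
        omega
      rw [h1, mul_comm]
  have hf1 : (Function.support fun σ => c σ * coboundary (fun σ => φ (σ, τ)) σ).Finite := by
    refine (slant_finite hφ hc τ).subset fun σ hσ => ⟨left_ne_zero_of_mul hσ, ?_⟩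
    obtain ⟨ρ, hρ, hv, -⟩ := coboundary_ne_zero (right_ne_zero_of_mul hσ)
    exact ⟨ρ, hv, hρ⟩
  have e0 : slant (tensorCoboundary φ) c τ =
      ∑ᶠ σ, (c σ * coboundary (fun σ => φ (σ, τ)) σ +
        (-1 : ℤ) ^ k.toNat * (c σ * coboundary (fun τ => φ (σ, τ)) τ)) := by
    refine finsum_congr fun σ => ?_
    simp only [tensorCoboundary]
    rw [mul_add, ← mul_assoc, hsign σ, mul_assoc]
  have e1 : slant φ (boundary c) τ = ∑ᶠ σ, c σ * coboundary (fun σ => φ (σ, τ)) σ :=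
    finsum_boundary_mul (slant_finite hφ hc τ)
  rw [e0, Pi.add_apply, e1, Pi.smul_apply, smul_eq_mul]
  obtain ⟨_ | l, t⟩ := τ
  · simp [coboundary]
  · have hf2 : ∀ j : Fin (l + 2), (Function.support fun σ =>
        (-1 : ℤ) ^ (j : ℕ) * (c σ * φ (σ, face j t))).Finite := fun j =>
      (slant_support_finite hφ hc (face j t)).subset fun σ hσ => right_ne_zero_of_mul hσ
    have e2 : ∀ σ, c σ * coboundary (fun τ => φ (σ, τ)) ⟨l + 1, t⟩ =
        ∑ j : Fin (l + 2), (-1 : ℤ) ^ (j : ℕ) * (c σ * φ (σ, face j t)) := by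
      intro σ
      simp only [coboundary, Finset.mul_sum]
      exact Finset.sum_congr rfl fun j _ => by ring
    have hf3 : (Function.support fun σ =>
        ∑ j : Fin (l + 2), (-1 : ℤ) ^ (j : ℕ) * (c σ * φ (σ, face j t))).Finite := by
      refine (Set.finite_iUnion hf2).subset fun σ hσ => ?_
      obtain ⟨j, -, hj⟩ := Finset.exists_ne_zero_of_sum_ne_zero hσ
      exact Set.mem_iUnion.2 ⟨j, hj⟩
    simp only [e2]
    rw [finsum_add_distrib hf1 (hf3.subset fun σ hσ => right_ne_zero_of_mul hσ),
      ← mul_finsum, finsum_sum_comm _ _ fun j _ => hf2 j]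
    congr 2
    refine Finset.sum_congr rfl fun j _ => ?_
    rw [← mul_finsum]
    rfl

/-- The slant product on cochains and chains. -/
noncomputable def slantHom (n k m : ℤ) (h : k + m = n) :
    TensorCochain X n →+ CoarseChain X k →+ ComplCochain (Set.univ : Set X) m :=
  AddMonoidHom.mk'
    (fun φ => AddMonoidHom.mk' (fun c => ⟨slant φ.1 c.1, slant_mem h φ.2 c.2⟩)
      fun a b => Subtype.ext (slant_add_right φ.2 a.2 b.2))
    fun φ ψ => AddMonoidHom.ext fun c => Subtype.ext (slant_add_left φ.2 ψ.2 c.2)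

end Slant
section Classes

variable {X : Type*} [MetricSpace X]

/-- The slant product of a cocycle and a cycle, as a cocycle. -/
noncomputable def slantCocycle (n k m : ℤ) (h : k + m = n) :
    (TensorCochain.d (X := X) n (n + 1) rfl).ker →+
      (CoarseChain.d (X := X) k (k - 1) (sub_add_cancel k 1)).ker →+
        (ComplCochain.d (Set.univ : Set X) m (m + 1) rfl).ker :=
  AddMonoidHom.mk'
    (fun φ => AddMonoidHom.mk'
      (fun c => ⟨slantHom n k m h φ.1 c.1, by
        have h1 : tensorCoboundary φ.1.1 = 0 := congrArg Subtype.val φ.2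
        have h2 : boundary c.1.1 = 0 := congrArg Subtype.val c.2
        have h3 := slant_coboundary φ.1.2 c.1.2
        rw [h1, h2] at h3
        have h4 : slant (0 : Simplex X × Simplex X → ℤ) c.1.1 = 0 := by
          funext τ; simp [slant]
        have h5 : slant φ.1.1 (0 : Simplex X → ℤ) = 0 := by funext τ; simp [slant]
        rw [h4, h5, zero_add, eq_comm, smul_eq_zero] at h3
        exact Subtype.ext (h3.resolve_left (pow_ne_zero _ (by norm_num)))⟩)
      fun a b => Subtype.ext (map_add (slantHom n k m h φ.1) a.1 b.1))
    fun φ ψ => AddMonoidHom.ext fun c => Subtype.ext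
      (congrArg (fun f => f c.1) (map_add (slantHom n k m h) φ.1 ψ.1))

/-- The slant product of a coboundary and a cycle is a coboundary. -/
theorem slantCocycle_left (n k m : ℤ) (h : k + m = n)
    {φ : (TensorCochain.d (X := X) n (n + 1) rfl).ker}
    (hφ : φ ∈ (TensorCochain.d (X := X) (n - 1) n (sub_add_cancel n 1)).range.addSubgroupOf
      (TensorCochain.d (X := X) n (n + 1) rfl).ker)
    (c : (CoarseChain.d (X := X) k (k - 1) (sub_add_cancel k 1)).ker) :
    slantCocycle n k m h φ c ∈
      (ComplCochain.d (Set.univ : Set X) (m - 1) m (sub_add_cancel m 1)).range.addSubgroupOf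
        (ComplCochain.d (Set.univ : Set X) m (m + 1) rfl).ker := by
  obtain ⟨η, hη⟩ := AddSubgroup.mem_addSubgroupOf.1 hφ
  refine AddSubgroup.mem_addSubgroupOf.2
    ⟨(-1 : ℤ) ^ k.toNat • slantHom (n - 1) k (m - 1) (by omega) η c.1, ?_⟩
  rw [map_zsmul]
  have h2 : boundary c.1.1 = 0 := congrArg Subtype.val c.2
  have h3 := slant_coboundary η.2 c.1.2
  have h5 : slant η.1 (0 : Simplex X → ℤ) = 0 := by funext τ; simp [slant]
  rw [h2, h5, zero_add] at h3
  have h6 : tensorCoboundary η.1 = φ.1.1 := congrArg Subtype.val hη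
  rw [h6] at h3
  exact Subtype.ext h3.symm

/-- The slant product of a cocycle and a boundary is a coboundary. -/
theorem slantCocycle_right (n k m : ℤ) (h : k + m = n)
    (φ : (TensorCochain.d (X := X) n (n + 1) rfl).ker)
    {c : (CoarseChain.d (X := X) k (k - 1) (sub_add_cancel k 1)).ker}
    (hc : c ∈ (CoarseChain.d (X := X) (k + 1) k rfl).range.addSubgroupOf
      (CoarseChain.d (X := X) k (k - 1) (sub_add_cancel k 1)).ker) :
    slantCocycle n k m h φ c ∈
      (ComplCochain.d (Set.univ : Set X) (m - 1) m (sub_add_cancel m 1)).range.addSubgroupOf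
        (ComplCochain.d (Set.univ : Set X) m (m + 1) rfl).ker := by
  obtain ⟨b, hb⟩ := AddSubgroup.mem_addSubgroupOf.1 hc
  refine AddSubgroup.mem_addSubgroupOf.2
    ⟨-((-1 : ℤ) ^ (k + 1).toNat • slantHom n (k + 1) (m - 1) (by omega) φ.1 b), ?_⟩
  rw [map_neg, map_zsmul]
  have h1 : tensorCoboundary φ.1.1 = 0 := congrArg Subtype.val φ.2
  have h3 := slant_coboundary φ.1.2 b.2
  have h4 : slant (0 : Simplex X × Simplex X → ℤ) b.1 = 0 := by funext τ; simp [slant]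
  have h6 : boundary b.1 = c.1.1 := congrArg Subtype.val hb
  rw [h1, h4, h6] at h3
  exact Subtype.ext (eq_neg_of_add_eq_zero_left h3.symm).symm

/-- The slant product `U/z` of classes `U ∈ HX^n(X ⊗ X - δ(X))` and `z ∈ HX_k(X)`. It lies in
`HX^m(X - X)`, where `m = n - k`. -/
noncomputable def slantClass (n k m : ℤ) (h : k + m = n) :
    TensorCohomology X n →+ CoarseHomology X k →+ ComplCohomology (Set.univ : Set X) m :=
  QuotientAddGroup.lift _
    (AddMonoidHom.mk'
      (fun φ => QuotientAddGroup.lift _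
        ((QuotientAddGroup.mk' _).comp (slantCocycle n k m h φ))
        fun _ hc => (QuotientAddGroup.eq_zero_iff _).2 (slantCocycle_right n k m h φ hc))
      fun φ ψ => QuotientAddGroup.addMonoidHom_ext _ <| AddMonoidHom.ext fun c =>
        congrArg (QuotientAddGroup.mk' ((ComplCochain.d (Set.univ : Set X) (m - 1) m
            (sub_add_cancel m 1)).range.addSubgroupOf
              (ComplCochain.d (Set.univ : Set X) m (m + 1) rfl).ker))
          (DFunLike.congr_fun (map_add (slantCocycle (X := X) n k m h) φ ψ) c))
    fun _ hφ => QuotientAddGroup.addMonoidHom_ext _ <| AddMonoidHom.ext fun c =>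
      (QuotientAddGroup.eq_zero_iff _).2 (slantCocycle_left n k m h hφ c)

/-- On representatives, the slant product of classes is the slant product of (co)chains. -/
theorem slantClass_mk (n k m : ℤ) (h : k + m = n)
    (φ : (TensorCochain.d (X := X) n (n + 1) rfl).ker)
    (c : (CoarseChain.d (X := X) k (k - 1) (sub_add_cancel k 1)).ker) :
    slantClass n k m h (QuotientAddGroup.mk φ) (QuotientAddGroup.mk c) =
        QuotientAddGroup.mk (slantCocycle n k m h φ c) ∧
      (slantCocycle n k m h φ c).1.1 = slant φ.1.1 c.1.1 :=
  ⟨rfl, rfl⟩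

variable (X)

/-- The `0`-cochain which takes the value `1` on every `0`-simplex. -/
def oneCochain (X : Type*) : Simplex X → ℤ := fun σ => if σ.1 = 0 then 1 else 0

/-- The constant function `1`, as a cocycle of `CX^0(X - X)`. -/
def oneCocycle : (ComplCochain.d (Set.univ : Set X) 0 (0 + 1) rfl).ker :=
  ⟨⟨oneCochain X, mem_complCochain_univ (k := 0) fun σ hσ => by
      by_contra h
      exact hσ (if_neg (by exact_mod_cast h))⟩, by
    refine Subtype.ext (funext fun σ => ?_)
    obtain ⟨_ | _ | k, s⟩ := σ
    · rfl
    · change ∑ i : Fin 2, (-1 : ℤ) ^ (i : ℕ) * oneCochain X (face i s) = 0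
      simp [Fin.sum_univ_two, oneCochain, face]
    · change ∑ i : Fin (k + 3), (-1 : ℤ) ^ (i : ℕ) * oneCochain X (face i s) = 0
      simp [oneCochain, face]⟩

/-- The class `1 ∈ HX^0(X - X)`. -/
def oneClass : ComplCohomology (Set.univ : Set X) 0 := QuotientAddGroup.mk (oneCocycle X)

variable {X}

/-! ## Orientation pairs and coarse Poincaré duality spaces -/

/-- Classes `U ∈ HX^n(X ⊗ X - δ(X))` and `z ∈ HX_n(X)` form an orientation pair if
`U/z = 1 ∈ HX^0(X - X)`. -/
def IsOrientationPair (n : ℤ) (U : TensorCohomology X n) (z : CoarseHomology X n) : Prop :=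
  slantClass n n 0 (add_zero n) U z = oneClass X

variable (X)

/-- The data exhibiting `X` as a coarse Poincaré duality space of formal dimension `n`: controlled
chain homotopy equivalences between the complex `C^*(X)` of all cochains and the complex
`CX_(n-*)(X)` of coarse chains. All indices range over `ℤ`; the groups vanish in negative
degrees. -/
structure CoarseDuality (n : ℤ) where
  /-- `p : C^k(X) → CX_(n-k)(X)` -/
  p : ∀ k m : ℤ, k + m = n → (Cochain X k →+ CoarseChain X m)
  /-- `q : CX_(n-k)(X) → C^k(X)` -/
  q : ∀ k m : ℤ, k + m = n → (CoarseChain X m →+ Cochain X k)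
  /-- `F : C^(k+1)(X) → C^k(X)` -/
  F : ∀ k : ℤ, Cochain X (k + 1) →+ Cochain X k
  /-- `G : CX_m(X) → CX_(m+1)(X)` -/
  G : ∀ m : ℤ, CoarseChain X m →+ CoarseChain X (m + 1)
  p_comm : ∀ (k m : ℤ) (h : k + (m + 1) = n) (h' : k + 1 + m = n) (φ : Cochain X k),
    CoarseChain.d (m + 1) m rfl (p k (m + 1) h φ) = p (k + 1) m h' (Cochain.d k (k + 1) rfl φ)
  q_comm : ∀ (k m : ℤ) (h : k + (m + 1) = n) (h' : k + 1 + m = n) (c : CoarseChain X (m + 1)),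
    Cochain.d k (k + 1) rfl (q k (m + 1) h c) = q (k + 1) m h' (CoarseChain.d (m + 1) m rfl c)
  homotopy_F : ∀ (k m : ℤ) (h : k + 1 + m = n) (φ : Cochain X (k + 1)),
    q (k + 1) m h (p (k + 1) m h φ) - φ =
      Cochain.d k (k + 1) rfl (F k φ) + F (k + 1) (Cochain.d (k + 1) (k + 1 + 1) rfl φ)
  homotopy_G : ∀ (k m : ℤ) (h : k + (m + 1) = n) (c : CoarseChain X (m + 1)),
    p k (m + 1) h (q k (m + 1) h c) - c =
      CoarseChain.d (m + 1 + 1) (m + 1) rfl (G (m + 1) c) + G m (CoarseChain.d (m + 1) m rfl c)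
  supp_p : ∀ (k m : ℤ) (h : k + m = n) (φ : Cochain X k),
    CoarselyContained (supp (p k m h φ).1) (supp φ.1)
  supp_F : ∀ (k : ℤ) (φ : Cochain X (k + 1)),
    CoarseInterContained (supp (F k φ).1) (diag Set.univ) (supp φ.1)
  supp_q : ∀ (k m : ℤ) (h : k + m = n) (c : CoarseChain X m),
    CoarseInterContained (supp (q k m h c).1) (diag Set.univ) (supp c.1)
  supp_G : ∀ (m : ℤ) (c : CoarseChain X m), CoarselyContained (supp (G m c).1) (supp c.1)

/-- `X` is a coarse PD(`n`) space. -/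
def IsCoarsePD (n : ℤ) : Prop := Nonempty (CoarseDuality X n)

end Classes

end CoarsePD

/-! Let `u` be a cocycle for the diagonal class and `c` a cycle for the fundamental class. The cap
product `φ ↦ φ ∩ c` and the slant product `a ↦ u / a` are, up to signs, chain maps `p` and `q`.
For a cochain `φ` the products of `u` with `φ` in the first and in the second factor are
homotopic: evaluate `φ` on the joins of front faces of the two factors and `u` on the back faces.
As `u` is supported near the diagonal, this homotopy is controlled; its slant product with `c` is
the homotopy `F` from `q p` to multiplication by `u / c = 1`. The transpose of `F`, for `u` with
its factors exchanged, shows that `q` has a left inverse as well, namely the cap product from the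
other side. Hence `p` is also a left inverse up to homotopy, which gives `G`.

Conversely, given `p` and `q`, the cycle `p(1)` is a fundamental class, and the matrix of `q` on
single simplices should be a diagonal cocycle. Since `q` is a mere homomorphism on infinite
chains, with a support condition for each chain separately, one has to see that `q` is determined
by its matrix and that the support of the matrix is uniformly close to the diagonal. On chains
with vertices in a locally finite set both follow from Specker's theorem that homomorphisms from
`ℤ^ℕ` to `ℤ` are continuous. The vertices of `p(1)` form such a set, and since `q(p(1)) = 1` in
degree `0`, every point of `X` is within bounded distance of it. Pulling the matrix back along a
retraction onto these vertices yields the cocycle `u`, with `u / p(1) = q(p(1)) = 1`. -/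

namespace CoarsePD

open Metric Bornology

/-! ### Simplices as lists -/

section Lists

variable {X : Type*} {φ : Simplex X → ℤ} {σ : Simplex X}

/-- The list of vertices of a simplex. Lists carry the combinatorics of splitting and joining
simplices without dimension casts. -/
def vertexList (σ : Simplex X) : List X := List.ofFn σ.2

/-- The extension of a cochain to lists of vertices, with value zero on the empty list. -/
def listExt (φ : Simplex X → ℤ) (l : List X) : ℤ :=
  match List.equivSigmaTuple l with
  | ⟨0, _⟩ => 0
  | ⟨k + 1, s⟩ => φ ⟨k, s⟩

@[simp] theorem listExt_nil (φ : Simplex X → ℤ) : listExt φ [] = 0 := rfl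

@[simp] theorem listExt_vertexList (φ : Simplex X → ℤ) (σ : Simplex X) :
    listExt φ (vertexList σ) = φ σ := by
  have h : List.equivSigmaTuple (vertexList σ) = ⟨σ.1 + 1, σ.2⟩ :=
    List.equivSigmaTuple.apply_symm_apply ⟨σ.1 + 1, σ.2⟩
  simp only [listExt, h]

theorem exists_vertexList {l : List X} (hl : l ≠ []) : ∃ σ : Simplex X, vertexList σ = l := by
  have h : List.equivSigmaTuple.symm (List.equivSigmaTuple l) = l :=
    List.equivSigmaTuple.symm_apply_apply l
  rcases h' : List.equivSigmaTuple l with ⟨_ | k, s⟩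
  · rw [h'] at h
    exact absurd h.symm (by simpa [List.equivSigmaTuple] using hl)
  · rw [h'] at h
    exact ⟨⟨k, s⟩, h⟩

theorem exists_of_listExt_ne_zero {l : List X} (h : listExt φ l ≠ 0) :
    ∃ σ : Simplex X, vertexList σ = l ∧ φ σ ≠ 0 := by
  obtain ⟨σ, rfl⟩ := exists_vertexList (l := l) (by rintro rfl; exact h rfl)
  exact ⟨σ, rfl, by simpa using h⟩

theorem mem_vertexList {v : X} : v ∈ vertexList σ ↔ v ∈ verts σ := by
  rw [vertexList, List.mem_ofFn, verts, Set.mem_range]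

@[simp] theorem length_vertexList (σ : Simplex X) : (vertexList σ).length = σ.1 + 1 := by
  simp [vertexList]

theorem vertexList_ne_nil (σ : Simplex X) : vertexList σ ≠ [] := fun h => by
  have := length_vertexList σ
  simp [h] at this

theorem listExt_add (φ ψ : Simplex X → ℤ) : listExt (φ + ψ) = listExt φ + listExt ψ := by
  funext l
  rcases eq_or_ne l [] with rfl | h
  · simp
  · obtain ⟨σ, rfl⟩ := exists_vertexList h
    simp

/-- The coboundary on functions of lists, augmented in that the empty list is the only face of a
list with one element. -/
def listCoboundary : (List X → ℤ) → List X → ℤ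
  | _, [] => 0
  | φ, x :: l => φ l - listCoboundary (fun m => φ (x :: m)) l

@[simp] theorem listCoboundary_nil (φ : List X → ℤ) : listCoboundary φ [] = 0 := rfl

theorem listCoboundary_cons (φ : List X → ℤ) (x : X) (l : List X) :
    listCoboundary φ (x :: l) = φ l - listCoboundary (fun m => φ (x :: m)) l := rfl

theorem listCoboundary_ofFn {k : ℕ} (φ : List X → ℤ) (s : Fin (k + 1) → X) :
    listCoboundary φ (List.ofFn s) =
      ∑ i : Fin (k + 1), (-1) ^ (i : ℕ) * φ (List.ofFn (i.removeNth s)) := by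
  induction k generalizing φ with
  | zero => simp [listCoboundary_cons]
  | succ k ih =>
    rw [List.ofFn_succ, listCoboundary_cons, ih, Fin.sum_univ_succ (n := k + 1), sub_eq_add_neg,
      ← Finset.sum_neg_distrib]
    congr 1
    · simp [Fin.removeNth_zero, Fin.tail_def]
    · refine Finset.sum_congr rfl fun i _ => ?_
      have hface : List.ofFn (i.succ.removeNth s) =
          s 0 :: List.ofFn (i.removeNth fun j => s j.succ) := by
        rw [List.ofFn_succ]
        congr 1
        simp only [Fin.removeNth, Fin.succ_succAbove_succ]
        rfl
      rw [hface, Fin.val_succ, pow_succ]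
      ring

theorem coboundary_eq_listCoboundary {f : List X → ℤ} (hnil : f [] = 0)
    (h : ∀ σ, f (vertexList σ) = φ σ) (σ : Simplex X) :
    coboundary φ σ = listCoboundary f (vertexList σ) := by
  obtain ⟨k, s⟩ := σ
  simp only [vertexList]
  rw [listCoboundary_ofFn]
  cases k with
  | zero => simp [coboundary, hnil]
  | succ k =>
    refine Finset.sum_congr rfl fun i _ => ?_
    rw [← h]
    rfl

theorem listCoboundary_listExt (φ : Simplex X → ℤ) :
    listCoboundary (listExt φ) = listExt (coboundary φ) := by
  funext l
  rcases eq_or_ne l [] with rfl | h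
  · rfl
  · obtain ⟨σ, rfl⟩ := exists_vertexList h
    rw [listExt_vertexList, coboundary_eq_listCoboundary (listExt_nil φ) (listExt_vertexList φ)]

theorem listCoboundary_add (φ ψ : List X → ℤ) (l : List X) :
    listCoboundary (fun m => φ m + ψ m) l = listCoboundary φ l + listCoboundary ψ l := by
  induction l generalizing φ ψ with
  | nil => simp
  | cons x l ih => simp only [listCoboundary_cons, ih]; ring

@[simp] theorem listCoboundary_zero (l : List X) : listCoboundary (fun _ => 0) l = 0 := by
  induction l with
  | nil => rfl
  | cons x l ih => rw [listCoboundary_cons, ih, sub_zero]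

theorem listCoboundary_const_mul (a : ℤ) (φ : List X → ℤ) (l : List X) :
    listCoboundary (fun m => a * φ m) l = a * listCoboundary φ l := by
  induction l generalizing φ with
  | nil => simp
  | cons x l ih => simp only [listCoboundary_cons, ih]; ring

theorem listCoboundary_pow_mul {a : ℤ} (ha : a * a = 1) (φ : List X → ℤ) (l : List X) :
    listCoboundary (fun m => a ^ m.length * φ m) l = a * a ^ l.length * listCoboundary φ l := by
  induction l generalizing φ with
  | nil => simp
  | cons x l ih =>
    have hcons : (fun m : List X => a ^ (x :: m).length * φ (x :: m)) =
        fun m => a * (a ^ m.length * φ (x :: m)) := by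
      funext m; rw [List.length_cons, pow_succ]; ring
    rw [listCoboundary_cons, listCoboundary_cons, hcons, listCoboundary_const_mul, ih,
      List.length_cons, pow_succ]
    linear_combination (-(a ^ l.length * φ l)) * ha

theorem listCoboundary_append (φ : List X → ℤ) (a b : List X) :
    listCoboundary φ (a ++ b) = listCoboundary (fun m => φ (m ++ b)) a +
      (-1) ^ a.length * listCoboundary (fun m => φ (a ++ m)) b := by
  induction a generalizing φ with
  | nil => simp
  | cons x a ih =>
    simp only [List.cons_append, listCoboundary_cons, ih, List.length_cons, pow_succ]
    ring

/-- The sum over the splittings of a list into an initial and a final segment with one common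
element. -/
def splitSum : (List X → List X → ℤ) → List X → ℤ
  | _, [] => 0
  | Ψ, x :: l => Ψ [x] (x :: l) + splitSum (fun a b => Ψ (x :: a) b) l

@[simp] theorem splitSum_nil (Ψ : List X → List X → ℤ) : splitSum Ψ [] = 0 := rfl

theorem splitSum_cons (Ψ : List X → List X → ℤ) (x : X) (l : List X) :
    splitSum Ψ (x :: l) = Ψ [x] (x :: l) + splitSum (fun a b => Ψ (x :: a) b) l := rfl

theorem splitSum_add (Φ Ψ : List X → List X → ℤ) (l : List X) :
    splitSum (fun a b => Φ a b + Ψ a b) l = splitSum Φ l + splitSum Ψ l := by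
  induction l generalizing Φ Ψ with
  | nil => simp
  | cons x l ih => simp only [splitSum_cons, ih]; ring

@[simp] theorem splitSum_zero (l : List X) : splitSum (fun _ _ => 0) l = 0 := by
  induction l with
  | nil => rfl
  | cons x l ih => rw [splitSum_cons, ih, add_zero]

theorem splitSum_const_mul (r : ℤ) (Ψ : List X → List X → ℤ) (l : List X) :
    splitSum (fun a b => r * Ψ a b) l = r * splitSum Ψ l := by
  induction l generalizing Ψ with
  | nil => simp
  | cons x l ih => simp only [splitSum_cons, ih]; ring

theorem splitSum_neg (Ψ : List X → List X → ℤ) (l : List X) :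
    splitSum (fun a b => -Ψ a b) l = -splitSum Ψ l := by
  simpa using splitSum_const_mul (-1) Ψ l

theorem splitSum_sub (Φ Ψ : List X → List X → ℤ) (l : List X) :
    splitSum (fun a b => Φ a b - Ψ a b) l = splitSum Φ l - splitSum Ψ l := by
  simp only [sub_eq_add_neg, splitSum_add, splitSum_neg]

theorem splitSum_congr {Φ Ψ : List X → List X → ℤ} {l : List X}
    (h : ∀ a b, a.length + b.length = l.length + 1 → a ⊆ l → b ⊆ l → a ≠ [] → b ≠ [] →
      Φ a b = Ψ a b) : splitSum Φ l = splitSum Ψ l := by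
  induction l generalizing Φ Ψ with
  | nil => rfl
  | cons x l ih =>
    rw [splitSum_cons, splitSum_cons, h [x] (x :: l) (by simp; omega) (by simp) (by simp) (by simp)
      (by simp)]
    congr 1
    exact ih fun a b hlen ha hb _ hb0 => h _ _ (by simp; omega)
      (List.cons_subset_cons x ha) (List.subset_cons_of_subset x hb) (by simp) hb0

theorem exists_of_splitSum_ne_zero {Ψ : List X → List X → ℤ} {l : List X} (h : splitSum Ψ l ≠ 0) :
    ∃ a b, Ψ a b ≠ 0 ∧ a.length + b.length = l.length + 1 ∧ a ⊆ l ∧ b ⊆ l := by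
  by_contra! hzero
  refine h ((splitSum_congr fun a b hlen ha hb _ _ => ?_).trans (splitSum_zero l))
  by_contra hab
  exact hzero a b hab hlen ha hb

theorem listCoboundary_splitSum_comm (Ψ : List X → List X → List X → ℤ) (l m : List X) :
    listCoboundary (fun n => splitSum (fun a b => Ψ a b n) l) m =
      splitSum (fun a b => listCoboundary (Ψ a b) m) l := by
  induction l generalizing Ψ with
  | nil => simp only [splitSum_nil, listCoboundary_zero]
  | cons x l ih => simp only [splitSum_cons, listCoboundary_add, ih]

theorem listCoboundary_splitSum {Ψ : List X → List X → ℤ} (h : ∀ a, Ψ a [] = 0) (l : List X) :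
    listCoboundary (splitSum Ψ) l = splitSum (fun a b => listCoboundary (fun m => Ψ m b) a) l -
      splitSum (fun a b => (-1) ^ a.length * listCoboundary (Ψ a) b) l - Ψ [] l := by
  induction l generalizing Ψ with
  | nil => simp [h]
  | cons x l ih =>
    have hsign : (fun a b => (-1 : ℤ) ^ (x :: a).length * listCoboundary (Ψ (x :: a)) b) =
        fun a b => -((-1) ^ a.length * listCoboundary (Ψ (x :: a)) b) := by
      funext a b; rw [List.length_cons, pow_succ]; ring
    simp only [listCoboundary_cons, splitSum_cons]
    rw [listCoboundary_add, ih fun a => h _, splitSum_sub, hsign, splitSum_neg]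
    simp only [listCoboundary_nil, List.length_singleton]
    ring

end Lists

section Products

variable {X : Type*} {φ ψ : Simplex X → ℤ} {u : Simplex X × Simplex X → ℤ}

/-- The join homotopy on lists: the initial segments of two lists are joined and fed to `φ`, the
final segments to `u`. It is a homotopy between the products of `u` with `φ` in the two factors. -/
def listJoin (φ : List X → ℤ) (u : List X → List X → ℤ) (l m : List X) : ℤ :=
  splitSum (fun a b => splitSum (fun a' b' =>
    (-1) ^ (b.length * (a'.length + 1)) * (φ (a ++ a') * u b b')) m) l

theorem neg_one_pow_mul_self (n : ℕ) : (-1 : ℤ) ^ n * (-1) ^ n = 1 :=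
  pow_mul_pow_eq_one n rfl

theorem neg_one_pow_length {a b l : List X} (h : a.length + b.length = l.length + 1) :
    (-1 : ℤ) ^ l.length = -((-1) ^ a.length * (-1) ^ b.length) := by
  rw [← pow_add, h, pow_succ]
  ring

theorem listCoboundary_listJoin_left {φ : List X → ℤ} {u : List X → List X → ℤ}
    (hu : ∀ b, u [] b = 0) (l m : List X) :
    listCoboundary (fun x => listJoin φ u x m) l =
      splitSum (fun a b => splitSum (fun a' b' => (-1) ^ (b.length * (a'.length + 1)) *
        (listCoboundary (fun x => φ (x ++ a')) a * u b b')) m) l -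
      splitSum (fun a b => splitSum (fun a' b' => (-1) ^ (b.length * (a'.length + 1)) *
        ((-1) ^ a.length * (-1) ^ (a'.length + 1) * φ (a ++ a') *
          listCoboundary (fun x => u x b') b)) m) l -
      splitSum (fun a' b' => (-1) ^ (l.length * (a'.length + 1)) * (φ a' * u l b')) m := by
  refine (listCoboundary_splitSum (fun a => by simp [hu]) l).trans ?_
  congr 1
  congr 1
  · refine splitSum_congr fun a b _ _ _ _ _ => ?_
    rw [listCoboundary_splitSum_comm]
    refine splitSum_congr fun a' b' _ _ _ _ _ => ?_
    rw [listCoboundary_const_mul]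
    congr 1
    simp only [mul_comm _ (u b b')]
    rw [listCoboundary_const_mul]
  · refine splitSum_congr fun a b _ _ _ _ _ => ?_
    rw [listCoboundary_splitSum_comm, ← splitSum_const_mul]
    refine splitSum_congr fun a' b' _ _ _ _ _ => ?_
    simp only [mul_comm _ (a'.length + 1), pow_mul]
    rw [listCoboundary_pow_mul (neg_one_pow_mul_self _), listCoboundary_const_mul]
    ring

theorem listCoboundary_listJoin_right {φ : List X → ℤ} {u : List X → List X → ℤ}
    (hu : ∀ b, u b [] = 0) (l m : List X) :
    listCoboundary (listJoin φ u l) m =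
      splitSum (fun a b => splitSum (fun a' b' => (-1) ^ (b.length * (a'.length + 1)) *
        ((-1) ^ b.length * listCoboundary (fun x => φ (a ++ x)) a' * u b b')) m) l -
      splitSum (fun a b => splitSum (fun a' b' => (-1) ^ (b.length * (a'.length + 1)) *
        ((-1) ^ a'.length * φ (a ++ a') * listCoboundary (u b) b')) m) l -
      splitSum (fun a b => (-1) ^ b.length * (φ a * u b m)) l := by
  rw [← splitSum_sub, ← splitSum_sub]
  refine (listCoboundary_splitSum_comm (fun a b n => splitSum (fun a' b' =>
    (-1) ^ (b.length * (a'.length + 1)) * (φ (a ++ a') * u b b')) n) l m).trans ?_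
  refine splitSum_congr fun a b _ _ _ _ _ => ?_
  refine (listCoboundary_splitSum (fun a' => by rw [hu]; ring) m).trans ?_
  congr 1
  · congr 1
    · refine splitSum_congr fun a' b' _ _ _ _ _ => ?_
      have hfactor :
          (fun n : List X => (-1 : ℤ) ^ (b.length * (n.length + 1)) * (φ (a ++ n) * u b b')) =
          fun n => ((-1) ^ b.length * u b b') * (((-1) ^ b.length) ^ n.length * φ (a ++ n)) := by
        funext n; rw [pow_mul, pow_succ]; ring
      rw [hfactor, listCoboundary_const_mul, listCoboundary_pow_mul (neg_one_pow_mul_self _),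
        pow_mul, pow_succ]
      ring
    · refine splitSum_congr fun a' b' _ _ _ _ _ => ?_
      rw [listCoboundary_const_mul, listCoboundary_const_mul]
      ring
  · simp

theorem listJoin_listCoboundary {φ : List X → ℤ} {u : List X → List X → ℤ}
    (hu : ∀ b b', listCoboundary (fun x => u x b') b =
      (-1) ^ b.length * listCoboundary (u b) b') (l m : List X) :
    listJoin (listCoboundary φ) u l m =
      splitSum (fun a b => splitSum (fun a' b' => (-1) ^ (b.length * (a'.length + 1)) *
        (listCoboundary (fun x => φ (x ++ a')) a * u b b')) m) l -
      splitSum (fun a b => splitSum (fun a' b' => (-1) ^ (b.length * (a'.length + 1)) *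
        ((-1) ^ a.length * (-1) ^ (a'.length + 1) * φ (a ++ a') *
          listCoboundary (fun x => u x b') b)) m) l -
      (-1) ^ l.length * (splitSum (fun a b => splitSum (fun a' b' =>
          (-1) ^ (b.length * (a'.length + 1)) *
            ((-1) ^ b.length * listCoboundary (fun x => φ (a ++ x)) a' * u b b')) m) l -
        splitSum (fun a b => splitSum (fun a' b' => (-1) ^ (b.length * (a'.length + 1)) *
          ((-1) ^ a'.length * φ (a ++ a') * listCoboundary (u b) b')) m) l) := by
  rw [← splitSum_sub, ← splitSum_sub, ← splitSum_const_mul, ← splitSum_sub]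
  refine splitSum_congr fun a b hab _ _ _ _ => ?_
  rw [← splitSum_sub, ← splitSum_sub, ← splitSum_const_mul, ← splitSum_sub]
  refine splitSum_congr fun a' b' _ _ _ _ _ => ?_
  rw [listCoboundary_append, hu b b', neg_one_pow_length hab, pow_succ]
  linear_combination (-(-1) ^ (b.length * (a'.length + 1)) * (-1) ^ a.length *
    listCoboundary (fun x => φ (a ++ x)) a' * u b b') * neg_one_pow_mul_self b.length

theorem listCoboundary_listJoin {φ : List X → ℤ} {u : List X → List X → ℤ} (h₁ : ∀ b, u b [] = 0)
    (h₂ : ∀ b, u [] b = 0)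
    (hu : ∀ b b', listCoboundary (fun x => u x b') b =
      (-1) ^ b.length * listCoboundary (u b) b') (l m : List X) :
    listCoboundary (fun x => listJoin φ u x m) l -
      (-1) ^ l.length * listCoboundary (listJoin φ u l) m =
      listJoin (listCoboundary φ) u l m - splitSum (fun a b => (-1) ^ a.length * (φ a * u b m)) l -
      splitSum (fun a' b' => (-1) ^ (l.length * (a'.length + 1)) * (φ a' * u l b')) m := by
  have hcross : splitSum (fun a b => (-1) ^ a.length * (φ a * u b m)) l =
      -((-1) ^ l.length * splitSum (fun a b => (-1) ^ b.length * (φ a * u b m)) l) := by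
    rw [← splitSum_const_mul, ← splitSum_neg]
    refine splitSum_congr fun a b hab _ _ _ _ => ?_
    rw [neg_one_pow_length hab]
    linear_combination (-(-1) ^ a.length * φ a * u b m) * neg_one_pow_mul_self b.length
  rw [listCoboundary_listJoin_left h₂, listCoboundary_listJoin_right h₁,
    listJoin_listCoboundary hu, hcross]
  ring

/-- Multiplication of a cochain or chain by a function of the dimension. -/
def dimScale (ε : ℕ → ℤ) (φ : Simplex X → ℤ) : Simplex X → ℤ := fun σ => ε σ.1 * φ σ

theorem listExt_dimScale (ε : ℕ → ℤ) (φ : Simplex X → ℤ) (l : List X) :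
    listExt (dimScale ε φ) l = ε (l.length - 1) * listExt φ l := by
  rcases eq_or_ne l [] with rfl | h
  · simp
  · obtain ⟨σ, rfl⟩ := exists_vertexList h
    simp [dimScale]

theorem coboundary_dimScale (ε : ℕ → ℤ) (φ : Simplex X → ℤ) :
    coboundary (dimScale ε φ) = dimScale (fun k => ε (k - 1)) (coboundary φ) := by
  funext ⟨k, s⟩
  cases k with
  | zero => simp [coboundary, dimScale]
  | succ k =>
    simp only [coboundary, dimScale, face, Finset.mul_sum, Nat.add_sub_cancel]
    exact Finset.sum_congr rfl fun i _ => by ring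

theorem dimScale_dimScale (ε η : ℕ → ℤ) (φ : Simplex X → ℤ) :
    dimScale ε (dimScale η φ) = dimScale (fun k => ε k * η k) φ := by
  funext σ; simp [dimScale, mul_assoc]

/-- The cup product of cochains, summed over all degrees. -/
def cup (φ ψ : Simplex X → ℤ) : Simplex X → ℤ := fun σ =>
  splitSum (fun a b => listExt φ a * listExt ψ b) (vertexList σ)

theorem coboundary_cup (φ ψ : Simplex X → ℤ) :
    coboundary (cup φ ψ) =
      cup (coboundary φ) ψ + cup (dimScale (fun k => (-1) ^ k) φ) (coboundary ψ) := by
  funext σ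
  rw [coboundary_eq_listCoboundary (φ := cup φ ψ)
    (f := splitSum fun a b => listExt φ a * listExt ψ b) rfl (fun _ => rfl),
    listCoboundary_splitSum (by simp)]
  simp only [cup, Pi.add_apply, listExt_nil, zero_mul, sub_zero, ← listCoboundary_listExt]
  rw [sub_eq_add_neg]
  congr 1
  · refine splitSum_congr fun a b _ _ _ _ _ => ?_
    simp only [mul_comm _ (listExt ψ b)]
    rw [listCoboundary_const_mul]
  · rw [← splitSum_neg]
    refine splitSum_congr fun a b _ _ _ ha _ => ?_
    obtain ⟨k, hk⟩ := Nat.exists_eq_succ_of_ne_zero (mt List.length_eq_zero_iff.1 ha)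
    rw [listCoboundary_const_mul, listExt_dimScale, hk, Nat.succ_sub_one, pow_succ]
    ring

theorem cup_add_right (φ ψ ψ' : Simplex X → ℤ) : cup φ (ψ + ψ') = cup φ ψ + cup φ ψ' := by
  funext σ
  simp only [cup, Pi.add_apply, ← splitSum_add, listExt_add, mul_add]

theorem cup_add_left (φ φ' ψ : Simplex X → ℤ) : cup (φ + φ') ψ = cup φ ψ + cup φ' ψ := by
  funext σ
  simp only [cup, Pi.add_apply, ← splitSum_add, listExt_add, add_mul]

theorem exists_of_cup_ne_zero {σ : Simplex X} (h : cup φ ψ σ ≠ 0) :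
    ∃ α β, φ α ≠ 0 ∧ ψ β ≠ 0 ∧ verts α ⊆ verts σ ∧ verts β ⊆ verts σ ∧ α.1 + β.1 = σ.1 := by
  obtain ⟨a, b, hab, hl, ha, hb⟩ := exists_of_splitSum_ne_zero h
  obtain ⟨α, rfl, hα⟩ := exists_of_listExt_ne_zero (left_ne_zero_of_mul hab)
  obtain ⟨β, rfl, hβ⟩ := exists_of_listExt_ne_zero (right_ne_zero_of_mul hab)
  simp only [length_vertexList] at hl
  exact ⟨α, β, hα, hβ, fun v hv => mem_vertexList.1 (ha (mem_vertexList.2 hv)),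
    fun v hv => mem_vertexList.1 (hb (mem_vertexList.2 hv)), by omega⟩

theorem splitSum_mul_of_eq_zero {f g : List X → ℤ} {e : ℤ} (hg : ∀ x, g [x] = e)
    (hg' : ∀ l, 2 ≤ l.length → g l = 0) {l : List X} (hl : l ≠ []) :
    splitSum (fun a b => f a * g b) l = f l * e := by
  induction l generalizing f with
  | nil => exact absurd rfl hl
  | cons x l ih =>
    rw [splitSum_cons]
    rcases eq_or_ne l [] with rfl | h
    · simp [hg]
    · have hlen : 2 ≤ (x :: l).length := by
        rw [List.length_cons]
        exact Nat.succ_le_succ (List.length_pos_iff.2 h)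
      rw [hg' _ hlen, mul_zero, zero_add]
      exact ih (f := fun a => f (x :: a)) h

theorem cup_eq_mul_const (φ : Simplex X → ℤ) {e : ℤ} (hvertex : ∀ x, ψ ⟨0, x⟩ = e)
    (hpos : ∀ k s, ψ ⟨k + 1, s⟩ = 0) : cup φ ψ = fun σ => φ σ * e := by
  funext σ
  refine (splitSum_mul_of_eq_zero (f := listExt φ) (e := e) (fun x => ?_) (fun l hl => ?_)
    (vertexList_ne_nil σ)).trans (by rw [listExt_vertexList])
  · obtain ⟨⟨k, s⟩, hs⟩ := exists_vertexList (l := [x]) (by simp)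
    have h := length_vertexList (⟨k, s⟩ : Simplex X)
    rw [hs] at h
    obtain rfl : k = 0 := by simpa using h.symm
    rw [← hs, listExt_vertexList, hvertex]
  · obtain ⟨⟨k, s⟩, hs⟩ := exists_vertexList (l := l) (by rintro rfl; simp at hl)
    have h := length_vertexList (⟨k, s⟩ : Simplex X)
    rw [hs] at h
    obtain ⟨j, rfl⟩ : ∃ j, k = j + 1 := ⟨k - 1, by simp only at h; omega⟩
    rw [← hs, listExt_vertexList, hpos]

/-- A cochain of `X ⊗ X` as a function on pairs of lists. -/
def listExt₂ (u : Simplex X × Simplex X → ℤ) (a b : List X) : ℤ :=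
  listExt (fun σ => listExt (fun τ => u (σ, τ)) b) a

theorem listExt₂_nil_left (u : Simplex X × Simplex X → ℤ) (b : List X) : listExt₂ u [] b = 0 := rfl

theorem listExt₂_nil_right (u : Simplex X × Simplex X → ℤ) (a : List X) : listExt₂ u a [] = 0 := by
  rcases eq_or_ne a [] with rfl | h
  · rfl
  · obtain ⟨σ, rfl⟩ := exists_vertexList h
    simp [listExt₂]

theorem listExt₂_vertexList (u : Simplex X × Simplex X → ℤ) (σ τ : Simplex X) :
    listExt₂ u (vertexList σ) (vertexList τ) = u (σ, τ) := by simp [listExt₂]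

theorem listCoboundary_listExt₂ (hu : tensorCoboundary u = 0) (a b : List X) :
    listCoboundary (fun x => listExt₂ u x b) a =
      (-1) ^ a.length * listCoboundary (listExt₂ u a) b := by
  rcases eq_or_ne a [] with rfl | ha
  · change 0 = _ * listCoboundary (fun _ => 0) b
    rw [listCoboundary_zero, mul_zero]
  rcases eq_or_ne b [] with rfl | hb
  · simp only [listExt₂_nil_right, listCoboundary_zero, listCoboundary_nil, mul_zero]
  obtain ⟨σ, rfl⟩ := exists_vertexList ha
  obtain ⟨τ, rfl⟩ := exists_vertexList hb
  have h := congrFun hu (σ, τ)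
  simp only [tensorCoboundary, Pi.zero_apply] at h
  rw [coboundary_eq_listCoboundary (f := fun x => listExt₂ u x (vertexList τ))
      (listExt₂_nil_left u _) (fun ρ => listExt₂_vertexList u ρ τ),
    coboundary_eq_listCoboundary (f := listExt₂ u (vertexList σ)) (listExt₂_nil_right u _)
      (fun ρ => listExt₂_vertexList u σ ρ)] at h
  rw [length_vertexList, pow_succ]
  linear_combination h

/-- The join homotopy `listJoin` for cochains of `X` and of `X ⊗ X`. -/
def joinCochain (φ : Simplex X → ℤ) (u : Simplex X × Simplex X → ℤ) : Simplex X × Simplex X → ℤ :=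
  fun s => listJoin (listExt φ) (listExt₂ u) (vertexList s.1) (vertexList s.2)

theorem exists_of_listExt₂_ne_zero {a b : List X} (h : listExt₂ u a b ≠ 0) :
    ∃ α β, vertexList α = a ∧ vertexList β = b ∧ u (α, β) ≠ 0 := by
  obtain ⟨α, rfl, hα⟩ := exists_of_listExt_ne_zero h
  obtain ⟨β, rfl, hβ⟩ := exists_of_listExt_ne_zero hα
  exact ⟨α, β, rfl, rfl, hβ⟩

theorem exists_of_joinCochain_ne_zero {s : Simplex X × Simplex X} (h : joinCochain φ u s ≠ 0) :
    ∃ ρ α β, φ ρ ≠ 0 ∧ u (α, β) ≠ 0 ∧ verts ρ ⊆ verts s.1 ∪ verts s.2 ∧ verts α ⊆ verts s.1 ∧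
      verts β ⊆ verts s.2 ∧ ρ.1 + α.1 + β.1 = s.1.1 + s.2.1 + 1 := by
  obtain ⟨a, b, hab, hlen, ha, hb⟩ := exists_of_splitSum_ne_zero h
  obtain ⟨a', b', hab', hlen', ha', hb'⟩ := exists_of_splitSum_ne_zero hab
  have hprod := right_ne_zero_of_mul hab'
  obtain ⟨ρ, hρ, hρ0⟩ := exists_of_listExt_ne_zero (left_ne_zero_of_mul hprod)
  obtain ⟨α, β, rfl, rfl, hu⟩ := exists_of_listExt₂_ne_zero (right_ne_zero_of_mul hprod)
  have hjoin := congrArg List.length hρ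
  simp only [length_vertexList, List.length_append] at hjoin hlen hlen'
  refine ⟨ρ, α, β, hρ0, hu, fun v hv => ?_, fun v hv => mem_vertexList.1 (hb (mem_vertexList.2 hv)),
    fun v hv => mem_vertexList.1 (hb' (mem_vertexList.2 hv)), by omega⟩
  rw [← mem_vertexList, hρ, List.mem_append] at hv
  exact hv.imp (fun h => mem_vertexList.1 (ha h)) (fun h => mem_vertexList.1 (ha' h))

theorem joinCochain_add (φ ψ : Simplex X → ℤ) (u : Simplex X × Simplex X → ℤ) :
    joinCochain (φ + ψ) u = joinCochain φ u + joinCochain ψ u := by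
  funext s
  simp only [joinCochain, listJoin, listExt_add, Pi.add_apply, add_mul, mul_add, splitSum_add]

/-- The product of `u` with the cochain `φ` in the first factor. -/
def cupFst (φ : Simplex X → ℤ) (u : Simplex X × Simplex X → ℤ) : Simplex X × Simplex X → ℤ :=
  fun s => cup φ (fun σ => u (σ, s.2)) s.1

/-- The product of `u` with the cochain `φ` in the second factor, with the sign it has in
`tensorCoboundary_joinCochain`. -/
def cupSnd (φ : Simplex X → ℤ) (u : Simplex X × Simplex X → ℤ) : Simplex X × Simplex X → ℤ :=
  fun s => cup (dimScale (fun k => (-1) ^ ((s.1.1 + 1) * k)) φ) (fun τ => u (s.1, τ)) s.2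

theorem cupFst_dimScale_apply (φ : Simplex X → ℤ) (u : Simplex X × Simplex X → ℤ)
    (σ τ : Simplex X) :
    cupFst (dimScale (fun k => (-1) ^ k) φ) u (σ, τ) = -splitSum (fun a b =>
      (-1) ^ a.length * (listExt φ a * listExt₂ u b (vertexList τ))) (vertexList σ) := by
  rw [← splitSum_neg]
  refine splitSum_congr fun a b _ _ _ ha hb => ?_
  obtain ⟨α, rfl⟩ := exists_vertexList ha
  obtain ⟨β, rfl⟩ := exists_vertexList hb
  simp only [listExt_vertexList, listExt₂_vertexList, length_vertexList, dimScale, pow_succ]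
  ring

theorem cupSnd_apply (φ : Simplex X → ℤ) (u : Simplex X × Simplex X → ℤ) (σ τ : Simplex X) :
    cupSnd φ u (σ, τ) = splitSum (fun a b => (-1) ^ ((σ.1 + 1) * (a.length + 1)) *
      (listExt φ a * listExt₂ u (vertexList σ) b)) (vertexList τ) := by
  refine splitSum_congr fun a b _ _ _ ha hb => ?_
  obtain ⟨α, rfl⟩ := exists_vertexList ha
  obtain ⟨β, rfl⟩ := exists_vertexList hb
  simp only [listExt_vertexList, listExt₂_vertexList, length_vertexList, dimScale]
  have hexp : (σ.1 + 1) * (α.1 + 1 + 1) = (σ.1 + 1) * α.1 + 2 * (σ.1 + 1) := by ring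
  rw [hexp, pow_add, (even_two_mul _).neg_one_pow]
  ring

theorem tensorCoboundary_joinCochain (φ : Simplex X → ℤ) (hu : tensorCoboundary u = 0) :
    tensorCoboundary (joinCochain φ u) =
      joinCochain (coboundary φ) u + cupFst (dimScale (fun k => (-1) ^ k) φ) u - cupSnd φ u := by
  funext ⟨σ, τ⟩
  have hnil (l : List X) : listJoin (listExt φ) (listExt₂ u) l [] = 0 := splitSum_zero l
  have h := listCoboundary_listJoin (φ := listExt φ) (listExt₂_nil_right u) (listExt₂_nil_left u)
    (listCoboundary_listExt₂ hu) (vertexList σ) (vertexList τ)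
  rw [listCoboundary_listExt, length_vertexList, pow_succ] at h
  simp only [tensorCoboundary, Pi.add_apply, Pi.sub_apply]
  rw [coboundary_eq_listCoboundary (φ := fun σ => joinCochain φ u (σ, τ))
      (f := fun x => listJoin (listExt φ) (listExt₂ u) x (vertexList τ)) rfl (fun _ => rfl),
    coboundary_eq_listCoboundary (φ := fun τ => joinCochain φ u (σ, τ))
      (f := listJoin (listExt φ) (listExt₂ u) (vertexList σ)) (hnil _) (fun _ => rfl),
    cupFst_dimScale_apply, cupSnd_apply]
  simp only [joinCochain]
  linear_combination h

end Products

/-! ### Control of supports -/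

section Control

variable {X : Type*}

theorem zero_mem_verts (σ : Simplex X) : σ.2 0 ∈ verts σ := ⟨0, rfl⟩

theorem finite_verts (σ : Simplex X) : (verts σ).Finite := Set.finite_range _

theorem finite_simplices {S : Set X} (hS : S.Finite) (n : ℕ) :
    {σ : Simplex X | verts σ ⊆ S ∧ σ.1 ≤ n}.Finite := by
  have hfin (k : ℕ) : {s : Fin (k + 1) → X | ∀ i, s i ∈ S}.Finite := Set.Finite.pi' fun _ => hS
  refine ((Set.finite_Iic n).biUnion fun k _ =>
    (hfin k).image fun s => (⟨k, s⟩ : Simplex X)).subset ?_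
  rintro ⟨k, s⟩ ⟨hS', hk⟩
  exact Set.mem_biUnion (x := k) hk ⟨s, fun i => hS' ⟨i, rfl⟩, rfl⟩

variable [MetricSpace X] {σ ρ τ : Simplex X} {R R' : ℝ} {φ ψ χ c : Simplex X → ℤ}
  {u : Simplex X × Simplex X → ℤ} {n k : ℤ}

/-- All vertices of `σ` are at distance at most `R` from all vertices of `ρ`. -/
def Within (R : ℝ) (σ ρ : Simplex X) : Prop :=
  ∀ v ∈ verts σ, ∀ w ∈ verts ρ, dist v w ≤ R

theorem Within.symm (h : Within R σ ρ) : Within R ρ σ :=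
  fun v hv w hw => by rw [dist_comm]; exact h w hw v hv

theorem Within.mono (h : Within R σ ρ) (hR : R ≤ R') : Within R' σ ρ :=
  fun v hv w hw => (h v hv w hw).trans hR

theorem Within.nonneg (h : Within R σ ρ) : 0 ≤ R :=
  dist_nonneg.trans (h _ (zero_mem_verts σ) _ (zero_mem_verts ρ))

theorem Within.trans (h : Within R σ ρ) (h' : Within R' ρ τ) : Within (R + R') σ τ :=
  fun v hv w hw => (dist_triangle v (ρ.2 0) w).trans
    (add_le_add (h v hv _ (zero_mem_verts ρ)) (h' _ (zero_mem_verts ρ) w hw))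

theorem Within.subset {σ ρ σ' ρ' : Simplex X} (h : Within R σ ρ) (hσ : verts σ' ⊆ verts σ)
    (hρ : verts ρ' ⊆ verts ρ) : Within R σ' ρ' :=
  fun v hv w hw => h v (hσ hv) w (hρ hw)

theorem exists_within (σ ρ : Simplex X) : ∃ R, Within R σ ρ := by
  obtain ⟨R, hR⟩ := ((finite_verts σ).prod (finite_verts ρ)).image (fun p => dist p.1 p.2)
    |>.bddAbove
  exact ⟨R, fun v hv w hw => hR ⟨(v, w), ⟨hv, hw⟩, rfl⟩⟩

theorem within_of_dist_const {x : X} (h : dist (stab σ) (EvConst.const x) ≤ R) :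
    Within (R + R) σ σ := fun v hv w hw =>
  (dist_triangle_right v w x).trans
    (add_le_add (dist_stab_const_le.1 h v hv) (dist_stab_const_le.1 h w hw))

theorem dist_stab_le (h : Within R σ ρ) : dist (stab σ) (stab ρ) ≤ R :=
  EvConst.dist_le_iff.2 fun _ => h _ ⟨_, rfl⟩ _ ⟨_, rfl⟩

theorem within_of_dist_stab (h : dist (stab σ) (stab ρ) ≤ R) (hσ : Within R' σ σ) :
    Within (R' + R) σ ρ := by
  rintro v hv _ ⟨j, rfl⟩
  have hdist := EvConst.dist_le_iff.1 h j
  have hj : (⟨min (j : ℕ) ρ.1, Nat.lt_succ_of_le (min_le_right _ _)⟩ : Fin (ρ.1 + 1)) = j :=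
    Fin.ext (min_eq_left (Nat.le_of_lt_succ j.2))
  simp only [stab, hj] at hdist
  exact (dist_triangle _ _ _).trans (add_le_add (hσ v hv _ ⟨_, rfl⟩) hdist)

theorem CoarseChain.exists_within (hc : c ∈ CoarseChain X k) :
    ∃ R, ∀ σ, c σ ≠ 0 → Within R σ σ := by
  rcases isEmpty_or_nonempty X with hX | ⟨⟨x⟩⟩
  · exact ⟨0, fun σ => isEmptyElim (σ.2 0)⟩
  · obtain ⟨R, hR⟩ := hc.2.2.exists_thickening ⟨_, x, trivial, rfl⟩
    refine ⟨R + R, fun σ hσ => ?_⟩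
    obtain ⟨_, ⟨y, -, rfl⟩, hy⟩ := mem_thickening_iff.1 (hR ⟨σ, hσ, rfl⟩)
    exact within_of_dist_const hy.le

theorem mem_coarseChain (hdeg : c ∈ Cochain X k)
    (hfin : ∀ x r, {σ : Simplex X | c σ ≠ 0 ∧ ∃ v ∈ verts σ, dist v x ≤ r}.Finite)
    (hsize : ∀ σ, c σ ≠ 0 → Within R σ σ) : c ∈ CoarseChain X k := by
  refine ⟨hdeg, fun B hB => ?_, Or.inr ⟨R + 1, ?_⟩⟩
  · rcases isEmpty_or_nonempty X with hX | ⟨⟨x⟩⟩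
    · exact Set.toFinite _ |>.subset (s := ∅) fun σ => isEmptyElim (σ.2 0)
    · obtain ⟨r, hr⟩ := hB.subset_closedBall x
      exact (hfin x r).subset fun σ ⟨hσ, i, hi⟩ => ⟨hσ, σ.2 i, ⟨i, rfl⟩, hr hi⟩
  · rintro _ ⟨σ, hσ, rfl⟩
    refine mem_thickening_iff.2 ⟨_, ⟨σ.2 0, trivial, rfl⟩, ?_⟩
    exact (dist_stab_const_le.2 fun v hv => hsize σ hσ v hv _ (zero_mem_verts σ)).trans_lt
      (lt_add_one _)

theorem CoarseChain.of_support {d : Simplex X → ℤ} (hc : c ∈ CoarseChain X k)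
    (h : ∀ σ, d σ ≠ 0 → c σ ≠ 0) : d ∈ CoarseChain X k :=
  ⟨fun σ hσ => hc.1 σ (h σ hσ), fun B hB => (hc.2.1 B hB).subset fun σ hσ => ⟨h σ hσ.1, hσ.2⟩,
    hc.2.2.mono (Set.image_mono h)⟩

theorem CoarseChain.finite_near (hc : c ∈ CoarseChain X k) (x : X) (r : ℝ) :
    {σ : Simplex X | c σ ≠ 0 ∧ ∃ v ∈ verts σ, dist v x ≤ r}.Finite := by
  refine (hc.2.1 (closedBall x r) isBounded_closedBall).subset ?_
  rintro σ ⟨hσ, _, ⟨i, rfl⟩, hi⟩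
  exact ⟨hσ, i, hi⟩

theorem TensorCochain.exists_within (hu : u ∈ TensorCochain X n) (R : ℝ) :
    ∃ R', ∀ α β, u (α, β) ≠ 0 → Within R α α → Within R β β → Within R' α β := by
  rcases isEmpty_or_nonempty X with hX | ⟨⟨x⟩⟩
  · exact ⟨0, fun α => isEmptyElim (α.2 0)⟩
  · obtain ⟨R', hR'⟩ := (hu.2 (R + 1)).exists_thickening ⟨_, _, ⟨x, rfl⟩, rfl⟩
    refine ⟨R' + R', fun α β h hα hβ => ?_⟩
    have hR := hα.nonneg
    have hnear : stab (grid (α, β)) ∈ thickening R' (diag (Set.range fun x : X => (x, x))) := by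
      refine hR' ⟨self_subset_thickening (by linarith) _ ⟨_, ⟨_, h, rfl⟩, rfl⟩,
        mem_thickening_iff.2 ⟨_, ⟨(α.2 0, β.2 0), trivial, rfl⟩, ?_⟩⟩
      refine lt_of_le_of_lt (dist_stab_const_le.2 ?_) (lt_add_one _)
      rw [verts_grid]
      rintro ⟨v, w⟩ ⟨hv, hw⟩
      exact max_le (hα v hv _ (zero_mem_verts α)) (hβ w hw _ (zero_mem_verts β))
    obtain ⟨_, ⟨_, ⟨z, rfl⟩, rfl⟩, hz⟩ := mem_thickening_iff.1 hnear
    intro v hv w hw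
    have hzvw := dist_stab_const_le.1 hz.le (v, w) (by rw [verts_grid]; exact ⟨hv, hw⟩)
    rw [Prod.dist_eq, max_le_iff] at hzvw
    exact (dist_triangle_right v w z).trans (add_le_add hzvw.1 hzvw.2)

theorem mem_tensorCochain (hdeg : ∀ s, u s ≠ 0 → (s.1.1 : ℤ) + s.2.1 = n)
    (hnear : ∀ R, ∃ R', ∀ α β, u (α, β) ≠ 0 → Within R α α → Within R β β → Within R' α β) :
    u ∈ TensorCochain X n := by
  refine ⟨hdeg, fun R => ?_⟩
  obtain ⟨R', hR'⟩ := hnear (2 * R + 2 * R)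
  refine Or.inr ⟨R + max (2 * R + 2 * R) R', ?_⟩
  rintro z ⟨hz1, hz2⟩
  obtain ⟨_, ⟨_, ⟨⟨α, β⟩, hs, rfl⟩, rfl⟩, hzs⟩ := mem_thickening_iff.1 hz1
  obtain ⟨_, ⟨⟨x, y⟩, -, rfl⟩, hzx⟩ := mem_thickening_iff.1 hz2
  have hdist : dist (stab (grid (α, β))) (EvConst.const (x, y)) ≤ 2 * R := by
    linarith [dist_triangle_left (stab (grid (α, β))) (EvConst.const (x, y)) z]
  have hcoord := dist_stab_const_le.1 hdist
  rw [verts_grid] at hcoord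
  have hα : Within (2 * R + 2 * R) α α := within_of_dist_const (x := x)
    (dist_stab_const_le.2 fun v hv =>
      (max_le_iff.1 (hcoord (v, β.2 0) ⟨hv, zero_mem_verts β⟩)).1)
  have hβ : Within (2 * R + 2 * R) β β := within_of_dist_const (x := y)
    (dist_stab_const_le.2 fun w hw =>
      (max_le_iff.1 (hcoord (α.2 0, w) ⟨zero_mem_verts α, hw⟩)).2)
  have hαβ := hR' α β hs hα hβ
  refine mem_thickening_iff.2 ⟨_, ⟨_, ⟨α.2 0, rfl⟩, rfl⟩, ?_⟩
  refine (dist_triangle _ _ _).trans_lt (add_lt_add_of_lt_of_le hzs (dist_stab_const_le.2 ?_))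
  rw [verts_grid]
  rintro ⟨v, w⟩ ⟨hv, hw⟩
  exact max_le_max (hα v hv _ (zero_mem_verts α)) (hαβ.symm w hw _ (zero_mem_verts α))

/-- The relation `|ψ| ∩_c Δ ⊂_c |φ|` in terms of simplices: those of bounded size on which `ψ` is
non-zero are near the support of `φ`. Unlike `⊂_c`, it forces `ψ = 0` near `Δ` when `φ = 0`. -/
def NearSupp (ψ φ : Simplex X → ℤ) : Prop :=
  ∀ R, ∃ R', ∀ σ, ψ σ ≠ 0 → Within R σ σ → ∃ ρ, φ ρ ≠ 0 ∧ Within R' σ ρ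

theorem NearSupp.coarseInterContained (h : NearSupp ψ φ) :
    CoarseInterContained (supp ψ) (diag Set.univ) (supp φ) := by
  intro R
  obtain ⟨R', hR'⟩ := h (2 * R + 2 * R)
  refine Or.inr ⟨R + R', ?_⟩
  rintro z ⟨hz1, hz2⟩
  obtain ⟨_, ⟨σ, hσ, rfl⟩, hzσ⟩ := mem_thickening_iff.1 hz1
  obtain ⟨_, ⟨x, -, rfl⟩, hzx⟩ := mem_thickening_iff.1 hz2
  have hdist : dist (stab σ) (EvConst.const x) ≤ 2 * R := by
    linarith [dist_triangle_left (stab σ) (EvConst.const x) z]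
  obtain ⟨ρ, hρ, hw⟩ := hR' σ hσ (within_of_dist_const hdist)
  exact mem_thickening_iff.2 ⟨_, ⟨ρ, hρ, rfl⟩,
    (dist_triangle _ _ _).trans_lt (add_lt_add_of_lt_of_le hzσ (dist_stab_le hw))⟩

theorem NearSupp.coarselyContained (h : NearSupp c φ) (hc : c ∈ CoarseChain X k) :
    CoarselyContained (supp c) (supp φ) := by
  obtain ⟨R, hR⟩ := CoarseChain.exists_within hc
  obtain ⟨R', hR'⟩ := h R
  refine Or.inr ⟨R' + 1, ?_⟩
  rintro _ ⟨σ, hσ, rfl⟩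
  obtain ⟨ρ, hρ, hw⟩ := hR' σ hσ (hR σ hσ)
  exact mem_thickening_iff.2 ⟨_, ⟨ρ, hρ, rfl⟩, (dist_stab_le hw).trans_lt (lt_add_one _)⟩

theorem CoarseInterContained.nearSupp (h : CoarseInterContained (supp ψ) (diag Set.univ) (supp φ))
    (hφ : φ ≠ 0) : NearSupp ψ φ := by
  obtain ⟨ρ₀, hρ₀⟩ := Function.ne_iff.1 hφ
  intro R
  obtain ⟨R', hR'⟩ := (h (R + 1)).exists_thickening ⟨_, ρ₀, hρ₀, rfl⟩
  refine ⟨R + R', fun σ hσ hR => ?_⟩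
  have hnear : stab σ ∈ thickening R' (supp φ) := by
    refine hR' ⟨self_subset_thickening (by linarith [hR.nonneg]) _ ⟨_, hσ, rfl⟩,
      mem_thickening_iff.2 ⟨_, ⟨σ.2 0, trivial, rfl⟩, ?_⟩⟩
    exact (dist_stab_const_le.2 fun v hv => hR v hv _ (zero_mem_verts σ)).trans_lt (lt_add_one _)
  obtain ⟨_, ⟨ρ, hρ, rfl⟩, hz⟩ := mem_thickening_iff.1 hnear
  exact ⟨ρ, hρ, within_of_dist_stab hz.le hR⟩

theorem NearSupp.trans (h : NearSupp χ ψ) (h' : NearSupp ψ φ) : NearSupp χ φ := by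
  intro R
  obtain ⟨R', hR'⟩ := h R
  obtain ⟨R'', hR''⟩ := h' (R' + R')
  refine ⟨R' + R'', fun σ hσ hR => ?_⟩
  obtain ⟨ρ, hρ, hw⟩ := hR' σ hσ hR
  obtain ⟨τ, hτ, hw'⟩ := hR'' ρ hρ (hw.symm.trans hw)
  exact ⟨τ, hτ, hw.trans hw'⟩

theorem NearSupp.add {ψ' : Simplex X → ℤ} (h : NearSupp ψ φ) (h' : NearSupp ψ' φ) :
    NearSupp (ψ + ψ') φ := by
  intro R
  obtain ⟨R₁, h₁⟩ := h R
  obtain ⟨R₂, h₂⟩ := h' R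
  refine ⟨max R₁ R₂, fun σ hσ hR => ?_⟩
  by_cases h0 : ψ σ = 0
  · obtain ⟨ρ, hρ, hw⟩ := h₂ σ (fun h' => hσ (by simp [h0, h'])) hR
    exact ⟨ρ, hρ, hw.mono (le_max_right _ _)⟩
  · obtain ⟨ρ, hρ, hw⟩ := h₁ σ h0 hR
    exact ⟨ρ, hρ, hw.mono (le_max_left _ _)⟩

theorem nearSupp_of_imp (h : ∀ σ, ψ σ ≠ 0 → φ σ ≠ 0) : NearSupp ψ φ :=
  fun R => ⟨R, fun σ hσ hR => ⟨σ, h σ hσ, hR⟩⟩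

theorem NearSupp.mono {ψ' : Simplex X → ℤ} (h : NearSupp ψ φ)
    (h' : ∀ σ, ψ' σ ≠ 0 → ψ σ ≠ 0) : NearSupp ψ' φ :=
  (nearSupp_of_imp h').trans h

end Control

/-! ### Transposition of operators on cochains -/

section Transpose

variable {X : Type*} {c : Simplex X → ℤ} {ρ σ : Simplex X} {S : Finset (Simplex X)}
  {T : (Simplex X → ℤ) →+ (Simplex X → ℤ)}

open Classical in
/-- The indicator cochain of the simplex `ρ`. -/
noncomputable def delta (ρ : Simplex X) : Simplex X → ℤ := fun σ => if σ = ρ then 1 else 0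

@[simp] theorem delta_self (ρ : Simplex X) : delta ρ ρ = 1 := if_pos rfl

theorem delta_of_ne (h : σ ≠ ρ) : delta ρ σ = 0 := if_neg h

theorem eq_of_delta_ne_zero (h : delta ρ σ ≠ 0) : σ = ρ := by
  by_contra h'
  exact h (delta_of_ne h')

theorem finsum_mul_delta (c : Simplex X → ℤ) (ρ : Simplex X) : ∑ᶠ σ, c σ * delta ρ σ = c ρ := by
  rw [finsum_eq_single _ ρ fun σ h => by rw [delta_of_ne h, mul_zero], delta_self, mul_one]

/-- The transpose of an operator on cochains, applied to a chain. For a local operator and a coarse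
chain the sum is finite; otherwise it may take the junk value `0`. -/
noncomputable def transpose (T : (Simplex X → ℤ) →+ (Simplex X → ℤ)) (c : Simplex X → ℤ) :
    Simplex X → ℤ := fun ρ => ∑ᶠ σ, c σ * T (delta ρ) σ

theorem exists_of_transpose_ne_zero (h : transpose T c ρ ≠ 0) :
    ∃ σ, c σ ≠ 0 ∧ T (delta ρ) σ ≠ 0 := by
  by_contra! hzero
  refine h ((finsum_congr fun σ => ?_).trans finsum_zero)
  by_cases hσ : c σ = 0
  · rw [hσ, zero_mul]
  · rw [hzero σ hσ, mul_zero]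

/-- The value of `T ψ` at `σ` only depends on the values of `ψ` on the finite set `S`. -/
def DeterminedOn (T : (Simplex X → ℤ) →+ (Simplex X → ℤ)) (σ : Simplex X)
    (S : Finset (Simplex X)) : Prop :=
  ∀ ψ : Simplex X → ℤ, (∀ ρ ∈ S, ψ ρ = 0) → T ψ σ = 0

theorem DeterminedOn.mem (h : DeterminedOn T σ S) (hne : T (delta ρ) σ ≠ 0) : ρ ∈ S := by
  by_contra hρ
  exact hne (h _ fun ρ' hρ' => delta_of_ne fun heq => hρ (heq ▸ hρ'))

theorem DeterminedOn.finite_support (h : DeterminedOn T σ S) (ψ : Simplex X → ℤ) :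
    (Function.support fun ρ => T (delta ρ) σ * ψ ρ).Finite :=
  S.finite_toSet.subset fun _ hρ => h.mem (left_ne_zero_of_mul hρ)

theorem DeterminedOn.apply_eq (h : DeterminedOn T σ S) (ψ : Simplex X → ℤ) :
    T ψ σ = ∑ᶠ ρ, T (delta ρ) σ * ψ ρ := by
  rw [finsum_eq_finsetSum_of_support_subset (s := S) _
    fun ρ hρ => h.mem (left_ne_zero_of_mul hρ)]
  have hdiff := h (ψ - ∑ ρ ∈ S, ψ ρ • delta ρ) fun ρ hρ => by
    rw [Pi.sub_apply, Finset.sum_apply, Finset.sum_eq_single_of_mem ρ hρ]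
    · simp
    · intro ρ' _ hne
      rw [Pi.smul_apply, delta_of_ne hne.symm, smul_zero]
  rw [map_sub, map_sum, Pi.sub_apply, sub_eq_zero] at hdiff
  rw [hdiff, Finset.sum_apply]
  refine Finset.sum_congr rfl fun ρ _ => ?_
  rw [map_zsmul, Pi.smul_apply, smul_eq_mul, mul_comm]

variable [MetricSpace X] {k m : ℤ}

/-- Locality of an operator on cochains: its value at a simplex of bounded size only depends on the
values at finitely many simplices within bounded distance. -/
def IsLocal (T : (Simplex X → ℤ) →+ (Simplex X → ℤ)) : Prop :=
  ∀ R, ∃ R', ∀ σ, Within R σ σ → ∃ S : Finset (Simplex X),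
    (∀ ρ ∈ S, Within R' σ ρ) ∧ DeterminedOn T σ S

theorem transpose_finite (hT : IsLocal T) (hc : c ∈ CoarseChain X k) (x : X) (r : ℝ) :
    {σ | c σ ≠ 0 ∧ ∃ ρ, T (delta ρ) σ ≠ 0 ∧ ∃ v ∈ verts ρ, dist v x ≤ r}.Finite := by
  obtain ⟨R, hR⟩ := CoarseChain.exists_within hc
  obtain ⟨R', hR'⟩ := hT R
  refine (CoarseChain.finite_near hc x (R' + r)).subset ?_
  rintro σ ⟨hσ, ρ, hρ, v, hv, hvx⟩
  obtain ⟨S, hS, hd⟩ := hR' σ (hR σ hσ)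
  exact ⟨hσ, σ.2 0, zero_mem_verts σ, (dist_triangle _ v _).trans
    (add_le_add (hS ρ (hd.mem hρ) _ (zero_mem_verts σ) v hv) hvx)⟩

theorem transpose_mem (hT : IsLocal T) (hc : c ∈ CoarseChain X k)
    (hdeg : ∀ σ ρ, c σ ≠ 0 → T (delta ρ) σ ≠ 0 → (ρ.1 : ℤ) = m) :
    transpose T c ∈ CoarseChain X m := by
  obtain ⟨R, hR⟩ := CoarseChain.exists_within hc
  obtain ⟨R', hR'⟩ := hT R
  choose! S hS hd using hR'
  refine mem_coarseChain (R := R' + R') (fun ρ hρ => ?_) (fun x r => ?_) fun ρ hρ => ?_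
  · obtain ⟨σ, hσ, h⟩ := exists_of_transpose_ne_zero hρ
    exact hdeg σ ρ hσ h
  · refine ((transpose_finite hT hc x r).biUnion fun σ _ => (S σ).finite_toSet).subset ?_
    rintro ρ ⟨hρ, hv⟩
    obtain ⟨σ, hσ, h⟩ := exists_of_transpose_ne_zero hρ
    exact Set.mem_biUnion (x := σ) ⟨hσ, ρ, h, hv⟩ ((hd σ (hR σ hσ)).mem h)
  · obtain ⟨σ, hσ, h⟩ := exists_of_transpose_ne_zero hρ
    have := hS σ (hR σ hσ) ρ ((hd σ (hR σ hσ)).mem h)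
    exact this.symm.trans this

theorem transpose_nearSupp (hT : IsLocal T) (hc : c ∈ CoarseChain X k) :
    NearSupp (transpose T c) c := by
  obtain ⟨R, hR⟩ := CoarseChain.exists_within hc
  obtain ⟨R', hR'⟩ := hT R
  refine fun _ => ⟨R', fun ρ hρ _ => ?_⟩
  obtain ⟨σ, hσ, h⟩ := exists_of_transpose_ne_zero hρ
  obtain ⟨S, hS, hd⟩ := hR' σ (hR σ hσ)
  exact ⟨σ, hσ, (hS ρ (hd.mem h)).symm⟩

theorem finsum_transpose_mul (hT : IsLocal T) (hc : c ∈ CoarseChain X k) {ψ : Simplex X → ℤ}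
    (hfin : {σ | c σ ≠ 0 ∧ ∃ ρ, ψ ρ ≠ 0 ∧ T (delta ρ) σ ≠ 0}.Finite) :
    ∑ᶠ ρ, transpose T c ρ * ψ ρ = ∑ᶠ σ, c σ * T ψ σ := by
  obtain ⟨R, hR⟩ := CoarseChain.exists_within hc
  obtain ⟨R', hR'⟩ := hT R
  choose! S _ hd using hR'
  have hentry : ∀ ρ, transpose T c ρ * ψ ρ =
      ∑ σ ∈ hfin.toFinset, c σ * (T (delta ρ) σ * ψ ρ) := by
    intro ρ
    by_cases hψ : ψ ρ = 0
    · simp [hψ]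
    · rw [transpose, finsum_eq_finsetSum_of_support_subset (s := hfin.toFinset), Finset.sum_mul]
      · exact Finset.sum_congr rfl fun σ _ => mul_assoc _ _ _
      · intro σ hσ
        rw [Set.Finite.coe_toFinset]
        exact ⟨left_ne_zero_of_mul hσ, ρ, hψ, right_ne_zero_of_mul hσ⟩
  have hsum : ∑ᶠ σ, c σ * T ψ σ = ∑ σ ∈ hfin.toFinset, c σ * T ψ σ := by
    refine finsum_eq_finsetSum_of_support_subset _ fun σ hσ => ?_
    have hc0 := left_ne_zero_of_mul hσ
    have hT0 := right_ne_zero_of_mul hσ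
    rw [(hd σ (hR σ hc0)).apply_eq] at hT0
    obtain ⟨ρ, hρ⟩ : ∃ ρ, T (delta ρ) σ * ψ ρ ≠ 0 := by
      by_contra! hzero
      exact hT0 ((finsum_congr hzero).trans finsum_zero)
    rw [Set.Finite.coe_toFinset]
    exact ⟨hc0, ρ, right_ne_zero_of_mul hρ, left_ne_zero_of_mul hρ⟩
  rw [finsum_congr hentry, hsum, finsum_sum_comm]
  · refine Finset.sum_congr rfl fun σ hσ => ?_
    rw [Set.Finite.mem_toFinset] at hσ
    rw [(hd σ (hR σ hσ.1)).apply_eq ψ, mul_finsum]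
  · intro σ hσ
    rw [Set.Finite.mem_toFinset] at hσ
    exact ((hd σ (hR σ hσ.1)).finite_support ψ).subset fun ρ hρ => right_ne_zero_of_mul hρ

theorem boundary_transpose (hT : IsLocal T) (hc : c ∈ CoarseChain X k)
    (hm : transpose T c ∈ CoarseChain X m) (ρ : Simplex X) :
    boundary (transpose T c) ρ = ∑ᶠ σ, c σ * T (coboundary (delta ρ)) σ := by
  rw [← finsum_mul_delta (boundary (transpose T c)), finsum_boundary_mul,
    finsum_transpose_mul hT hc]
  · refine (transpose_finite hT hc (ρ.2 0) 0).subset ?_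
    rintro σ ⟨hσ, τ, hτ, h⟩
    obtain ⟨ρ', hρ', hv, -⟩ := coboundary_ne_zero hτ
    rw [eq_of_delta_ne_zero hρ'] at hv
    exact ⟨hσ, τ, h, ρ.2 0, hv (zero_mem_verts ρ), (dist_self _).le⟩
  · refine (CoarseChain.finite_near hm (ρ.2 0) 0).subset ?_
    rintro σ ⟨hσ, τ, hτ, h⟩
    rw [eq_of_delta_ne_zero h] at hτ
    exact ⟨hσ, ρ.2 0, hτ (zero_mem_verts ρ), (dist_self _).le⟩

theorem transpose_boundary (hT : IsLocal T) (hc : c ∈ CoarseChain X k) (ρ : Simplex X) :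
    transpose T (boundary c) ρ = ∑ᶠ σ, c σ * coboundary (T (delta ρ)) σ := by
  refine finsum_boundary_mul ?_
  obtain ⟨R, hR⟩ := CoarseChain.exists_within hc
  obtain ⟨R', hR'⟩ := hT R
  refine (CoarseChain.finite_near hc (ρ.2 0) R').subset ?_
  rintro σ ⟨hσ, τ, hτ, h⟩
  obtain ⟨S, hS, hd⟩ := hR' τ ((hR σ hσ).subset hτ hτ)
  exact ⟨hσ, τ.2 0, hτ (zero_mem_verts τ),
    hS ρ (hd.mem h) _ (zero_mem_verts τ) _ (zero_mem_verts ρ)⟩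

end Transpose

/-! ### Cup and cap products as local operators -/

section Operators

variable {X : Type*} {φ ψ c : Simplex X → ℤ} {u K : Simplex X × Simplex X → ℤ}
  {T : (Simplex X → ℤ) →+ (Simplex X → ℤ)} {σ τ : Simplex X} {S : Set X} {n k l m : ℤ}

theorem cup_congr {φ' ψ' : Simplex X → ℤ} {r : ℤ}
    (h : ∀ α β, verts α ⊆ verts σ → verts β ⊆ verts σ → α.1 + β.1 = σ.1 →
      φ α * ψ β = r * (φ' α * ψ' β)) :
    cup φ ψ σ = r * cup φ' ψ' σ := by
  simp only [cup]
  rw [← splitSum_const_mul]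
  refine splitSum_congr fun a b hl ha hb ha0 hb0 => ?_
  obtain ⟨α, rfl⟩ := exists_vertexList ha0
  obtain ⟨β, rfl⟩ := exists_vertexList hb0
  simp only [length_vertexList] at hl
  simp only [listExt_vertexList]
  exact h α β (fun v hv => mem_vertexList.1 (ha (mem_vertexList.2 hv)))
    (fun v hv => mem_vertexList.1 (hb (mem_vertexList.2 hv))) (by omega)

theorem cup_neg_left (φ ψ : Simplex X → ℤ) (σ : Simplex X) : cup (-φ) ψ σ = -cup φ ψ σ := by
  rw [← neg_one_mul (cup φ ψ σ)]
  exact cup_congr fun α β _ _ _ => by simp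

theorem delta_dimScale (ε : ℕ → ℤ) (ρ : Simplex X) :
    dimScale ε (delta ρ) = fun σ => ε ρ.1 * delta ρ σ := by
  funext σ
  by_cases h : σ = ρ
  · rw [h]; rfl
  · simp [dimScale, delta_of_ne h]

theorem boundary_dimScale (ε : ℕ → ℤ) (c : Simplex X → ℤ) :
    boundary (dimScale ε c) = dimScale (fun k => ε (k + 1)) (boundary c) := by
  funext τ
  simp only [boundary, dimScale, insertVertex, Finset.mul_sum]
  refine Finset.sum_congr rfl fun i _ => ?_
  simp only [← smul_eq_mul (ε (τ.1 + 1))]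
  rw [← smul_finsum, smul_eq_mul, smul_eq_mul]
  ring

theorem dimScale_add (ε : ℕ → ℤ) (φ ψ : Simplex X → ℤ) :
    dimScale ε (φ + ψ) = dimScale ε φ + dimScale ε ψ := by
  funext σ; simp [dimScale, mul_add]

theorem dimScale_mem {ε : ℕ → ℤ} (hφ : φ ∈ Cochain X k) :
    dimScale ε φ ∈ Cochain X k := fun σ hσ => hφ σ (right_ne_zero_of_mul hσ)

/-- Cup product with `φ` on the left. -/
def cupLeft (φ : Simplex X → ℤ) : (Simplex X → ℤ) →+ (Simplex X → ℤ) :=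
  AddMonoidHom.mk' (cup φ) (cup_add_right φ)

/-- Cup product with `φ` on the right. -/
def cupRight (φ : Simplex X → ℤ) : (Simplex X → ℤ) →+ (Simplex X → ℤ) :=
  AddMonoidHom.mk' (fun ψ => cup ψ φ) fun ψ ψ' => cup_add_left ψ ψ' φ

/-- The simplices of dimension at most `n` with vertices in a finite set. -/
noncomputable def simplicesIn (hS : S.Finite) (n : ℕ) : Finset (Simplex X) :=
  (finite_simplices hS n).toFinset

theorem mem_simplicesIn (hS : S.Finite) {n : ℕ} :
    σ ∈ simplicesIn hS n ↔ verts σ ⊆ S ∧ σ.1 ≤ n := Set.Finite.mem_toFinset _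

theorem cupLeft_determinedOn (φ : Simplex X → ℤ) (σ : Simplex X) :
    DeterminedOn (cupLeft φ) σ (simplicesIn (finite_verts σ) σ.1) := by
  intro ψ hψ
  by_contra hne
  obtain ⟨α, β, -, hβ, -, hv, hd⟩ := exists_of_cup_ne_zero hne
  exact hβ (hψ β ((mem_simplicesIn _).2 ⟨hv, by omega⟩))

theorem cupRight_determinedOn (φ : Simplex X → ℤ) (σ : Simplex X) :
    DeterminedOn (cupRight φ) σ (simplicesIn (finite_verts σ) σ.1) := by
  intro ψ hψ
  by_contra hne
  obtain ⟨α, β, hα, -, hv, -, hd⟩ := exists_of_cup_ne_zero hne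
  exact hα (hψ α ((mem_simplicesIn _).2 ⟨hv, by omega⟩))

theorem transpose_zero (T : (Simplex X → ℤ) →+ (Simplex X → ℤ)) : transpose T 0 = 0 := by
  funext ρ; simp [transpose]

/-- The sign `(-1)^(k(k+1)/2)` that makes capping with a cycle a chain map: it absorbs the sign
`(-1)^k` relating the boundary of a cap product by a `k`-cochain to the coboundary of that
cochain. -/
def capSign : ℕ → ℤ
  | 0 => 1
  | k + 1 => (-1) ^ (k + 1) * capSign k

theorem capSign_mul_self (k : ℕ) : capSign k * capSign k = 1 := by
  induction k with
  | zero => rfl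
  | succ k ih =>
    rw [capSign]
    linear_combination ((-1) ^ (k + 1) * (-1) ^ (k + 1)) * ih + neg_one_pow_mul_self (k + 1)

theorem coboundary_capSign (φ : Simplex X → ℤ) :
    coboundary (dimScale (fun k => (-1) ^ k * capSign k) φ) = -dimScale capSign (coboundary φ) := by
  rw [coboundary_dimScale]
  funext ⟨k, s⟩
  cases k with
  | zero => simp [dimScale, coboundary]
  | succ k =>
    simp only [dimScale, Pi.neg_apply, Nat.add_sub_cancel, capSign, pow_succ]
    ring

/-- Every pair of simplices in the support of `K` has a pair of faces in the support of `u`. -/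
def FacesIn (K u : Simplex X × Simplex X → ℤ) : Prop :=
  ∀ σ τ, K (σ, τ) ≠ 0 → ∃ α β, u (α, β) ≠ 0 ∧ verts α ⊆ verts σ ∧ verts β ⊆ verts τ

theorem facesIn_joinCochain (φ : Simplex X → ℤ) (u : Simplex X × Simplex X → ℤ) :
    FacesIn (joinCochain φ u) u := fun σ τ h => by
  obtain ⟨-, α, β, -, h, -, hα, hβ, -⟩ := exists_of_joinCochain_ne_zero h
  exact ⟨α, β, h, hα, hβ⟩

theorem facesIn_cupFst (φ : Simplex X → ℤ) (u : Simplex X × Simplex X → ℤ) :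
    FacesIn (cupFst φ u) u := fun σ τ h => by
  obtain ⟨-, β, -, hβ, -, hv, -⟩ := exists_of_cup_ne_zero h
  exact ⟨β, τ, hβ, hv, subset_rfl⟩

theorem facesIn_cupSnd (φ : Simplex X → ℤ) (u : Simplex X × Simplex X → ℤ) :
    FacesIn (cupSnd φ u) u := fun σ τ h => by
  obtain ⟨-, β, -, hβ, -, hv, -⟩ := exists_of_cup_ne_zero h
  exact ⟨σ, β, hβ, subset_rfl, hv⟩

theorem exists_of_slant_ne_zero (h : slant u c τ ≠ 0) : ∃ σ, c σ ≠ 0 ∧ u (σ, τ) ≠ 0 := by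
  by_contra! hzero
  refine h ((finsum_congr fun σ => ?_).trans finsum_zero)
  by_cases hσ : c σ = 0
  · rw [hσ, zero_mul]
  · rw [hzero σ hσ, mul_zero]

theorem slant_zero_right (u : Simplex X × Simplex X → ℤ) : slant u 0 = 0 := by
  funext τ
  simp [slant]

variable [MetricSpace X]

theorem cupLeft_isLocal (φ : Simplex X → ℤ) : IsLocal (cupLeft φ) := fun R =>
  ⟨R, fun σ hσ => ⟨_, fun _ hρ => hσ.subset subset_rfl ((mem_simplicesIn _).1 hρ).1,
    cupLeft_determinedOn φ σ⟩⟩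

theorem cupRight_isLocal (φ : Simplex X → ℤ) : IsLocal (cupRight φ) := fun R =>
  ⟨R, fun σ hσ => ⟨_, fun _ hρ => hσ.subset subset_rfl ((mem_simplicesIn _).1 hρ).1,
    cupRight_determinedOn φ σ⟩⟩

theorem IsLocal.nearSupp (hT : IsLocal T) (ψ : Simplex X → ℤ) : NearSupp (T ψ) ψ := by
  intro R
  obtain ⟨R', hR'⟩ := hT R
  refine ⟨R', fun σ hσ hR => ?_⟩
  obtain ⟨S, hS, hd⟩ := hR' σ hR
  by_contra! hfar
  exact hσ (hd ψ fun ρ hρ => by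
    by_contra hne
    exact hfar ρ hne (hS ρ hρ))

/-- All simplices of the support of `ψ` meet a fixed bounded set. -/
def BddSupp (ψ : Simplex X → ℤ) : Prop :=
  ∃ (x : X) (r : ℝ), ∀ τ, ψ τ ≠ 0 → ∃ v ∈ verts τ, dist v x ≤ r

theorem bddSupp_delta (ρ : Simplex X) : BddSupp (delta ρ) :=
  ⟨ρ.2 0, 0, fun τ hτ => ⟨ρ.2 0, by rw [eq_of_delta_ne_zero hτ]; exact zero_mem_verts ρ,
    (dist_self _).le⟩⟩

theorem BddSupp.coboundary (h : BddSupp ψ) : BddSupp (coboundary ψ) := by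
  obtain ⟨x, r, h⟩ := h
  refine ⟨x, r, fun τ hτ => ?_⟩
  obtain ⟨ρ, hρ, hv, -⟩ := coboundary_ne_zero hτ
  obtain ⟨v, hv', hx⟩ := h ρ hρ
  exact ⟨v, hv hv', hx⟩

theorem BddSupp.finite (h : BddSupp ψ) (hT : IsLocal T) (hc : c ∈ CoarseChain X k) :
    (Function.support fun σ => c σ * T ψ σ).Finite := by
  obtain ⟨x, r, h⟩ := h
  refine (transpose_finite hT hc x r).subset fun σ hσ => ?_
  obtain ⟨R, hR⟩ := CoarseChain.exists_within hc
  obtain ⟨R', hR'⟩ := hT R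
  have hcσ := left_ne_zero_of_mul hσ
  obtain ⟨S, -, hd⟩ := hR' σ (hR σ hcσ)
  have hTσ := right_ne_zero_of_mul hσ
  rw [hd.apply_eq] at hTσ
  obtain ⟨ρ, hρ⟩ : ∃ ρ, T (delta ρ) σ * ψ ρ ≠ 0 := by
    by_contra! hzero
    exact hTσ ((finsum_congr hzero).trans finsum_zero)
  exact ⟨hcσ, ρ, left_ne_zero_of_mul hρ, h ρ (right_ne_zero_of_mul hρ)⟩

theorem transpose_cupLeft_mem (h : k + m = n) (hc : c ∈ CoarseChain X n)
    (hφ : φ ∈ Cochain X k) : transpose (cupLeft φ) c ∈ CoarseChain X m := by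
  refine transpose_mem (cupLeft_isLocal φ) hc fun σ ρ hσ hρ => ?_
  obtain ⟨α, β, hα, hβ, -, -, hd⟩ := exists_of_cup_ne_zero hρ
  obtain rfl := eq_of_delta_ne_zero hβ
  have hdegα := hφ α hα
  have hdegσ := hc.1 σ hσ
  omega

theorem transpose_cupRight_mem (h : k + m = n) (hc : c ∈ CoarseChain X n)
    (hφ : φ ∈ Cochain X k) : transpose (cupRight φ) c ∈ CoarseChain X m := by
  refine transpose_mem (cupRight_isLocal φ) hc fun σ ρ hσ hρ => ?_
  obtain ⟨α, β, hα, hβ, -, -, hd⟩ := exists_of_cup_ne_zero hρ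
  obtain rfl := eq_of_delta_ne_zero hα
  have hdegβ := hφ β hβ
  have hdegσ := hc.1 σ hσ
  omega

theorem transpose_cupLeft_nearSupp (hc : c ∈ CoarseChain X n) (φ : Simplex X → ℤ) :
    NearSupp (transpose (cupLeft φ) c) φ := by
  obtain ⟨R, hR⟩ := CoarseChain.exists_within hc
  refine fun _ => ⟨R, fun ρ hρ _ => ?_⟩
  obtain ⟨σ, hσ, h⟩ := exists_of_transpose_ne_zero hρ
  obtain ⟨α, β, hα, hβ, hv, hv', -⟩ := exists_of_cup_ne_zero h
  rw [eq_of_delta_ne_zero hβ] at hv'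
  exact ⟨α, hα, (hR σ hσ).subset hv' hv⟩

theorem transpose_cupRight_nearSupp (hc : c ∈ CoarseChain X n) (φ : Simplex X → ℤ) :
    NearSupp (transpose (cupRight φ) c) φ := by
  obtain ⟨R, hR⟩ := CoarseChain.exists_within hc
  refine fun _ => ⟨R, fun ρ hρ _ => ?_⟩
  obtain ⟨σ, hσ, h⟩ := exists_of_transpose_ne_zero hρ
  obtain ⟨α, β, hα, hβ, hv, hv', -⟩ := exists_of_cup_ne_zero h
  rw [eq_of_delta_ne_zero hα] at hv
  exact ⟨β, hβ, (hR σ hσ).subset hv hv'⟩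

theorem boundary_transpose_cupLeft (hc : c ∈ CoarseChain X n) (hdc : boundary c = 0)
    (hφ : φ ∈ Cochain X k) :
    boundary (transpose (cupLeft (dimScale capSign φ)) c) =
      transpose (cupLeft (dimScale capSign (coboundary φ))) c := by
  funext ρ
  rw [boundary_transpose (cupLeft_isLocal _) hc
    (transpose_cupLeft_mem (add_sub_cancel k n) hc (dimScale_mem hφ))]
  have hsum :=
    transpose_boundary (cupLeft_isLocal (dimScale (fun k => (-1) ^ k * capSign k) φ)) hc ρ
  rw [hdc, transpose_zero, Pi.zero_apply] at hsum
  have hscale : dimScale (fun k => (-1) ^ k) (dimScale (fun k => (-1) ^ k * capSign k) φ) =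
      dimScale capSign φ := by
    rw [dimScale_dimScale]
    congr 1
    funext k
    rw [← mul_assoc, neg_one_pow_mul_self, one_mul]
  have hleibniz : ∀ σ,
      c σ * coboundary (cupLeft (dimScale (fun k => (-1) ^ k * capSign k) φ) (delta ρ)) σ =
        c σ * cupLeft (dimScale capSign φ) (coboundary (delta ρ)) σ -
          c σ * cupLeft (dimScale capSign (coboundary φ)) (delta ρ) σ := by
    intro σ
    simp only [cupLeft, AddMonoidHom.mk'_apply]
    rw [coboundary_cup, Pi.add_apply, coboundary_capSign, cup_neg_left, hscale]
    ring
  rw [finsum_congr hleibniz, finsum_sub_distrib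
    ((bddSupp_delta ρ).coboundary.finite (cupLeft_isLocal _) hc)
    ((bddSupp_delta ρ).finite (cupLeft_isLocal _) hc)] at hsum
  exact sub_eq_zero.1 hsum.symm

theorem boundary_transpose_cupRight (hc : c ∈ CoarseChain X n) (hdc : boundary c = 0)
    (hφ : φ ∈ Cochain X k) :
    boundary (dimScale capSign (transpose (cupRight φ) c)) =
      dimScale capSign (transpose (cupRight (coboundary φ)) c) := by
  rw [boundary_dimScale]
  funext ρ
  have hsum := transpose_boundary (cupRight_isLocal φ) hc ρ
  rw [hdc, transpose_zero, Pi.zero_apply] at hsum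
  have hleibniz : ∀ σ, c σ * coboundary (cupRight φ (delta ρ)) σ =
      c σ * cupRight φ (coboundary (delta ρ)) σ +
        (-1) ^ ρ.1 * (c σ * cupRight (coboundary φ) (delta ρ) σ) := by
    intro σ
    simp only [cupRight, AddMonoidHom.mk'_apply]
    rw [coboundary_cup, Pi.add_apply, delta_dimScale,
      cup_congr (φ := fun σ => (-1) ^ ρ.1 * delta ρ σ) (φ' := delta ρ) (ψ' := coboundary φ)
        (r := (-1) ^ ρ.1) fun α β _ _ _ => by ring]
    ring
  have hfin := (bddSupp_delta ρ).finite (cupRight_isLocal (coboundary φ)) hc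
  rw [finsum_congr hleibniz, finsum_add_distrib
    ((bddSupp_delta ρ).coboundary.finite (cupRight_isLocal _) hc)
    (hfin.subset fun σ hσ => right_ne_zero_of_mul hσ), ← mul_finsum _ _] at hsum
  simp only [dimScale]
  rw [boundary_transpose (cupRight_isLocal _) hc
    (transpose_cupRight_mem (add_sub_cancel k n) hc hφ)]
  simp only [transpose]
  rw [capSign, pow_succ]
  linear_combination ((-1) ^ ρ.1 * capSign ρ.1) * hsum +
    capSign ρ.1 * (∑ᶠ σ, c σ * cupRight (coboundary φ) (delta ρ) σ) * neg_one_pow_mul_self ρ.1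

/-! ### Slant products -/

theorem facesIn_within (hu : u ∈ TensorCochain X n) (hc : c ∈ CoarseChain X k) (R : ℝ) :
    ∃ R', ∀ σ τ α β, c σ ≠ 0 → Within R τ τ → u (α, β) ≠ 0 → verts α ⊆ verts σ →
      verts β ⊆ verts τ → Within R' σ τ := by
  obtain ⟨R₀, hR₀⟩ := CoarseChain.exists_within hc
  obtain ⟨R', hR'⟩ := TensorCochain.exists_within hu (max R₀ R)
  refine ⟨R₀ + R' + R, fun σ τ α β hσ hτ huv hα hβ => ?_⟩
  have hσ' := hR₀ σ hσ
  exact ((hσ'.subset subset_rfl hα).trans (hR' α β huv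
    ((hσ'.subset hα hα).mono (le_max_left _ _)) ((hτ.subset hβ hβ).mono (le_max_right _ _)))).trans
    (hτ.subset hβ subset_rfl)

theorem faces_finite (hu : u ∈ TensorCochain X n) (hc : c ∈ CoarseChain X k) (τ : Simplex X) :
    {σ | c σ ≠ 0 ∧ ∃ α β, u (α, β) ≠ 0 ∧ verts α ⊆ verts σ ∧ verts β ⊆ verts τ}.Finite := by
  obtain ⟨R, hR⟩ := exists_within τ τ
  obtain ⟨R', hR'⟩ := facesIn_within hu hc R
  refine (CoarseChain.finite_near hc (τ.2 0) R').subset ?_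
  rintro σ ⟨hσ, α, β, h, hα, hβ⟩
  exact ⟨hσ, σ.2 0, zero_mem_verts σ,
    hR' σ τ α β hσ hR h hα hβ _ (zero_mem_verts σ) _ (zero_mem_verts τ)⟩

theorem FacesIn.finite (h : FacesIn K u) (hu : u ∈ TensorCochain X n)
    (hc : c ∈ CoarseChain X k) (τ : Simplex X) :
    (Function.support fun σ => c σ * K (σ, τ)).Finite :=
  (faces_finite hu hc τ).subset fun σ hσ =>
    ⟨left_ne_zero_of_mul hσ, h σ τ (right_ne_zero_of_mul hσ)⟩

theorem FacesIn.mem (h : FacesIn K u) (hu : u ∈ TensorCochain X n)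
    (hdeg : ∀ s, K s ≠ 0 → (s.1.1 : ℤ) + s.2.1 = m) :
    K ∈ TensorCochain X m := by
  refine mem_tensorCochain hdeg fun R => ?_
  obtain ⟨R', hR'⟩ := TensorCochain.exists_within hu R
  refine ⟨R + R' + R, fun σ τ hK hσ hτ => ?_⟩
  obtain ⟨α, β, huv, hα, hβ⟩ := h σ τ hK
  exact ((hσ.subset subset_rfl hα).trans (hR' α β huv (hσ.subset hα hα)
    (hτ.subset hβ hβ))).trans (hτ.subset hβ subset_rfl)

/-- The operator `φ ↦ (join of φ and u) / c` on cochains, the homotopy between the two composites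
of the cap product with `c` and the slant product with `u`. -/
noncomputable def slantJoin (hu : u ∈ TensorCochain X n) (hc : c ∈ CoarseChain X k) :
    (Simplex X → ℤ) →+ (Simplex X → ℤ) :=
  AddMonoidHom.mk' (fun φ => slant (joinCochain φ u) c) fun φ ψ => by
    funext τ
    simp only [slant, Pi.add_apply, joinCochain_add, mul_add]
    exact finsum_add_distrib ((facesIn_joinCochain φ u).finite hu hc τ)
      ((facesIn_joinCochain ψ u).finite hu hc τ)

theorem slant_nearSupp (hu : u ∈ TensorCochain X n) (hc : c ∈ CoarseChain X k) :
    NearSupp (slant u c) c := by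
  intro R
  obtain ⟨R', hR'⟩ := facesIn_within hu hc R
  refine ⟨R', fun τ hτ hR => ?_⟩
  obtain ⟨σ, hσ, h⟩ := exists_of_slant_ne_zero hτ
  exact ⟨σ, hσ, (hR' σ τ σ τ hσ hR h subset_rfl subset_rfl).symm⟩

theorem slantJoin_isLocal (hu : u ∈ TensorCochain X n) (hc : c ∈ CoarseChain X k) :
    IsLocal (slantJoin hu hc) := by
  classical
  intro R
  obtain ⟨R', hR'⟩ := facesIn_within hu hc R
  refine ⟨max R R', fun τ hτ => ?_⟩
  let A := (faces_finite hu hc τ).toFinset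
  refine ⟨A.biUnion fun σ =>
    simplicesIn ((finite_verts σ).union (finite_verts τ)) (σ.1 + τ.1 + 1), fun ρ hρ => ?_,
    fun ψ hψ => ?_⟩
  · obtain ⟨σ, hσ, hρ⟩ := Finset.mem_biUnion.1 hρ
    obtain ⟨hσ, α, β, h, hα, hβ⟩ := (Set.Finite.mem_toFinset _).1 hσ
    have hw := (hR' σ τ α β hσ hτ h hα hβ).symm
    intro v hv w hw'
    rcases ((mem_simplicesIn _).1 hρ).1 hw' with hwσ | hwτ
    · exact (hw v hv w hwσ).trans (le_max_right _ _)
    · exact (hτ v hv w hwτ).trans (le_max_left _ _)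
  · by_contra hne
    obtain ⟨σ, hσ, hjoin⟩ := exists_of_slant_ne_zero hne
    obtain ⟨ρ, α, β, hρ, h, hv, hα, hβ, hd⟩ := exists_of_joinCochain_ne_zero hjoin
    refine hρ (hψ ρ (Finset.mem_biUnion.2 ⟨σ, (Set.Finite.mem_toFinset _).2
      ⟨hσ, α, β, h, hα, hβ⟩, (mem_simplicesIn _).2 ⟨hv, ?_⟩⟩))
    simp only at hd
    omega

theorem joinCochain_mem (hu : u ∈ TensorCochain X n) (hφ : φ ∈ Cochain X k) :
    joinCochain φ u ∈ TensorCochain X (k + n - 1) := by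
  refine (facesIn_joinCochain φ u).mem hu fun s hs => ?_
  obtain ⟨ρ, α, β, hρ, h, -, -, -, hd⟩ := exists_of_joinCochain_ne_zero hs
  have hdegρ := hφ ρ hρ
  have hdegu := hu.1 _ h
  simp only at hdegu
  omega

theorem slantJoin_mem (hu : u ∈ TensorCochain X n) (hc : c ∈ CoarseChain X n)
    (hφ : φ ∈ Cochain X k) (hl : l + 1 = k) : slantJoin hu hc φ ∈ Cochain X l := by
  intro τ hτ
  obtain ⟨σ, hσ, hjoin⟩ := exists_of_slant_ne_zero hτ
  have hdegσ := hc.1 σ hσ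
  have hdeg := (joinCochain_mem hu hφ).1 _ hjoin
  simp only at hdeg
  omega

theorem cup_slant (hu : u ∈ TensorCochain X n) (hc : c ∈ CoarseChain X k)
    (φ : Simplex X → ℤ) (τ : Simplex X) :
    cup φ (slant u c) τ = ∑ᶠ σ, c σ * cup φ (fun ρ => u (σ, ρ)) τ := by
  have hfin := faces_finite hu hc τ
  have hcup : cupLeft φ (slant u c) τ =
      cupLeft φ (∑ σ ∈ hfin.toFinset, c σ • fun ρ => u (σ, ρ)) τ := by
    rw [← sub_eq_zero, ← Pi.sub_apply, ← map_sub]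
    refine cupLeft_determinedOn φ τ _ fun ρ hρ => ?_
    have hv := ((mem_simplicesIn _).1 hρ).1
    rw [Pi.sub_apply, sub_eq_zero, slant,
      finsum_eq_finsetSum_of_support_subset (s := hfin.toFinset), Finset.sum_apply]
    · rfl
    · intro σ hσ
      rw [Set.Finite.coe_toFinset]
      exact ⟨left_ne_zero_of_mul hσ, σ, ρ, right_ne_zero_of_mul hσ, subset_rfl, hv⟩
  refine hcup.trans ?_
  rw [finsum_eq_finsetSum_of_support_subset (s := hfin.toFinset), map_sum, Finset.sum_apply]
  · refine Finset.sum_congr rfl fun σ _ => ?_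
    rw [map_zsmul]
    rfl
  · intro σ hσ
    rw [Set.Finite.coe_toFinset]
    obtain ⟨-, β, -, hβ, -, hv, -⟩ := exists_of_cup_ne_zero (right_ne_zero_of_mul hσ)
    exact ⟨left_ne_zero_of_mul hσ, σ, β, hβ, subset_rfl, hv⟩

theorem slant_transpose_cupLeft (hu : u ∈ TensorCochain X n) (hc : c ∈ CoarseChain X k)
    (φ : Simplex X → ℤ) (τ : Simplex X) :
    slant u (transpose (cupLeft φ) c) τ = slant (cupFst φ u) c τ := by
  refine finsum_transpose_mul (cupLeft_isLocal φ) hc ((faces_finite hu hc τ).subset ?_)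
  rintro σ ⟨hσ, ρ, hρ, h⟩
  obtain ⟨-, β, -, hβ, -, hv, -⟩ := exists_of_cup_ne_zero h
  rw [eq_of_delta_ne_zero hβ] at hv
  exact ⟨hσ, ρ, τ, hρ, hv, subset_rfl⟩

theorem slant_apply_of_pos (hu : u ∈ TensorCochain X n) (hc : c ∈ CoarseChain X n)
    (hτ : 0 < τ.1) : slant u c τ = 0 := by
  by_contra hne
  obtain ⟨σ, hσ, h⟩ := exists_of_slant_ne_zero hne
  have hdegσ := hc.1 σ hσ
  have hdegu := hu.1 _ h
  simp only at hdegu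
  omega

theorem slant_cupSnd {n : ℕ} {e : ℤ} (hu : u ∈ TensorCochain X n) (hc : c ∈ CoarseChain X n)
    (he : ∀ x, slant u c ⟨0, x⟩ = e) (φ : Simplex X → ℤ) (τ : Simplex X) :
    slant (cupSnd φ u) c τ = (-1) ^ ((n + 1) * τ.1) * φ τ * e := by
  have hcup := cup_slant hu hc (dimScale (fun k => (-1) ^ ((n + 1) * k)) φ) τ
  rw [cup_eq_mul_const _ he fun j s => slant_apply_of_pos hu hc j.succ_pos] at hcup
  refine Eq.trans (finsum_congr fun σ => ?_) hcup.symm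
  by_cases hσ : c σ = 0
  · rw [hσ, zero_mul, zero_mul]
  · have hdegσ : σ.1 = n := by exact_mod_cast hc.1 σ hσ
    simp only [cupSnd, hdegσ]

theorem slant_tensorCoboundary_joinCochain (hu : u ∈ TensorCochain X n)
    (hdu : tensorCoboundary u = 0) (hc : c ∈ CoarseChain X k) (φ : Simplex X → ℤ)
    (τ : Simplex X) :
    slant (tensorCoboundary (joinCochain φ u)) c τ =
      slant (joinCochain (coboundary φ) u) c τ +
        slant (cupFst (dimScale (fun k => (-1) ^ k) φ) u) c τ - slant (cupSnd φ u) c τ := by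
  have hjoin := (facesIn_joinCochain (coboundary φ) u).finite hu hc τ
  have hfst := (facesIn_cupFst (dimScale (fun k => (-1) ^ k) φ) u).finite hu hc τ
  have hsnd := (facesIn_cupSnd φ u).finite hu hc τ
  rw [tensorCoboundary_joinCochain φ hdu]
  simp only [slant, Pi.sub_apply, Pi.add_apply, mul_add, mul_sub]
  rw [finsum_sub_distrib ((hjoin.union hfst).subset (Function.support_add _ _)) hsnd,
    finsum_add_distrib hjoin hfst]

theorem coboundary_slantJoin {n : ℕ} {e : ℤ} (hu : u ∈ TensorCochain X n)
    (hdu : tensorCoboundary u = 0) (hc : c ∈ CoarseChain X n) (hdc : boundary c = 0)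
    (he : ∀ x, slant u c ⟨0, x⟩ = e) (hφ : φ ∈ Cochain X k) (τ : Simplex X) :
    (-1) ^ n * coboundary (slantJoin hu hc φ) τ =
      slantJoin hu hc (coboundary φ) τ +
        slant u (transpose (cupLeft (dimScale (fun k => (-1) ^ k) φ)) c) τ -
        (-1) ^ ((n + 1) * τ.1) * φ τ * e := by
  have h := congrFun (slant_coboundary (joinCochain_mem hu hφ) hc) τ
  rw [hdc, slant_zero_right, zero_add, Pi.smul_apply, smul_eq_mul, Int.toNat_natCast,
    slant_tensorCoboundary_joinCochain hu hdu hc] at h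
  rw [← slant_cupSnd hu hc he, slant_transpose_cupLeft hu hc]
  exact h.symm

end Operators

/-! ### Signs -/

section Signs

variable {X : Type*} {u : Simplex X × Simplex X → ℤ} {σ : Simplex X}

/-- The sign `(-1)^(k(k+3)/2)`, which makes the slant product with a cocycle a chain map. -/
def slantSign (k : ℕ) : ℤ := (-1) ^ k * capSign k

theorem slantSign_mul_self (k : ℕ) : slantSign k * slantSign k = 1 := by
  rw [slantSign]
  linear_combination ((-1) ^ k * (-1) ^ k) * capSign_mul_self k + neg_one_pow_mul_self k

theorem slantSign_succ (k : ℕ) : slantSign (k + 1) = capSign k := by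
  rw [slantSign, capSign, ← mul_assoc, neg_one_pow_mul_self, one_mul]

theorem capSign_add (a b : ℕ) : capSign (a + b) = capSign a * capSign b * (-1) ^ (a * b) := by
  induction a with
  | zero => simp [capSign]
  | succ a ih =>
    rw [Nat.add_right_comm, capSign, ih, capSign]
    ring

theorem neg_one_pow_mul_succ (a : ℕ) : (-1 : ℤ) ^ (a * (a + 1)) = 1 :=
  (Nat.even_mul_succ_self a).neg_one_pow

theorem slantSign_mul_slantSign_add (a b : ℕ) :
    slantSign b * (slantSign (a + b) * capSign a) = (-1) ^ ((a + b) * a) := by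
  have hpow : (-1 : ℤ) ^ ((a + b) * a) = (-1) ^ a * (-1) ^ (a * b) := by
    have hsq := neg_one_pow_mul_succ a
    rw [mul_add, mul_one, pow_add] at hsq
    rw [add_mul, pow_add, mul_comm b]
    linear_combination (-1) ^ (a * b) * ((-1) ^ a * hsq -
      (-1) ^ (a * a) * neg_one_pow_mul_self a)
  rw [hpow, slantSign, slantSign, capSign_add, pow_add]
  linear_combination ((-1) ^ a * (-1) ^ (a * b) * (-1) ^ b * (-1) ^ b * capSign b * capSign b) *
    capSign_mul_self a + ((-1) ^ a * (-1) ^ (a * b) * (-1) ^ b * (-1) ^ b) * capSign_mul_self b +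
    ((-1) ^ a * (-1) ^ (a * b)) * neg_one_pow_mul_self b

/-- Exchange of the two factors of `X ⊗ X`. Besides the Koszul sign there is a global sign depending
on the total degree; with it, `u / c = 1` implies `swapFactors u / c = 1`. -/
def swapFactors (u : Simplex X × Simplex X → ℤ) : Simplex X × Simplex X → ℤ :=
  fun s => (-1) ^ (s.1.1 + s.2.1 + s.1.1 * s.2.1) * u (s.2, s.1)

theorem coboundary_eq_zero (φ : Simplex X → ℤ) (h : σ.1 = 0) : coboundary φ σ = 0 := by
  obtain ⟨k, s⟩ := σ
  obtain rfl : k = 0 := h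
  rfl

theorem coboundary_swapFactors_left (u : Simplex X × Simplex X → ℤ) (σ τ : Simplex X) :
    coboundary (fun ρ => swapFactors u (ρ, τ)) σ =
      (-1) ^ (σ.1 + σ.1 * τ.1) * -coboundary (fun ρ => u (τ, ρ)) σ := by
  refine (congrFun (coboundary_dimScale (fun k => (-1) ^ (k + τ.1 + k * τ.1))
    fun ρ => u (τ, ρ)) σ).trans ?_
  simp only [dimScale]
  rcases hσ : σ.1 with _ | k
  · simp [coboundary_eq_zero _ hσ]
  · rw [Nat.add_sub_cancel]
    ring

theorem coboundary_swapFactors_right (u : Simplex X × Simplex X → ℤ) (σ τ : Simplex X) :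
    coboundary (fun ρ => swapFactors u (σ, ρ)) τ =
      (-1) ^ (τ.1 + σ.1 * τ.1) * -coboundary (fun ρ => u (ρ, σ)) τ := by
  refine (congrFun (coboundary_dimScale (fun k => (-1) ^ (σ.1 + k + σ.1 * k))
    fun ρ => u (ρ, σ)) τ).trans ?_
  simp only [dimScale]
  rcases hτ : τ.1 with _ | k
  · simp [coboundary_eq_zero _ hτ]
  · rw [Nat.add_sub_cancel]
    ring

theorem tensorCoboundary_swapFactors (h : tensorCoboundary u = 0) :
    tensorCoboundary (swapFactors u) = 0 := by
  funext ⟨σ, τ⟩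
  have hflip := congrFun h (τ, σ)
  simp only [tensorCoboundary, Pi.zero_apply] at hflip ⊢
  rw [coboundary_swapFactors_left, coboundary_swapFactors_right, pow_add, pow_add]
  linear_combination (-(-1) ^ (σ.1 * τ.1) * (-1) ^ σ.1 * (-1) ^ τ.1) * hflip +
    (-1) ^ (σ.1 * τ.1) * (-1) ^ σ.1 * coboundary (fun ρ => u (τ, ρ)) σ * neg_one_pow_mul_self τ.1

/-- `dimScale` as a homomorphism. -/
def dimScaleHom (ε : ℕ → ℤ) : (Simplex X → ℤ) →+ (Simplex X → ℤ) :=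
  AddMonoidHom.mk' (dimScale ε) (dimScale_add ε)

theorem delta_mem (ρ : Simplex X) : delta ρ ∈ Cochain X (ρ.1 : ℤ) := fun σ hσ => by
  rw [eq_of_delta_ne_zero hσ]

/-- The sign `(-1)^((n+1)k)` with which the right cup factor enters the coboundary of a join. -/
def joinSign (n k : ℕ) : ℤ := (-1) ^ ((n + 1) * k)

theorem joinSign_mul_self (n k : ℕ) : joinSign n k * joinSign n k = 1 := neg_one_pow_mul_self _

theorem coboundary_joinSign (n : ℕ) (φ : Simplex X → ℤ) :
    coboundary (dimScale (joinSign n) φ) =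
      (-1 : ℤ) ^ (n + 1) • dimScale (joinSign n) (coboundary φ) := by
  rw [coboundary_dimScale]
  funext σ
  simp only [dimScale, Pi.smul_apply, smul_eq_mul]
  rcases hσ : σ.1 with _ | k
  · simp [coboundary_eq_zero _ hσ]
  · rw [Nat.add_sub_cancel, joinSign, joinSign, mul_add, mul_one, pow_add _ _ (n + 1)]
    linear_combination (-(-1) ^ ((n + 1) * k) * coboundary φ σ) * neg_one_pow_mul_self (n + 1)

theorem verts_subset_of_cup_delta_ne_zero {ψ : Simplex X → ℤ} {ρ τ : Simplex X}
    (h : cup (delta ρ) ψ τ ≠ 0) : verts ρ ⊆ verts τ := by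
  obtain ⟨α, -, hα, -, hv, -, -⟩ := exists_of_cup_ne_zero h
  rwa [eq_of_delta_ne_zero hα] at hv

theorem apply_vertex_eq_of_coboundary_eq_zero {φ : Simplex X → ℤ} (h : coboundary φ = 0)
    (x y : Fin 1 → X) :
    φ ⟨0, x⟩ = φ ⟨0, y⟩ := by
  have hedge := congrFun h ⟨1, ![y 0, x 0]⟩
  change ∑ i : Fin 2, (-1 : ℤ) ^ (i : ℕ) * φ (face i ![y 0, x 0]) = 0 at hedge
  have hface₀ : face 0 ![y 0, x 0] = (⟨0, x⟩ : Simplex X) := by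
    simp only [face]
    congr 1
    funext i
    fin_cases i
    rfl
  have hface₁ : face 1 ![y 0, x 0] = (⟨0, y⟩ : Simplex X) := by
    simp only [face]
    congr 1
    funext i
    fin_cases i
    rfl
  rw [Fin.sum_univ_two, hface₀, hface₁] at hedge
  simp only [Fin.val_zero, Fin.val_one, pow_zero, pow_one] at hedge
  linear_combination hedge

end Signs

/-! ### Cap and slant products as inverse chain homotopy equivalences -/

section Inverses

variable {X : Type*} [MetricSpace X] {n : ℕ} {k l m e : ℤ} {u : Simplex X × Simplex X → ℤ}
  {φ a b c : Simplex X → ℤ} {T : (Simplex X → ℤ) →+ (Simplex X → ℤ)} {ε : ℕ → ℤ}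

theorem swapFactors_mem (hu : u ∈ TensorCochain X k) : swapFactors u ∈ TensorCochain X k := by
  refine mem_tensorCochain (fun s hs => ?_) fun R => ?_
  · have hdeg := hu.1 _ (right_ne_zero_of_mul hs)
    simp only at hdeg
    omega
  · obtain ⟨R', hR'⟩ := TensorCochain.exists_within hu R
    exact ⟨R', fun α β h hα hβ => (hR' β α (right_ne_zero_of_mul h) hβ hα).symm⟩

theorem dimScale_mem_coarseChain (hc : c ∈ CoarseChain X k) : dimScale ε c ∈ CoarseChain X k :=
  CoarseChain.of_support hc fun _ hσ => right_ne_zero_of_mul hσ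

theorem IsLocal.comp_dimScaleHom (hT : IsLocal T) (ε : ℕ → ℤ) :
    IsLocal (T.comp (dimScaleHom ε)) := by
  intro R
  obtain ⟨R', hR'⟩ := hT R
  refine ⟨R', fun σ hσ => ?_⟩
  obtain ⟨S, hS, hd⟩ := hR' σ hσ
  refine ⟨S, hS, fun ψ hψ => hd _ fun ρ hρ => ?_⟩
  change ε ρ.1 * ψ ρ = 0
  rw [hψ ρ hρ, mul_zero]

theorem transpose_add (hT : IsLocal T) (ha : a ∈ CoarseChain X k) (hb : b ∈ CoarseChain X k) :
    transpose T (a + b) = transpose T a + transpose T b := by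
  funext ρ
  simp only [transpose, Pi.add_apply, add_mul]
  exact finsum_add_distrib ((bddSupp_delta ρ).finite hT ha) ((bddSupp_delta ρ).finite hT hb)

theorem transpose_cupLeft_add (hc : c ∈ CoarseChain X k) (φ ψ : Simplex X → ℤ) :
    transpose (cupLeft (φ + ψ)) c = transpose (cupLeft φ) c + transpose (cupLeft ψ) c := by
  funext ρ
  simp only [transpose, Pi.add_apply]
  rw [← finsum_add_distrib ((bddSupp_delta ρ).finite (cupLeft_isLocal _) hc)
    ((bddSupp_delta ρ).finite (cupLeft_isLocal _) hc)]
  refine finsum_congr fun σ => ?_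
  simp only [cupLeft, AddMonoidHom.mk'_apply, cup_add_left, Pi.add_apply, mul_add]

theorem transpose_cupRight_add (hc : c ∈ CoarseChain X k) (φ ψ : Simplex X → ℤ) :
    transpose (cupRight (φ + ψ)) c = transpose (cupRight φ) c + transpose (cupRight ψ) c := by
  funext ρ
  simp only [transpose, Pi.add_apply]
  rw [← finsum_add_distrib ((bddSupp_delta ρ).finite (cupRight_isLocal _) hc)
    ((bddSupp_delta ρ).finite (cupRight_isLocal _) hc)]
  refine finsum_congr fun σ => ?_
  simp only [cupRight, AddMonoidHom.mk'_apply, cup_add_right, Pi.add_apply, mul_add]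

theorem slant_boundary (hu : u ∈ TensorCochain X k) (hdu : tensorCoboundary u = 0)
    (ha : a ∈ CoarseChain X m) :
    slant u (boundary a) = -((-1 : ℤ) ^ m.toNat • coboundary (slant u a)) := by
  have h := slant_coboundary hu ha
  have hzero : slant (0 : Simplex X × Simplex X → ℤ) a = 0 := by
    funext τ
    simp [slant]
  rw [hdu, hzero] at h
  exact eq_neg_of_add_eq_zero_left h.symm

/-- The map `q : CX_(n-*)(X) → C^*(X)`, the slant product with the diagonal cocycle. -/
noncomputable def signedSlant (u : Simplex X × Simplex X → ℤ) (a : Simplex X → ℤ) : Simplex X → ℤ :=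
  slant u (dimScale slantSign a)

theorem coboundary_signedSlant (hu : u ∈ TensorCochain X k) (hdu : tensorCoboundary u = 0)
    (ha : a ∈ CoarseChain X m) :
    coboundary (signedSlant u a) = signedSlant u (boundary a) := by
  have h := slant_boundary hu hdu (dimScale_mem_coarseChain (ε := slantSign) ha)
  rw [boundary_dimScale] at h
  funext τ
  have hτ := congrFun h τ
  simp only [Pi.neg_apply, Pi.smul_apply, smul_eq_mul] at hτ
  have hsign : signedSlant u (boundary a) τ =
      -(-1) ^ m.toNat * slant u (dimScale (fun k => slantSign (k + 1)) (boundary a)) τ := by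
    simp only [signedSlant, slant]
    rw [mul_finsum _ _]
    refine finsum_congr fun σ => ?_
    by_cases hσ : boundary a σ = 0
    · simp [dimScale, hσ]
    · have hdeg := (boundary_mem (sub_add_cancel m 1) ha).1 σ hσ
      have hm : m.toNat = σ.1 + 1 := by omega
      simp only [dimScale]
      rw [hm, slantSign_succ, slantSign, pow_succ]
      ring
  rw [hsign, hτ, signedSlant]
  linear_combination (-coboundary (slant u (dimScale slantSign a)) τ) * neg_one_pow_mul_self m.toNat

/-- The map `p : C^*(X) → CX_(n-*)(X)`, the cap product with the fundamental cycle. -/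
noncomputable def capHom (hc : c ∈ CoarseChain X n) : (Simplex X → ℤ) →+ (Simplex X → ℤ) :=
  AddMonoidHom.mk' (fun φ =>
    transpose (cupLeft (dimScale capSign (dimScale (fun _ => slantSign n) φ))) c) fun φ ψ => by
      rw [dimScale_add, dimScale_add, transpose_cupLeft_add hc]

/-- The cap product in which the cochain is evaluated on the other end of the simplices. -/
noncomputable def capHomRight (hc : c ∈ CoarseChain X n) : (Simplex X → ℤ) →+ (Simplex X → ℤ) :=
  AddMonoidHom.mk' (fun φ =>
    dimScale capSign (transpose (cupRight (dimScale (fun _ => (-1) ^ n) φ)) c)) fun φ ψ => by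
      rw [dimScale_add, transpose_cupRight_add hc, dimScale_add]

theorem boundary_capHom (hc : c ∈ CoarseChain X n) (hdc : boundary c = 0)
    (hφ : φ ∈ Cochain X k) : boundary (capHom hc φ) = capHom hc (coboundary φ) := by
  refine (boundary_transpose_cupLeft hc hdc (dimScale_mem hφ)).trans ?_
  rw [coboundary_dimScale]
  rfl

theorem boundary_capHomRight (hc : c ∈ CoarseChain X n) (hdc : boundary c = 0)
    (hφ : φ ∈ Cochain X k) : boundary (capHomRight hc φ) = capHomRight hc (coboundary φ) := by
  refine (boundary_transpose_cupRight hc hdc (dimScale_mem hφ)).trans ?_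
  rw [coboundary_dimScale]
  rfl

theorem dimScale_slantSign_capHom (hc : c ∈ CoarseChain X n) (φ : Simplex X → ℤ) :
    dimScale slantSign (capHom hc φ) =
      transpose (cupLeft (dimScale (fun k => (-1) ^ (n * k)) φ)) c := by
  funext ρ
  change slantSign ρ.1 * transpose
    (cupLeft (dimScale capSign (dimScale (fun _ => slantSign n) φ))) c ρ = _
  simp only [transpose]
  rw [mul_finsum _ _]
  refine finsum_congr fun σ => ?_
  by_cases hσ : c σ = 0
  · simp [hσ]
  · have hdeg : σ.1 = n := by exact_mod_cast hc.1 σ hσ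
    rw [mul_left_comm]
    congr 1
    refine (cup_congr fun α β _ _ hd => ?_).symm
    by_cases hβ : β = ρ
    · subst hβ
      have hsign := slantSign_mul_slantSign_add α.1 β.1
      rw [hd, hdeg] at hsign
      simp only [dimScale]
      linear_combination (-φ α * delta β β) * hsign
    · simp [delta_of_ne hβ]

theorem signedSlant_capHom (hu : u ∈ TensorCochain X m) (hc : c ∈ CoarseChain X n)
    (φ : Simplex X → ℤ) :
    signedSlant u (capHom hc φ) = slant (cupFst (dimScale (fun k => (-1) ^ (n * k)) φ) u) c := by
  rw [signedSlant, dimScale_slantSign_capHom]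
  exact funext (slant_transpose_cupLeft hu hc _)

/-- The homotopy `F` from `signedSlant u ∘ capHom hc` to the identity. -/
noncomputable def joinHomotopy (hu : u ∈ TensorCochain X n) (hc : c ∈ CoarseChain X n) :
    (Simplex X → ℤ) →+ (Simplex X → ℤ) :=
  (slantJoin hu hc).comp (dimScaleHom fun k => (-1) ^ n * joinSign n k)

theorem joinHomotopy_isLocal (hu : u ∈ TensorCochain X n) (hc : c ∈ CoarseChain X n) :
    IsLocal (joinHomotopy hu hc) := (slantJoin_isLocal hu hc).comp_dimScaleHom _

theorem joinHomotopy_mem (hl : l + 1 = k) (hu : u ∈ TensorCochain X n)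
    (hc : c ∈ CoarseChain X n) (hφ : φ ∈ Cochain X k) : joinHomotopy hu hc φ ∈ Cochain X l :=
  slantJoin_mem hu hc (dimScale_mem (ε := fun k => (-1) ^ n * joinSign n k) hφ) hl

theorem joinHomotopy_apply (hu : u ∈ TensorCochain X n) (hc : c ∈ CoarseChain X n)
    (φ : Simplex X → ℤ) :
    joinHomotopy hu hc φ = (-1 : ℤ) ^ n • slantJoin hu hc (dimScale (joinSign n) φ) := by
  rw [← map_zsmul]
  exact congrArg (slantJoin hu hc) (dimScale_dimScale (fun _ => (-1) ^ n) (joinSign n) φ).symm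

theorem signedSlant_capHom_sub (hu : u ∈ TensorCochain X n) (hdu : tensorCoboundary u = 0)
    (hc : c ∈ CoarseChain X n) (hdc : boundary c = 0) (he : ∀ x, slant u c ⟨0, x⟩ = e)
    (hφ : φ ∈ Cochain X k) :
    signedSlant u (capHom hc φ) - e • φ =
      coboundary (joinHomotopy hu hc φ) + joinHomotopy hu hc (coboundary φ) := by
  funext τ
  have h := coboundary_slantJoin hu hdu hc hdc he (dimScale_mem (ε := joinSign n) hφ) τ
  have hsign : (fun k => (-1) ^ k * joinSign n k) = fun k => (-1 : ℤ) ^ (n * k) := by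
    funext k
    rw [joinSign, add_mul, one_mul, pow_add]
    linear_combination (-1) ^ (n * k) * neg_one_pow_mul_self k
  rw [coboundary_joinSign, map_zsmul, slant_transpose_cupLeft hu hc, dimScale_dimScale, hsign,
    Pi.smul_apply, smul_eq_mul, pow_succ] at h
  change _ = _ + _ - joinSign n τ.1 * (joinSign n τ.1 * φ τ) * e at h
  have hscale : coboundary (joinHomotopy hu hc φ) =
      (-1 : ℤ) ^ n • coboundary (slantJoin hu hc (dimScale (joinSign n) φ)) := by
    rw [joinHomotopy_apply]
    exact coboundary_dimScale (fun _ => (-1) ^ n) _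
  rw [signedSlant_capHom hu hc, hscale, joinHomotopy_apply]
  simp only [Pi.sub_apply, Pi.add_apply, Pi.smul_apply, smul_eq_mul]
  linear_combination φ τ * e * joinSign_mul_self n τ.1 - h

theorem finite_cofaces (hc : c ∈ CoarseChain X k) (ρ : Simplex X) :
    {τ | c τ ≠ 0 ∧ verts ρ ⊆ verts τ}.Finite :=
  (CoarseChain.finite_near hc (ρ.2 0) 0).subset fun _ hτ =>
    ⟨hτ.1, ρ.2 0, hτ.2 (zero_mem_verts ρ), (dist_self _).le⟩

theorem cup_delta_swapFactors (hu : u ∈ TensorCochain X n) (ρ σ : Simplex X) {τ : Simplex X}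
    (hτ : τ.1 = n) :
    cup (dimScale (fun k => (-1) ^ (n * k)) (delta ρ)) (fun β => swapFactors u (β, σ)) τ =
      capSign ρ.1 * (-1) ^ n * slantSign σ.1 * cup (delta ρ) (fun β => u (σ, β)) τ := by
  refine cup_congr fun α β _ _ hd => ?_
  by_cases hα : α = ρ
  · subst hα
    by_cases hβ : u (σ, β) = 0
    · simp [swapFactors, hβ]
    · have hdeg := hu.1 _ hβ
      simp only at hdeg
      have hσ : σ.1 = α.1 := by omega
      have hn : n = α.1 + β.1 := by omega
      have hpow : (-1 : ℤ) ^ ((α.1 + β.1) * α.1) * (-1) ^ (β.1 + α.1 + β.1 * α.1) =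
          (-1) ^ β.1 := by
        rw [← pow_add, show (α.1 + β.1) * α.1 + (β.1 + α.1 + β.1 * α.1) =
          α.1 * (α.1 + 1) + (β.1 * α.1 + β.1 * α.1) + β.1 by ring, pow_add, pow_add,
          neg_one_pow_mul_succ, Even.neg_one_pow ⟨_, rfl⟩, one_mul, one_mul]
      simp only [dimScale, swapFactors, hσ, hn, slantSign]
      rw [pow_add _ α.1 β.1]
      linear_combination delta α α * u (σ, β) * (hpow -
        (-1) ^ β.1 * (-1) ^ α.1 * (-1) ^ α.1 * capSign_mul_self α.1 -
        (-1) ^ β.1 * neg_one_pow_mul_self α.1)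
  · simp [dimScale, delta_of_ne hα]

theorem mul_signedSlant_capHom_delta (hu : u ∈ TensorCochain X n) (hc : c ∈ CoarseChain X n)
    (a : Simplex X → ℤ) (ρ σ : Simplex X) :
    a σ * signedSlant (swapFactors u) (capHom hc (delta ρ)) σ =
      ∑ τ ∈ (finite_cofaces hc ρ).toFinset, capSign ρ.1 * (-1) ^ n * c τ *
        (dimScale slantSign a σ * cup (delta ρ) (fun β => u (σ, β)) τ) := by
  have hterm : ∀ τ, c τ * cupFst (dimScale (fun k => (-1) ^ (n * k)) (delta ρ))
      (swapFactors u) (τ, σ) = c τ * (capSign ρ.1 * (-1) ^ n * slantSign σ.1 *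
        cup (delta ρ) (fun β => u (σ, β)) τ) := by
    intro τ
    by_cases hτ : c τ = 0
    · simp [hτ]
    · rw [cupFst, cup_delta_swapFactors hu ρ σ (by exact_mod_cast hc.1 τ hτ)]
  rw [signedSlant_capHom (swapFactors_mem hu), slant, finsum_congr hterm,
    finsum_eq_finsetSum_of_support_subset (s := (finite_cofaces hc ρ).toFinset), Finset.mul_sum]
  · refine Finset.sum_congr rfl fun τ _ => ?_
    simp only [dimScale]
    ring
  · intro τ hτ
    rw [Set.Finite.coe_toFinset]
    exact ⟨left_ne_zero_of_mul hτ,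
      verts_subset_of_cup_delta_ne_zero (right_ne_zero_of_mul (right_ne_zero_of_mul hτ))⟩

theorem capHomRight_apply (hc : c ∈ CoarseChain X n) (ψ : Simplex X → ℤ) (ρ : Simplex X) :
    capHomRight hc ψ ρ = ∑ τ ∈ (finite_cofaces hc ρ).toFinset,
      capSign ρ.1 * (-1) ^ n * c τ * cup (delta ρ) ψ τ := by
  have hterm : ∀ τ, c τ * cup (delta ρ) (dimScale (fun _ => (-1) ^ n) ψ) τ =
      c τ * ((-1) ^ n * cup (delta ρ) ψ τ) := fun τ => by
    congr 1
    exact cup_congr fun α β _ _ _ => by simp only [dimScale]; ring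
  change capSign ρ.1 * ∑ᶠ τ, c τ * cup (delta ρ) (dimScale (fun _ => (-1) ^ n) ψ) τ = _
  rw [finsum_congr hterm,
    finsum_eq_finsetSum_of_support_subset (s := (finite_cofaces hc ρ).toFinset), Finset.mul_sum]
  · exact Finset.sum_congr rfl fun τ _ => by ring
  · intro τ hτ
    rw [Set.Finite.coe_toFinset]
    exact ⟨left_ne_zero_of_mul hτ,
      verts_subset_of_cup_delta_ne_zero (right_ne_zero_of_mul (right_ne_zero_of_mul hτ))⟩

theorem finsum_mul_signedSlant_capHom_delta (hu : u ∈ TensorCochain X n)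
    (hc : c ∈ CoarseChain X n) (ha : a ∈ CoarseChain X m) (ρ : Simplex X) :
    ∑ᶠ σ, a σ * signedSlant (swapFactors u) (capHom hc (delta ρ)) σ =
      capHomRight hc (signedSlant u a) ρ := by
  have hfin : ∀ τ, (Function.support fun σ =>
      dimScale slantSign a σ * cup (delta ρ) (fun β => u (σ, β)) τ).Finite := fun τ =>
    (faces_finite hu ha τ).subset fun σ hσ => by
      obtain ⟨-, β, -, hβ, -, hv, -⟩ := exists_of_cup_ne_zero (right_ne_zero_of_mul hσ)
      exact ⟨right_ne_zero_of_mul (left_ne_zero_of_mul hσ), σ, β, hβ, subset_rfl, hv⟩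
  rw [finsum_congr (mul_signedSlant_capHom_delta hu hc a ρ), capHomRight_apply,
    finsum_sum_comm _ _ fun τ _ => (hfin τ).subset fun σ hσ => right_ne_zero_of_mul hσ]
  refine Finset.sum_congr rfl fun τ _ => ?_
  rw [← mul_finsum _ _, signedSlant, cup_slant hu (dimScale_mem_coarseChain ha)]

/-- The homotopy from `capHomRight hc ∘ signedSlant u` to the identity, dual to the one from
`signedSlant (swapFactors u) ∘ capHom hc` to the identity. -/
noncomputable def joinHomotopyTranspose (hu : u ∈ TensorCochain X n) (hc : c ∈ CoarseChain X n)
    (a : Simplex X → ℤ) : Simplex X → ℤ := transpose (joinHomotopy (swapFactors_mem hu) hc) a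

theorem joinHomotopyTranspose_mem (hl : m + 1 = l) (hu : u ∈ TensorCochain X n)
    (hc : c ∈ CoarseChain X n) (ha : a ∈ CoarseChain X m) :
    joinHomotopyTranspose hu hc a ∈ CoarseChain X l := by
  refine transpose_mem (joinHomotopy_isLocal _ hc) ha fun σ ρ hσ hρ => ?_
  have hdegρ := joinHomotopy_mem (sub_add_cancel _ 1) (swapFactors_mem hu) hc (delta_mem ρ) σ hρ
  have hdegσ := ha.1 σ hσ
  omega

theorem IsLocal.finite_coboundary (hT : IsLocal T) (ha : a ∈ CoarseChain X m) (ρ : Simplex X) :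
    (Function.support fun σ => a σ * coboundary (T (delta ρ)) σ).Finite := by
  obtain ⟨R, hR⟩ := CoarseChain.exists_within ha
  obtain ⟨R', hR'⟩ := hT R
  refine (CoarseChain.finite_near ha (ρ.2 0) R').subset fun σ hσ => ?_
  have haσ := left_ne_zero_of_mul hσ
  obtain ⟨τ, hτ, hv, -⟩ := coboundary_ne_zero (right_ne_zero_of_mul hσ)
  obtain ⟨S, hS, hd⟩ := hR' τ ((hR σ haσ).subset hv hv)
  exact ⟨haσ, τ.2 0, hv (zero_mem_verts τ),
    hS ρ (hd.mem hτ) _ (zero_mem_verts τ) _ (zero_mem_verts ρ)⟩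

theorem capHomRight_signedSlant_sub (hu : u ∈ TensorCochain X n) (hdu : tensorCoboundary u = 0)
    (hc : c ∈ CoarseChain X n) (hdc : boundary c = 0)
    (he : ∀ x, slant (swapFactors u) c ⟨0, x⟩ = e) (ha : a ∈ CoarseChain X m) :
    capHomRight hc (signedSlant u a) - e • a =
      boundary (joinHomotopyTranspose hu hc a) + joinHomotopyTranspose hu hc (boundary a) := by
  funext ρ
  have hT := joinHomotopy_isLocal (swapFactors_mem hu) hc
  have hhom := signedSlant_capHom_sub (swapFactors_mem hu) (tensorCoboundary_swapFactors hdu)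
    hc hdc he (delta_mem ρ)
  have hterm : ∀ σ, a σ * signedSlant (swapFactors u) (capHom hc (delta ρ)) σ =
      a σ * coboundary (joinHomotopy (swapFactors_mem hu) hc (delta ρ)) σ +
        a σ * joinHomotopy (swapFactors_mem hu) hc (coboundary (delta ρ)) σ +
          e * (a σ * delta ρ σ) := by
    intro σ
    have hσ := congrFun hhom σ
    simp only [Pi.sub_apply, Pi.add_apply, Pi.smul_apply, smul_eq_mul] at hσ
    linear_combination a σ * hσ
  have hfin₁ := hT.finite_coboundary ha ρ
  have hfin₂ := (bddSupp_delta ρ).coboundary.finite hT ha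
  have hfin₃ : (Function.support fun σ => e * (a σ * delta ρ σ)).Finite :=
    (Set.finite_singleton ρ).subset fun σ hσ =>
      eq_of_delta_ne_zero (right_ne_zero_of_mul (right_ne_zero_of_mul hσ))
  rw [Pi.sub_apply, Pi.add_apply, ← finsum_mul_signedSlant_capHom_delta hu hc ha,
    finsum_congr hterm, finsum_add_distrib
      ((hfin₁.union hfin₂).subset (Function.support_add _ _)) hfin₃,
    finsum_add_distrib hfin₁ hfin₂, ← mul_finsum _ _, finsum_mul_delta]
  rw [joinHomotopyTranspose, joinHomotopyTranspose, transpose_boundary hT ha,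
    boundary_transpose hT ha (joinHomotopyTranspose_mem rfl hu hc ha), Pi.smul_apply, smul_eq_mul]
  ring

theorem exists_slant_vertex_eq (hu : u ∈ TensorCochain X k) (hdu : tensorCoboundary u = 0)
    (hc : c ∈ CoarseChain X m) (hdc : boundary c = 0) : ∃ e, ∀ x, slant u c ⟨0, x⟩ = e := by
  have h := slant_boundary hu hdu hc
  rw [hdc, slant_zero_right, eq_comm, neg_eq_zero, smul_eq_zero] at h
  have hcocycle := h.resolve_left (pow_ne_zero _ (by norm_num))
  rcases isEmpty_or_nonempty (Fin 1 → X) with hX | ⟨⟨y⟩⟩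
  · exact ⟨0, fun x => isEmptyElim x⟩
  · exact ⟨slant u c ⟨0, y⟩, fun x => apply_vertex_eq_of_coboundary_eq_zero hcocycle x y⟩

theorem capHomRight_signedSlant_self (hc : c ∈ CoarseChain X n) (he : slant u c = oneCochain X) :
    capHomRight hc (signedSlant u c) = c := by
  have hslant : signedSlant u c = fun σ => slantSign n * oneCochain X σ := by
    rw [← he]
    funext τ
    simp only [signedSlant, slant]
    rw [mul_finsum _ _]
    refine finsum_congr fun σ => ?_
    by_cases hσ : c σ = 0
    · simp [dimScale, hσ]
    · have hdeg : σ.1 = n := by exact_mod_cast hc.1 σ hσ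
      simp only [dimScale, hdeg]
      ring
  have hcup : ∀ ρ τ, cup (delta ρ) (signedSlant u c) τ = delta ρ τ * slantSign n := fun ρ τ => by
    rw [hslant]
    exact congrFun (cup_eq_mul_const (delta ρ) (fun x => by simp [oneCochain])
      fun j s => by simp [oneCochain]) τ
  funext ρ
  rw [capHomRight_apply, Finset.sum_eq_single ρ]
  · rw [hcup, delta_self]
    by_cases hρ : c ρ = 0
    · simp [hρ]
    · have hdeg : ρ.1 = n := by exact_mod_cast hc.1 ρ hρ
      rw [hdeg, slantSign]
      linear_combination c ρ * capSign n * capSign n * neg_one_pow_mul_self n +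
        c ρ * capSign_mul_self n
  · intro τ _ hτ
    rw [hcup, delta_of_ne hτ, zero_mul, mul_zero]
  · intro hρ
    have hcρ : c ρ = 0 := by
      by_contra hne
      exact hρ ((Set.Finite.mem_toFinset _).2 ⟨hne, subset_rfl⟩)
    rw [hcρ, mul_zero, zero_mul]

theorem slant_swapFactors_eq_one (hu : u ∈ TensorCochain X n) (hdu : tensorCoboundary u = 0)
    (hc : c ∈ CoarseChain X n) (hdc : boundary c = 0) (he : slant u c = oneCochain X) (x) :
    slant (swapFactors u) c ⟨0, x⟩ = 1 := by
  obtain ⟨e, hswap⟩ := exists_slant_vertex_eq (swapFactors_mem hu)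
    (tensorCoboundary_swapFactors hdu) hc hdc
  have hbounds : ∀ ρ, (1 - e) * c ρ = boundary (joinHomotopyTranspose hu hc c) ρ := by
    intro ρ
    have h := congrFun (capHomRight_signedSlant_sub hu hdu hc hdc hswap hc) ρ
    rw [capHomRight_signedSlant_self hc he, hdc, joinHomotopyTranspose.eq_1 hu hc 0,
      transpose_zero, add_zero] at h
    rw [← h, Pi.sub_apply, Pi.smul_apply, smul_eq_mul]
    ring
  have hslant : (1 - e) * slant u c ⟨0, x⟩ =
      slant u (boundary (joinHomotopyTranspose hu hc c)) ⟨0, x⟩ := by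
    simp only [slant]
    rw [mul_finsum _ _]
    exact finsum_congr fun σ => by rw [← mul_assoc, hbounds]
  rw [slant_boundary hu hdu (joinHomotopyTranspose_mem rfl hu hc hc), Pi.neg_apply, Pi.smul_apply,
    coboundary_eq_zero _ rfl, smul_zero, neg_zero, he, oneCochain, if_pos rfl, mul_one] at hslant
  rw [hswap, sub_eq_zero.1 hslant]

end Inverses

section Duality

variable {X : Type*} [MetricSpace X] {n : ℕ} {k l m : ℤ} {u : Simplex X × Simplex X → ℤ}
  {φ a b c : Simplex X → ℤ}

theorem capHom_mem (h : k + m = n) (hc : c ∈ CoarseChain X n) (hφ : φ ∈ Cochain X k) :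
    capHom hc φ ∈ CoarseChain X m :=
  transpose_cupLeft_mem h hc (dimScale_mem (dimScale_mem hφ))

theorem capHom_nearSupp (hc : c ∈ CoarseChain X n) (φ : Simplex X → ℤ) :
    NearSupp (capHom hc φ) φ :=
  (transpose_cupLeft_nearSupp hc _).trans
    (nearSupp_of_imp fun _ hσ => right_ne_zero_of_mul (right_ne_zero_of_mul hσ))

theorem capHomRight_mem (h : k + m = n) (hc : c ∈ CoarseChain X n) (hφ : φ ∈ Cochain X k) :
    capHomRight hc φ ∈ CoarseChain X m :=
  dimScale_mem_coarseChain (transpose_cupRight_mem h hc (dimScale_mem hφ))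

theorem capHomRight_nearSupp (hc : c ∈ CoarseChain X n) (φ : Simplex X → ℤ) :
    NearSupp (capHomRight hc φ) φ :=
  ((transpose_cupRight_nearSupp hc _).trans
    (nearSupp_of_imp fun _ hσ => right_ne_zero_of_mul hσ)).mono fun _ hσ => right_ne_zero_of_mul hσ

theorem signedSlant_mem (h : k + m = n) (hu : u ∈ TensorCochain X n) (ha : a ∈ CoarseChain X m) :
    signedSlant u a ∈ Cochain X k :=
  (slant_mem (by omega) hu (dimScale_mem_coarseChain ha)).1

theorem signedSlant_add (hu : u ∈ TensorCochain X n) (ha : a ∈ CoarseChain X m)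
    (hb : b ∈ CoarseChain X m) :
    signedSlant u (a + b) = signedSlant u a + signedSlant u b := by
  rw [signedSlant, dimScale_add]
  exact slant_add_right hu (dimScale_mem_coarseChain ha) (dimScale_mem_coarseChain hb)

theorem signedSlant_nearSupp (hu : u ∈ TensorCochain X n) (ha : a ∈ CoarseChain X m) :
    NearSupp (signedSlant u a) a :=
  (slant_nearSupp hu (dimScale_mem_coarseChain ha)).trans
    (nearSupp_of_imp fun _ hσ => right_ne_zero_of_mul hσ)

/-- The homotopy `G` from `capHom hc ∘ signedSlant u` to the identity. The homotopies available
are `qp ≃ 1` and, for the right cap product `p'`, `p'q ≃ 1`; they are combined through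
`pq ≃ (p'q)(pq) = p'(qp)q ≃ p'q ≃ 1`. -/
noncomputable def chainHomotopy (hu : u ∈ TensorCochain X n) (hc : c ∈ CoarseChain X n)
    (a : Simplex X → ℤ) : Simplex X → ℤ :=
  joinHomotopyTranspose hu hc a + capHomRight hc (joinHomotopy hu hc (signedSlant u a)) +
    -joinHomotopyTranspose hu hc (capHom hc (signedSlant u a))

theorem chainHomotopy_mem (hl : m + 1 = l) (hu : u ∈ TensorCochain X n)
    (hc : c ∈ CoarseChain X n) (ha : a ∈ CoarseChain X m) :
    chainHomotopy hu hc a ∈ CoarseChain X l := by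
  have hq := signedSlant_mem (sub_add_cancel (n : ℤ) m) hu ha
  exact add_mem (add_mem (joinHomotopyTranspose_mem hl hu hc ha)
    (capHomRight_mem (by omega) hc (joinHomotopy_mem (sub_add_cancel _ 1) hu hc hq)))
    (neg_mem (joinHomotopyTranspose_mem hl hu hc (capHom_mem (sub_add_cancel (n : ℤ) m) hc hq)))

theorem joinHomotopyTranspose_add (hu : u ∈ TensorCochain X n) (hc : c ∈ CoarseChain X n)
    (ha : a ∈ CoarseChain X m) (hb : b ∈ CoarseChain X m) :
    joinHomotopyTranspose hu hc (a + b) =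
      joinHomotopyTranspose hu hc a + joinHomotopyTranspose hu hc b :=
  transpose_add (joinHomotopy_isLocal _ hc) ha hb

theorem chainHomotopy_add (hu : u ∈ TensorCochain X n) (hc : c ∈ CoarseChain X n)
    (ha : a ∈ CoarseChain X m) (hb : b ∈ CoarseChain X m) :
    chainHomotopy hu hc (a + b) = chainHomotopy hu hc a + chainHomotopy hu hc b := by
  have h := sub_add_cancel (n : ℤ) m
  rw [chainHomotopy, signedSlant_add hu ha hb, map_add, map_add, map_add,
    joinHomotopyTranspose_add hu hc ha hb,
    joinHomotopyTranspose_add hu hc (capHom_mem h hc (signedSlant_mem h hu ha))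
      (capHom_mem h hc (signedSlant_mem h hu hb)), chainHomotopy, chainHomotopy]
  abel

theorem chainHomotopy_nearSupp (hu : u ∈ TensorCochain X n) (hc : c ∈ CoarseChain X n)
    (ha : a ∈ CoarseChain X m) : NearSupp (chainHomotopy hu hc a) a := by
  have hT := joinHomotopy_isLocal (swapFactors_mem hu) hc
  have hq := signedSlant_nearSupp hu ha
  have hp := capHom_mem (sub_add_cancel (n : ℤ) m) hc (signedSlant_mem (sub_add_cancel _ m) hu ha)
  have hright : NearSupp (capHomRight hc (joinHomotopy hu hc (signedSlant u a))) a :=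
    (capHomRight_nearSupp hc _).trans (((joinHomotopy_isLocal hu hc).nearSupp _).trans hq)
  have hcap : NearSupp (joinHomotopyTranspose hu hc (capHom hc (signedSlant u a))) a :=
    (transpose_nearSupp hT hp).trans ((capHom_nearSupp hc _).trans hq)
  exact ((transpose_nearSupp hT ha).add hright).add (hcap.mono fun _ hσ => neg_ne_zero.1 hσ)

theorem boundary_neg (ha : a ∈ CoarseChain X m) : boundary (-a) = -boundary a :=
  congrArg Subtype.val <|
    map_neg (CoarseChain.d m (m - 1) (sub_add_cancel m 1)) (⟨a, ha⟩ : CoarseChain X m)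

theorem boundary_chainHomotopy (hu : u ∈ TensorCochain X n) (hc : c ∈ CoarseChain X n)
    (ha : a ∈ CoarseChain X m) :
    boundary (chainHomotopy hu hc a) = boundary (joinHomotopyTranspose hu hc a) +
      boundary (capHomRight hc (joinHomotopy hu hc (signedSlant u a))) -
      boundary (joinHomotopyTranspose hu hc (capHom hc (signedSlant u a))) := by
  have h := sub_add_cancel (n : ℤ) m
  have hq := signedSlant_mem h hu ha
  have hH := joinHomotopyTranspose_mem rfl hu hc ha
  have hF := capHomRight_mem (m := m + 1) (by omega) hc
    (joinHomotopy_mem (sub_add_cancel _ 1) hu hc hq)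
  have hHp := joinHomotopyTranspose_mem rfl hu hc (capHom_mem h hc hq)
  rw [chainHomotopy, boundary_add (add_mem hH hF) (neg_mem hHp), boundary_add hH hF,
    boundary_neg hHp, ← sub_eq_add_neg]

theorem capHom_signedSlant_sub (hu : u ∈ TensorCochain X n) (hdu : tensorCoboundary u = 0)
    (hc : c ∈ CoarseChain X n) (hdc : boundary c = 0) (he : slant u c = oneCochain X)
    (ha : a ∈ CoarseChain X m) :
    capHom hc (signedSlant u a) - a =
      boundary (chainHomotopy hu hc a) + chainHomotopy hu hc (boundary a) := by
  have h := sub_add_cancel (n : ℤ) m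
  have hq := signedSlant_mem h hu ha
  have hF := joinHomotopy_mem (sub_add_cancel _ 1) hu hc hq
  have hswap := slant_swapFactors_eq_one hu hdu hc hdc he
  have hdp : boundary (capHom hc (signedSlant u a)) = capHom hc (signedSlant u (boundary a)) := by
    rw [boundary_capHom hc hdc hq, coboundary_signedSlant hu hdu ha]
  have hright := capHomRight_signedSlant_sub hu hdu hc hdc hswap ha
  have hright_cap := capHomRight_signedSlant_sub hu hdu hc hdc hswap (capHom_mem h hc hq)
  have hleft := congrArg (capHomRight hc)
    (signedSlant_capHom_sub (e := 1) hu hdu hc hdc (fun x => by rw [he]; rfl) hq)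
  rw [one_smul] at hright hright_cap hleft
  rw [hdp] at hright_cap
  rw [map_sub, map_add, ← boundary_capHomRight hc hdc hF,
    coboundary_signedSlant hu hdu ha] at hleft
  rw [boundary_chainHomotopy hu hc ha, chainHomotopy]
  linear_combination (exp := 1) hright + hleft - hright_cap

theorem isCoarsePD_of_slant_eq (hu : u ∈ TensorCochain X n) (hdu : tensorCoboundary u = 0)
    (hc : c ∈ CoarseChain X n) (hdc : boundary c = 0) (he : slant u c = oneCochain X) :
    IsCoarsePD X n :=
  ⟨{
    p := fun k m h => AddMonoidHom.mk' (fun φ => ⟨capHom hc φ.1, capHom_mem h hc φ.2⟩)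
      fun φ ψ => Subtype.ext (map_add (capHom hc) φ.1 ψ.1)
    q := fun k m h => AddMonoidHom.mk' (fun a => ⟨signedSlant u a.1, signedSlant_mem h hu a.2⟩)
      fun a b => Subtype.ext (signedSlant_add hu a.2 b.2)
    F := fun k => AddMonoidHom.mk' (fun φ =>
      ⟨joinHomotopy hu hc φ.1, joinHomotopy_mem rfl hu hc φ.2⟩)
      fun φ ψ => Subtype.ext (map_add (joinHomotopy hu hc) φ.1 ψ.1)
    G := fun m => AddMonoidHom.mk' (fun a =>
      ⟨chainHomotopy hu hc a.1, chainHomotopy_mem rfl hu hc a.2⟩)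
      fun a b => Subtype.ext (chainHomotopy_add hu hc a.2 b.2)
    p_comm := fun k m h h' φ => Subtype.ext (boundary_capHom hc hdc φ.2)
    q_comm := fun k m h h' a => Subtype.ext (coboundary_signedSlant hu hdu a.2)
    homotopy_F := fun k m h φ => Subtype.ext <| (congrArg _ (one_smul ℤ φ.1).symm).trans
      (signedSlant_capHom_sub (e := 1) hu hdu hc hdc (fun x => by rw [he]; rfl) φ.2)
    homotopy_G := fun k m h a => Subtype.ext (capHom_signedSlant_sub hu hdu hc hdc he a.2)
    supp_p := fun k m h φ => (capHom_nearSupp hc φ.1).coarselyContained (capHom_mem h hc φ.2)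
    supp_F := fun k φ => ((joinHomotopy_isLocal hu hc).nearSupp φ.1).coarseInterContained
    supp_q := fun k m _ a => (signedSlant_nearSupp hu a.2).coarseInterContained
    supp_G := fun m a => (chainHomotopy_nearSupp hu hc a.2).coarselyContained
      (chainHomotopy_mem rfl hu hc a.2) }⟩

theorem isCoarsePD_of_isOrientationPair {U : TensorCohomology X n} {z : CoarseHomology X n}
    (h : IsOrientationPair (n : ℤ) U z) : IsCoarsePD X n := by
  induction U using QuotientAddGroup.induction_on with | H u => ?_
  induction z using QuotientAddGroup.induction_on with | H c => ?_
  obtain ⟨η, hη⟩ := AddSubgroup.mem_addSubgroupOf.1 (QuotientAddGroup.eq.1 h)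
  have hη_zero : η = 0 := Subtype.ext <| funext fun σ => by
    by_contra hσ
    have hdeg := η.2.1 σ hσ
    omega
  rw [hη_zero, map_zero] at hη
  have hslant : -slant u.1.1 c.1.1 + oneCochain X = 0 := congrArg Subtype.val hη.symm
  exact isCoarsePD_of_slant_eq u.1.2 (congrArg Subtype.val u.2) c.1.2 (congrArg Subtype.val c.2)
    (neg_add_eq_zero.1 hslant)

end Duality

/-! ### Homomorphisms out of the Baer–Specker group -/

section Specker

theorem exists_dvd_chain_mul_abs_lt (a : ℕ → ℤ) :
    ∃ N : ℕ → ℤ, (∀ i, 0 < N i) ∧ (∀ i k, i ≤ k → N i ∣ N k) ∧ ∀ i, N i * |a i| < N (i + 1) := by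
  have hpos (i : ℕ) : 0 < ∏ k ∈ Finset.range i, (|a k| + 1) :=
    Finset.prod_pos fun _ _ => by positivity
  refine ⟨fun i => ∏ k ∈ Finset.range i, (|a k| + 1), hpos, fun i k h =>
    Finset.prod_dvd_prod_of_subset _ _ _ (Finset.range_subset_range.2 h), fun i => ?_⟩
  simp only [Finset.prod_range_succ]
  exact mul_lt_mul_of_pos_left (lt_add_one _) (hpos i)

variable {ι : Type*} {f : (ℕ → ℤ) →+ (ι → ℤ)} {N : ℕ → ℤ} {j : ℕ → ι}

theorem map_indicator_ne (hdvd : ∀ i k, i ≤ k → N i ∣ N k) {i : ℕ} {j : ι} (hpos : 0 < N i)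
    (hlt : N i * |f (Pi.single i 1) j| < N (i + 1)) (hj : f (Pi.single i 1) j ≠ 0) {S T : Set ℕ}
    (hS : i ∈ S) (hT : i ∉ T) (hlow : ∀ k < i, k ∈ S ↔ k ∈ T) :
    f (S.indicator N) ≠ f (T.indicator N) := by
  classical
  intro hST
  have htail : ∀ k, i < k → N (i + 1) ∣ S.indicator N k - T.indicator N k := fun k hk => by
    have hind : ∀ A : Set ℕ, N (i + 1) ∣ A.indicator N k := fun A => by
      rw [Set.indicator_apply]
      split_ifs
      exacts [hdvd _ _ hk, dvd_zero _]
    exact dvd_sub (hind S) (hind T)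
  choose! w hw using htail
  have hdecomp : S.indicator N - T.indicator N =
      N i • Pi.single i 1 + N (i + 1) • fun k => if i < k then w k else 0 := by
    funext k
    simp only [Pi.sub_apply, Pi.add_apply, Pi.smul_apply, smul_eq_mul]
    rcases lt_trichotomy k i with hk | rfl | hk
    · simp [Pi.single_eq_of_ne hk.ne, hk.not_gt, Set.indicator_apply, hlow k hk]
    · simp [hS, hT]
    · simp [Pi.single_eq_of_ne hk.ne', hk, hw k hk]
  have hval := congrFun (congrArg f hdecomp) j
  rw [map_sub, hST, sub_self, map_add, map_zsmul, map_zsmul] at hval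
  simp only [Pi.add_apply, Pi.smul_apply, Pi.zero_apply, smul_eq_mul] at hval
  have hmul : N (i + 1) ∣ N i * f (Pi.single i 1) j :=
    ⟨-f (fun k => if i < k then w k else 0) j, by linear_combination -hval⟩
  refine mul_ne_zero hpos.ne' hj (Int.eq_zero_of_abs_lt_dvd hmul ?_)
  rwa [abs_mul, abs_of_pos hpos]

theorem injective_map_indicator (hdvd : ∀ i k, i ≤ k → N i ∣ N k) (hpos : ∀ i, 0 < N i)
    (hlt : ∀ i, N i * |f (Pi.single i 1) (j i)| < N (i + 1))
    (hj : ∀ i, f (Pi.single i 1) (j i) ≠ 0) :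
    Function.Injective fun S : Set ℕ => f (S.indicator N) := by
  classical
  intro S T hST
  by_contra hne
  have hex : ∃ i, ¬ (i ∈ S ↔ i ∈ T) := by
    by_contra! hall
    exact hne (Set.ext hall)
  have hlow : ∀ k < Nat.find hex, k ∈ S ↔ k ∈ T := fun k hk => not_not.1 (Nat.find_min hex hk)
  rcases (xor_iff_not_iff _ _).2 (Nat.find_spec hex) with ⟨hS, hT⟩ | ⟨hT, hS⟩
  · exact map_indicator_ne hdvd (hpos _) (hlt _) (hj _) hS hT hlow hST
  · exact map_indicator_ne hdvd (hpos _) (hlt _) (hj _) hT hS (fun k hk => (hlow k hk).symm)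
      hST.symm

theorem exists_map_single_eq_zero_of_countable_range (f : (ℕ → ℤ) →+ (ι → ℤ))
    (hf : (Set.range f).Countable) : ∃ i, f (Pi.single i 1) = 0 := by
  by_contra! hne
  choose j hj using fun i => Function.ne_iff.1 (hne i)
  obtain ⟨N, hpos, hdvd, hlt⟩ := exists_dvd_chain_mul_abs_lt fun i => f (Pi.single i 1) (j i)
  have hinj := injective_map_indicator hdvd hpos hlt hj
  have hcount : Countable (Set ℕ) := by
    have hrange : (Set.range fun S : Set ℕ => f (S.indicator N)).Countable :=
      hf.mono (Set.range_comp_subset_range (fun S : Set ℕ => S.indicator N) f)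
    have := hrange.to_subtype
    exact (Set.rangeFactorization_injective.2 hinj).countable
  obtain ⟨g, hg⟩ := exists_surjective_nat (Set ℕ)
  exact Function.cantor_surjective g hg

variable {f : (ℕ → ℤ) →+ ℤ}

theorem map_eq_zero_of_forall_ge (hf : ∀ i, f (Pi.single i 1) = 0) {N : ℕ} {x : ℕ → ℤ}
    (hx : ∀ k, N ≤ k → x k = 0) : f x = 0 := by
  induction N generalizing x with
  | zero => rw [show x = 0 from funext fun k => hx k (Nat.zero_le k), map_zero]
  | succ N ih =>
    have h := @ih (x - x N • Pi.single N 1) fun k hk => by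
      rcases hk.eq_or_lt with rfl | hlt
      · simp
      · simp [hx k hlt, Pi.single_eq_of_ne hlt.ne']
    rwa [map_sub, map_zsmul, hf, smul_zero, sub_zero] at h

theorem map_pow_mul_eq_zero (hf : ∀ i, f (Pi.single i 1) = 0) {m : ℕ} (hm : 1 < m)
    (a : ℕ → ℤ) : f (fun k => (m : ℤ) ^ k * a k) = 0 := by
  have hdvd : ∀ N, (m : ℤ) ^ N ∣ f (fun k => (m : ℤ) ^ k * a k) := by
    intro N
    have hsplit : (fun k => (m : ℤ) ^ k * a k) =
        (fun k => if k < N then (m : ℤ) ^ k * a k else 0) +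
          (m : ℤ) ^ N • fun k => if k < N then 0 else (m : ℤ) ^ (k - N) * a k := by
      funext k
      simp only [Pi.add_apply, Pi.smul_apply, smul_eq_mul]
      split_ifs with hk
      · simp
      · rw [← mul_assoc, ← pow_add, Nat.add_sub_of_le (not_lt.1 hk), zero_add]
    rw [hsplit, map_add, map_zsmul, map_eq_zero_of_forall_ge hf fun k hk => if_neg hk.not_gt,
      zero_add]
    exact ⟨_, rfl⟩
  set z := f (fun k => (m : ℤ) ^ k * a k)
  refine Int.eq_zero_of_abs_lt_dvd (hdvd z.natAbs) ?_
  rw [Int.abs_eq_natAbs]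
  exact_mod_cast Nat.lt_pow_self hm

-- Every sequence is `2 ^ k * a k + 3 ^ k * b k`, and `f` vanishes on both summands.
theorem eq_zero_of_map_single (hf : ∀ i, f (Pi.single i 1) = 0) : f = 0 := by
  ext x
  have hbezout : ∀ k, ∃ a b : ℤ, x k = ((2 : ℕ) : ℤ) ^ k * a + ((3 : ℕ) : ℤ) ^ k * b := by
    intro k
    obtain ⟨a, b, hab⟩ : IsCoprime ((2 : ℤ) ^ k) ((3 : ℤ) ^ k) :=
      IsCoprime.pow ⟨-1, 1, by norm_num⟩
    exact ⟨x k * a, x k * b, by push_cast; linear_combination (-x k) * hab⟩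
  choose a b hab using hbezout
  have hx : x = (fun k => ((2 : ℕ) : ℤ) ^ k * a k) + fun k => ((3 : ℕ) : ℤ) ^ k * b k :=
    funext hab
  rw [hx, map_add, map_pow_mul_eq_zero hf one_lt_two, map_pow_mul_eq_zero hf (by norm_num),
    add_zero, AddMonoidHom.zero_apply]

end Specker

/-! ### Automatic continuity of controlled homomorphisms -/

section Continuity

variable {X : Type*} [MetricSpace X] {m k : ℤ} {σ τ : Simplex X} {Y : Set X} {R : ℝ} {n : ℕ}

theorem delta_mem_coarseChain (h : (σ.1 : ℤ) = m) : delta σ ∈ CoarseChain X m := by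
  obtain ⟨R, hR⟩ := exists_within σ σ
  refine mem_coarseChain (R := R) (fun ρ hρ => by rw [eq_of_delta_ne_zero hρ, h])
    (fun x r => (Set.finite_singleton σ).subset fun ρ hρ => eq_of_delta_ne_zero hρ.1)
    fun ρ hρ => by rwa [eq_of_delta_ne_zero hρ]

open Classical in
/-- The `m`-chain given by a single simplex, with value `0` if the simplex is not of
dimension `m`. -/
noncomputable def deltaChain (m : ℤ) (σ : Simplex X) : CoarseChain X m :=
  if h : (σ.1 : ℤ) = m then ⟨delta σ, delta_mem_coarseChain h⟩ else 0

theorem coe_deltaChain (h : (σ.1 : ℤ) = m) : (deltaChain m σ).1 = delta σ := by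
  rw [deltaChain, dif_pos h]

theorem eq_sum_smul_deltaChain (a : CoarseChain X m) (ha : {σ | a.1 σ ≠ 0}.Finite) :
    a = ∑ σ ∈ ha.toFinset, a.1 σ • deltaChain m σ := by
  refine Subtype.ext (funext fun ρ => ?_)
  have hdelta : ∀ σ, a.1 σ * (deltaChain m σ).1 ρ = a.1 σ * delta σ ρ := fun σ => by
    by_cases hσ : a.1 σ = 0
    · rw [hσ, zero_mul, zero_mul]
    · rw [coe_deltaChain (a.2.1 σ hσ)]
  rw [AddSubgroup.val_finsetSum, Finset.sum_apply]
  simp only [AddSubgroup.coe_zsmul, Pi.smul_apply, smul_eq_mul, hdelta]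
  rw [Finset.sum_eq_single ρ (fun σ _ hσ => by rw [delta_of_ne hσ.symm, mul_zero])
    fun hρ => by rw [show a.1 ρ = 0 by simpa using hρ, zero_mul], delta_self, mul_one]

/-- The entries of the matrix of a homomorphism, its values on single simplices. -/
noncomputable def matrixEntry (q : CoarseChain X m →+ Cochain X k) (σ τ : Simplex X) : ℤ :=
  (q (deltaChain m σ)).1 τ

theorem dim_eq_of_matrixEntry_ne_zero {q : CoarseChain X m →+ Cochain X k}
    (h : matrixEntry q σ τ ≠ 0) : (σ.1 : ℤ) = m := by
  by_contra hσ
  rw [matrixEntry, deltaChain, dif_neg hσ, map_zero] at h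
  exact h rfl

theorem apply_eq_finsum_of_finite (q : CoarseChain X m →+ Cochain X k) (a : CoarseChain X m)
    (ha : {σ | a.1 σ ≠ 0}.Finite) (τ : Simplex X) :
    (q a).1 τ = ∑ᶠ σ, a.1 σ * matrixEntry q σ τ := by
  rw [finsum_eq_finsetSum_of_support_subset (s := ha.toFinset) _ fun σ hσ => by
    rw [Set.Finite.coe_toFinset]; exact left_ne_zero_of_mul hσ]
  conv_lhs => rw [eq_sum_smul_deltaChain a ha]
  simp only [map_sum, map_zsmul, AddSubgroup.val_finsetSum, Finset.sum_apply,
    AddSubgroup.coe_zsmul, Pi.smul_apply, smul_eq_mul, matrixEntry]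

/-- The subsets of a metric space which meet every ball in a finite set. -/
def LocFinite (Y : Set X) : Prop := ∀ (x : X) (r : ℝ), {y ∈ Y | dist y x ≤ r}.Finite

/-- The simplices with vertices in `Y`, of size at most `R` and dimension at most `n`. -/
def smallSimplices (Y : Set X) (R : ℝ) (n : ℕ) : Set (Simplex X) :=
  {σ | verts σ ⊆ Y ∧ Within R σ σ ∧ σ.1 ≤ n}

theorem finite_smallSimplices_near (hY : LocFinite Y) (x : X) (r : ℝ) :
    {σ ∈ smallSimplices Y R n | ∃ v ∈ verts σ, dist v x ≤ r}.Finite := by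
  refine (finite_simplices (hY x (R + r)) n).subset ?_
  rintro σ ⟨⟨hσY, hσR, hσn⟩, v, hv, hx⟩
  exact ⟨fun w hw => ⟨hσY hw, (dist_triangle _ v _).trans (add_le_add (hσR w hw v hv) hx)⟩, hσn⟩

theorem finite_smallSimplices_within (hY : LocFinite Y) (ρ : Simplex X) (r : ℝ) :
    {σ ∈ smallSimplices Y R n | Within r σ ρ}.Finite :=
  (finite_smallSimplices_near hY (ρ.2 0) r).subset fun σ hσ =>
    ⟨hσ.1, σ.2 0, zero_mem_verts σ, hσ.2 _ (zero_mem_verts σ) _ (zero_mem_verts ρ)⟩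

variable {s : ℕ → Simplex X}

/-- Infinite linear combinations of a sequence of distinct small simplices. -/
noncomputable def infiniteCombination (hY : LocFinite Y)
    (hs : ∀ i, s i ∈ smallSimplices Y R n ∧ ((s i).1 : ℤ) = m) : (ℕ → ℤ) →+ CoarseChain X m :=
  AddMonoidHom.mk' (fun ε => ⟨Function.extend s ε 0, by
    have hrange : ∀ σ, Function.extend s ε 0 σ ≠ 0 → ∃ i, s i = σ := fun σ hσ => by
      by_contra hno
      exact hσ (Function.extend_apply' _ _ _ hno)
    have hsmall : ∀ σ, Function.extend s ε 0 σ ≠ 0 →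
        σ ∈ smallSimplices Y R n ∧ (σ.1 : ℤ) = m := fun σ hσ => by
      obtain ⟨i, rfl⟩ := hrange σ hσ
      exact hs i
    exact mem_coarseChain (R := R) (fun σ hσ => (hsmall σ hσ).2)
      (fun x r => (finite_smallSimplices_near hY x r).subset fun σ hσ =>
        ⟨(hsmall σ hσ.1).1, hσ.2⟩)
      fun σ hσ => (hsmall σ hσ).1.2.1⟩) fun ε ε' => Subtype.ext <| by
    have h := Function.extend_add s ε ε' 0 0
    rwa [add_zero] at h

theorem infiniteCombination_single (hY : LocFinite Y)
    (hs : ∀ i, s i ∈ smallSimplices Y R n ∧ ((s i).1 : ℤ) = m) (hinj : Function.Injective s)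
    (i : ℕ) : infiniteCombination hY hs (Pi.single i 1) = deltaChain m (s i) := by
  refine Subtype.ext (funext fun σ => ?_)
  rw [coe_deltaChain (hs i).2]
  change Function.extend s (Pi.single i 1) 0 σ = delta (s i) σ
  by_cases h : ∃ j, s j = σ
  · obtain ⟨j, rfl⟩ := h
    rw [hinj.extend_apply]
    by_cases hij : j = i
    · simp [hij]
    · rw [Pi.single_eq_of_ne hij, delta_of_ne fun hs => hij (hinj hs)]
  · rw [Function.extend_apply' _ _ _ h, delta_of_ne fun hσ => h ⟨i, hσ.symm⟩]
    rfl

theorem exists_of_infiniteCombination_ne_zero (hY : LocFinite Y)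
    (hs : ∀ i, s i ∈ smallSimplices Y R n ∧ ((s i).1 : ℤ) = m) {ε : ℕ → ℤ}
    (h : (infiniteCombination hY hs ε).1 σ ≠ 0) : ∃ i, s i = σ := by
  by_contra hno
  exact h (Function.extend_apply' _ _ _ hno)

/-- The simultaneous evaluation of cochains on a family of simplices. -/
def evalSimplices {ι : Type*} (k : ℤ) (t : ι → Simplex X) : Cochain X k →+ (ι → ℤ) :=
  AddMonoidHom.mk' (fun φ i => φ.1 (t i)) fun _ _ => rfl

theorem exists_matrixEntry_eq_zero {ι : Type*} (hY : LocFinite Y)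
    (q : CoarseChain X m →+ Cochain X k)
    (hs : ∀ i, s i ∈ smallSimplices Y R n ∧ ((s i).1 : ℤ) = m) (hinj : Function.Injective s)
    (t : ι → Simplex X)
    (hcount : (Set.range fun ε i => (q (infiniteCombination hY hs ε)).1 (t i)).Countable) :
    ∃ j, ∀ i, matrixEntry q (s j) (t i) = 0 := by
  obtain ⟨j, hj⟩ := exists_map_single_eq_zero_of_countable_range
    (((evalSimplices k t).comp q).comp (infiniteCombination hY hs)) hcount
  refine ⟨j, fun i => ?_⟩
  rw [matrixEntry, ← infiniteCombination_single hY hs hinj]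
  exact congrFun hj i

theorem finite_matrixEntry_left (hY : LocFinite Y) (q : CoarseChain X m →+ Cochain X k)
    (τ : Simplex X) : {σ ∈ smallSimplices Y R n | matrixEntry q σ τ ≠ 0}.Finite := by
  by_contra hinf
  let s := Set.Infinite.natEmbedding _ hinf
  obtain ⟨j, hj⟩ := exists_matrixEntry_eq_zero hY q (s := fun i => (s i).1)
    (fun i => ⟨(s i).2.1, dim_eq_of_matrixEntry_ne_zero (s i).2.2⟩)
    (Subtype.val_injective.comp s.injective) (fun _ : Unit => τ) (Set.to_countable _)
  exact (s j).2.2 (hj ())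

variable {q : CoarseChain X m →+ Cochain X k}

theorem finite_matrixEntry_right (hY : LocFinite Y) (hq : ∀ a, NearSupp (q a).1 a.1)
    (σ : Simplex X) : {τ ∈ smallSimplices Y R n | matrixEntry q σ τ ≠ 0}.Finite := by
  obtain ⟨r, hr⟩ := hq (deltaChain m σ) R
  refine (finite_smallSimplices_within hY σ r).subset fun τ ⟨hτ, hne⟩ => ⟨hτ, ?_⟩
  obtain ⟨ρ, hρ, hw⟩ := hr τ hne hτ.2.1
  rw [coe_deltaChain (dim_eq_of_matrixEntry_ne_zero hne)] at hρ
  rwa [eq_of_delta_ne_zero hρ] at hw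

/-- The support of the matrix of a homomorphism on small simplices. -/
def matrixSupport (q : CoarseChain X m →+ Cochain X k) (Y : Set X) (R : ℝ) (n : ℕ) :
    Set (Simplex X × Simplex X) :=
  {p | p.1 ∈ smallSimplices Y R n ∧ p.2 ∈ smallSimplices Y R n ∧ matrixEntry q p.1 p.2 ≠ 0}

theorem finite_matrixSupport_fst_within (hY : LocFinite Y) (hq : ∀ a, NearSupp (q a).1 a.1)
    (ρ : Simplex X) (r : ℝ) : {p ∈ matrixSupport q Y R n | Within r p.1 ρ}.Finite :=
  ((finite_smallSimplices_within hY ρ r).biUnion fun σ _ =>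
    (Set.finite_singleton σ).prod (finite_matrixEntry_right hY hq σ)).subset
      fun p ⟨⟨hσ, hτ, hne⟩, hw⟩ => Set.mem_biUnion (x := p.1) ⟨hσ, hw⟩ ⟨rfl, hτ, hne⟩

theorem finite_matrixSupport_snd_within (hY : LocFinite Y) (q : CoarseChain X m →+ Cochain X k)
    (ρ : Simplex X) (r : ℝ) : {p ∈ matrixSupport q Y R n | Within r p.2 ρ}.Finite :=
  ((finite_smallSimplices_within hY ρ r).biUnion fun τ _ =>
    (finite_matrixEntry_left hY q τ).prod (Set.finite_singleton τ)).subset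
      fun p ⟨⟨hσ, hτ, hne⟩, hw⟩ => Set.mem_biUnion (x := p.2) ⟨hτ, hw⟩ ⟨⟨hσ, hne⟩, rfl⟩

theorem exists_far_pair (hY : LocFinite Y) (hq : ∀ a, NearSupp (q a).1 a.1)
    (hfar : ∀ r, ∃ p ∈ matrixSupport q Y R n, ¬ Within r p.1 p.2)
    {E : Set (Simplex X × Simplex X)} (hE : E.Finite) (r : ℝ) :
    ∃ p ∈ matrixSupport q Y R n, ¬ Within r p.1 p.2 ∧
      ∀ p' ∈ E, p'.1 ≠ p.1 ∧ ¬ Within r p'.1 p.2 ∧ ¬ Within r p.1 p'.2 := by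
  let S := matrixSupport q Y R n
  choose d hd using fun p : Simplex X × Simplex X => exists_within p.1 p.2
  choose d₁ hd₁ using fun p : Simplex X × Simplex X => exists_within p.1 p.1
  have hnear : (⋃ p' ∈ E, {p ∈ S | Within (d₁ p') p.1 p'.1} ∪
      ({p ∈ S | Within r p.2 p'.1} ∪ {p ∈ S | Within r p.1 p'.2})).Finite :=
    hE.biUnion fun p' _ => (finite_matrixSupport_fst_within hY hq _ _).union
      ((finite_matrixSupport_snd_within hY q _ _).union (finite_matrixSupport_fst_within hY hq _ _))
  obtain ⟨M, hM⟩ := (hnear.image d).bddAbove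
  obtain ⟨p, hp, hw⟩ := hfar (max M r)
  have hp_far := fun h => hw ((hd p).mono ((hM ⟨p, h, rfl⟩).trans (le_max_left _ _)))
  refine ⟨p, hp, fun h => hw (h.mono (le_max_right _ _)), fun p' hp' => ⟨fun h => ?_, fun h => ?_,
    fun h => ?_⟩⟩
  · exact hp_far (Set.mem_biUnion hp' (Or.inl ⟨hp, h ▸ hd₁ p'⟩))
  · exact hp_far (Set.mem_biUnion hp' (Or.inr (Or.inl ⟨hp, h.symm⟩)))
  · exact hp_far (Set.mem_biUnion hp' (Or.inr (Or.inr ⟨hp, h⟩)))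

theorem exists_scattered_seq (hY : LocFinite Y) (hq : ∀ a, NearSupp (q a).1 a.1)
    (hfar : ∀ r, ∃ p ∈ matrixSupport q Y R n, ¬ Within r p.1 p.2) :
    ∃ p : ℕ → Simplex X × Simplex X, (∀ i, p i ∈ matrixSupport q Y R n) ∧
      Function.Injective (fun i => (p i).1) ∧
      ∀ i j, ¬ Within (max i j : ℕ) (p i).1 (p j).2 := by
  obtain ⟨f, hf, hlt⟩ := exists_seq_of_forall_finset_exists
    (fun p : ℕ × Simplex X × Simplex X => p.2 ∈ matrixSupport q Y R n ∧ ¬ Within p.1 p.2.1 p.2.2)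
    (fun p p' => p.1 < p'.1 ∧ p.2.1 ≠ p'.2.1 ∧ ¬ Within p'.1 p.2.1 p'.2.2 ∧
      ¬ Within p'.1 p'.2.1 p.2.2) fun E _ => by
    obtain ⟨p, hp, hw, hsep⟩ := exists_far_pair hY hq hfar
      (E.finite_toSet.image Prod.snd) ((E.sup Prod.fst + 1 : ℕ) : ℝ)
    exact ⟨(E.sup Prod.fst + 1, p), ⟨hp, hw⟩, fun p' hp' =>
      ⟨Nat.lt_succ_of_le (Finset.le_sup (f := Prod.fst) hp'), hsep p'.2 ⟨p', hp', rfl⟩⟩⟩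
  have hmono : StrictMono fun i => (f i).1 := fun i j hij => (hlt i j hij).1
  have hle (i : ℕ) : (i : ℝ) ≤ (f i).1 := by exact_mod_cast hmono.le_apply
  refine ⟨fun i => (f i).2, fun i => (hf i).1, fun i j h => ?_, fun i j h => ?_⟩
  · rcases lt_trichotomy i j with hij | hij | hij
    · exact absurd h (hlt i j hij).2.1
    · exact hij
    · exact absurd h.symm (hlt j i hij).2.1
  · rcases lt_trichotomy i j with hij | rfl | hij
    · exact (hlt i j hij).2.2.1 (h.mono (by rw [max_eq_right hij.le]; exact hle j))
    · exact (hf i).2 (h.mono (by rw [max_self]; exact hle i))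
    · exact (hlt j i hij).2.2.2 (h.mono (by rw [max_eq_left hij.le]; exact hle i))

-- Otherwise a scattered sequence of matrix entries gives a homomorphism from all integer sequences
-- to the countable group of finitely supported ones which is injective on the unit vectors.
theorem exists_within_of_mem_matrixSupport (hY : LocFinite Y) (hq : ∀ a, NearSupp (q a).1 a.1)
    (R : ℝ) (n : ℕ) : ∃ r, ∀ p ∈ matrixSupport q Y R n, Within r p.1 p.2 := by
  by_contra! hfar
  obtain ⟨p, hp, hinj, hsep⟩ := exists_scattered_seq hY hq hfar
  have hs : ∀ i, (p i).1 ∈ smallSimplices Y R n ∧ ((p i).1.1 : ℤ) = m :=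
    fun i => ⟨(hp i).1, dim_eq_of_matrixEntry_ne_zero (hp i).2.2⟩
  obtain ⟨j, hj⟩ := exists_matrixEntry_eq_zero hY q hs hinj (fun i => (p i).2) <| by
    refine (Set.countable_range fun g : ℕ →₀ ℤ => (⇑g : ℕ → ℤ)).mono ?_
    rintro _ ⟨ε, rfl⟩
    obtain ⟨r, hr⟩ := hq (infiniteCombination hY hs ε) R
    have hfin : (Function.support fun i =>
        (q (infiniteCombination hY hs ε)).1 (p i).2).Finite := by
      refine (Set.finite_Iic ⌈r⌉₊).subset fun i hi => ?_
      obtain ⟨ρ, hρ, hw⟩ := hr _ hi (hp i).2.1.2.1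
      obtain ⟨j, rfl⟩ := exists_of_infiniteCombination_ne_zero hY hs hρ
      refine Set.mem_Iic.2 (not_lt.1 fun hlt => ?_)
      exact hsep j i (hw.symm.mono ((Nat.le_ceil r).trans
        (by exact_mod_cast hlt.le.trans (le_max_right j i))))
    exact ⟨Finsupp.ofSupportFinite _ hfin, rfl⟩
  exact (hp j).2.2 (hj j)

theorem apply_eq_zero_of_matrixEntry_eq_zero {a : CoarseChain X m}
    (h : ∀ σ, a.1 σ ≠ 0 → matrixEntry q σ τ = 0) : (q a).1 τ = 0 := by
  let dilate : (ℕ → ℤ) →+ CoarseChain X m := AddMonoidHom.mk'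
    (fun ε => ⟨fun σ => ε ⌊dist (σ.2 0) (τ.2 0)⌋₊ * a.1 σ,
      CoarseChain.of_support a.2 fun _ hσ => right_ne_zero_of_mul hσ⟩)
    fun ε ε' => Subtype.ext (funext fun σ => add_mul (ε _) (ε' _) _)
  have hsingle : ∀ i, (q (dilate (Pi.single i 1))).1 τ = 0 := by
    intro i
    rw [apply_eq_finsum_of_finite]
    · refine finsum_eq_zero_of_forall_eq_zero fun σ => ?_
      change _ * a.1 σ * _ = 0
      by_cases hσ : a.1 σ = 0
      · rw [hσ, mul_zero, zero_mul]
      · rw [h σ hσ, mul_zero]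
    · refine (CoarseChain.finite_near a.2 (τ.2 0) (i + 1)).subset fun σ hσ =>
        ⟨right_ne_zero_of_mul hσ, σ.2 0, zero_mem_verts σ, ?_⟩
      have hfloor : ⌊dist (σ.2 0) (τ.2 0)⌋₊ = i := by
        by_contra hne
        exact left_ne_zero_of_mul hσ (Pi.single_eq_of_ne hne _)
      rw [← hfloor]
      exact (Nat.lt_floor_add_one _).le
  have hone : dilate 1 = a := Subtype.ext (funext fun σ => one_mul _)
  have hzero := eq_zero_of_map_single
    (f := (((Pi.evalAddMonoidHom _ τ).comp (Cochain X k).subtype).comp q).comp dilate) hsingle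
  rw [← hone]
  exact DFunLike.congr_fun hzero 1

theorem apply_eq_finsum (hY : LocFinite Y) (q : CoarseChain X m →+ Cochain X k)
    (a : CoarseChain X m) (ha : ∀ σ, a.1 σ ≠ 0 → σ ∈ smallSimplices Y R n) (τ : Simplex X) :
    (q a).1 τ = ∑ᶠ σ, a.1 σ * matrixEntry q σ τ := by
  let S : Set (Simplex X) := {σ | matrixEntry q σ τ ≠ 0}
  have hindicator (A : Set (Simplex X)) : A.indicator a.1 ∈ CoarseChain X m :=
    CoarseChain.of_support a.2 fun σ hσ => (Set.indicator_apply_ne_zero.1 hσ).2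
  have hsplit : a = ⟨S.indicator a.1, hindicator S⟩ + ⟨Sᶜ.indicator a.1, hindicator Sᶜ⟩ :=
    Subtype.ext (Set.indicator_self_add_compl S a.1).symm
  have hcompl : (q ⟨Sᶜ.indicator a.1, hindicator Sᶜ⟩).1 τ = 0 :=
    apply_eq_zero_of_matrixEntry_eq_zero fun σ hσ =>
      not_not.1 (Set.indicator_apply_ne_zero.1 hσ).1
  have hfin : {σ | S.indicator a.1 σ ≠ 0}.Finite :=
    (finite_matrixEntry_left (R := R) (n := n) hY q τ).subset fun σ hσ =>
      ⟨ha σ (Set.indicator_apply_ne_zero.1 hσ).2, (Set.indicator_apply_ne_zero.1 hσ).1⟩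
  conv_lhs => rw [hsplit]
  rw [map_add, AddSubgroup.coe_add, Pi.add_apply, hcompl, add_zero,
    apply_eq_finsum_of_finite q _ hfin]
  refine finsum_congr fun σ => ?_
  by_cases hσ : σ ∈ S
  · exact congrArg (· * _) (Set.indicator_of_mem hσ _)
  · rw [not_not.1 hσ, mul_zero, mul_zero]

end Continuity

/-! ### The orientation pair of a coarse Poincaré duality space -/

theorem oneCochain_mem {X : Type*} [MetricSpace X] : oneCochain X ∈ Cochain X 0 :=
  (oneCocycle X).1.2.1

theorem coboundary_oneCochain {X : Type*} [MetricSpace X] : coboundary (oneCochain X) = 0 :=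
  congrArg Subtype.val (oneCocycle X).2

section MapSimplex

variable {X : Type*} {r : X → X} {σ τ : Simplex X}

/-- The image of a simplex under a map. -/
def mapSimplex (r : X → X) (σ : Simplex X) : Simplex X := ⟨σ.1, r ∘ σ.2⟩

theorem coboundary_mapSimplex (r : X → X) (φ : Simplex X → ℤ) (σ : Simplex X) :
    coboundary (fun ρ => φ (mapSimplex r ρ)) σ = coboundary φ (mapSimplex r σ) := by
  obtain ⟨_ | k, s⟩ := σ <;> rfl

theorem mapSimplex_of_eqOn (h : ∀ v ∈ verts σ, r v = v) : mapSimplex r σ = σ :=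
  congrArg (Sigma.mk σ.1) (funext fun i => h _ ⟨i, rfl⟩)

theorem verts_mapSimplex (r : X → X) (σ : Simplex X) : verts (mapSimplex r σ) = r '' verts σ :=
  Set.range_comp r σ.2

theorem verts_mapSimplex_subset {Y : Set X} (hrY : ∀ x, r x ∈ Y) (σ : Simplex X) :
    verts (mapSimplex r σ) ⊆ Y := by
  rw [verts_mapSimplex]
  exact Set.image_subset_iff.2 fun x _ => hrY x

variable [MetricSpace X] {R R₀ : ℝ}

theorem within_mapSimplex (hr : ∀ x, dist x (r x) ≤ R₀) (h : Within R σ τ) :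
    Within (R₀ + R + R₀) (mapSimplex r σ) (mapSimplex r τ) := by
  simp only [Within, verts_mapSimplex, Set.forall_mem_image]
  exact fun x hx y hy => (dist_triangle4 _ x y _).trans
    (add_le_add (add_le_add (dist_comm x _ ▸ hr x) (h x hx y hy)) (hr y))

theorem within_of_mapSimplex (hr : ∀ x, dist x (r x) ≤ R₀)
    (h : Within R (mapSimplex r σ) (mapSimplex r τ)) : Within (R₀ + R + R₀) σ τ := by
  simp only [Within, verts_mapSimplex, Set.forall_mem_image] at h
  exact fun x hx y hy => (dist_triangle4 _ (r x) (r y) _).trans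
    (add_le_add (add_le_add (hr x) (h hx hy)) (dist_comm y _ ▸ hr y))

end MapSimplex

section Retraction

variable {X : Type*} [MetricSpace X] {c : Simplex X → ℤ}

/-- The set of the vertices of the simplices in the support of a chain. -/
def chainVerts (c : Simplex X → ℤ) : Set X := {x | ∃ σ, c σ ≠ 0 ∧ x ∈ verts σ}

theorem locFinite_chainVerts {k : ℤ} (hc : c ∈ CoarseChain X k) : LocFinite (chainVerts c) :=
  fun x r => ((CoarseChain.finite_near hc x r).biUnion fun σ _ => finite_verts σ).subset
    fun y ⟨⟨σ, hσ, hy⟩, hyx⟩ => Set.mem_biUnion (x := σ) ⟨hσ, y, hy, hyx⟩ hy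

theorem exists_retraction_chainVerts (h : NearSupp (oneCochain X) c) :
    ∃ (r : X → X) (R₀ : ℝ), (∀ x, dist x (r x) ≤ R₀) ∧ (∀ x, r x ∈ chainVerts c) ∧
      ∀ x ∈ chainVerts c, r x = x := by
  obtain ⟨R₀, hR₀⟩ := h 0
  have hnear (x : X) : ∃ y, dist x y ≤ R₀ ∧ y ∈ chainVerts c ∧ (x ∈ chainVerts c → y = x) := by
    obtain ⟨ρ, hρ, hw⟩ := hR₀ ⟨0, fun _ => x⟩ ((if_pos rfl).trans_ne one_ne_zero) (by
      rintro _ ⟨i, rfl⟩ _ ⟨j, rfl⟩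
      exact (dist_self x).le)
    by_cases hx : x ∈ chainVerts c
    · exact ⟨x, (dist_self x).le.trans hw.nonneg, hx, fun _ => rfl⟩
    · exact ⟨ρ.2 0, hw x ⟨0, rfl⟩ _ (zero_mem_verts ρ), ⟨ρ, hρ, zero_mem_verts ρ⟩,
        fun hx' => absurd hx' hx⟩
  choose r hdist hmem hfix using hnear
  exact ⟨r, R₀, hdist, hmem, hfix⟩

end Retraction

section BoundaryDelta

variable {X : Type*} {σ ρ : Simplex X}

theorem of_boundary_delta_ne_zero (h : boundary (delta σ) ρ ≠ 0) :
    verts ρ ⊆ verts σ ∧ ρ.1 + 1 = σ.1 := by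
  obtain ⟨i, x, hx⟩ := boundary_ne_zero h
  rw [← eq_of_delta_ne_zero hx]
  exact ⟨verts_subset_insertVertex i x ρ.2, rfl⟩

theorem finite_support_boundary_delta (σ : Simplex X) : {ρ | boundary (delta σ) ρ ≠ 0}.Finite :=
  (finite_simplices (finite_verts σ) σ.1).subset fun _ hρ =>
    ⟨(of_boundary_delta_ne_zero hρ).1, Nat.le_of_succ_le (of_boundary_delta_ne_zero hρ).2.le⟩

theorem finsum_boundary_delta_mul (σ : Simplex X) (φ : Simplex X → ℤ) :
    ∑ᶠ ρ, boundary (delta σ) ρ * φ ρ = coboundary φ σ := by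
  rw [finsum_boundary_mul ((Set.finite_singleton σ).subset fun ρ hρ => eq_of_delta_ne_zero hρ.1),
    ← finsum_mul_delta (coboundary φ) σ]
  exact finsum_congr fun ρ => mul_comm _ _

end BoundaryDelta

namespace CoarseDuality

variable {X : Type*} [MetricSpace X] {n : ℕ} (D : CoarseDuality X n)

theorem boundary_p {k k' m m' : ℤ} (hk : k + 1 = k') (hm : m + 1 = m') (h : k + m' = n)
    (h' : k' + m = n) (φ : Cochain X k) :
    boundary (D.p k m' h φ).1 = (D.p k' m h' ⟨coboundary φ.1, coboundary_mem hk φ.2⟩).1 := by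
  subst hk hm
  exact congrArg Subtype.val (D.p_comm k m h h' φ)

theorem coboundary_q {k k' m m' : ℤ} (hk : k + 1 = k') (hm : m + 1 = m') (h : k + m' = n)
    (h' : k' + m = n) (c : CoarseChain X m') :
    coboundary (D.q k m' h c).1 = (D.q k' m h' ⟨boundary c.1, boundary_mem hm c.2⟩).1 := by
  subst hk hm
  exact congrArg Subtype.val (D.q_comm k m h h' c)

theorem nearSupp_q {k m : ℤ} (h : k + m = n) (a : CoarseChain X m) :
    NearSupp (D.q k m h a).1 a.1 := by
  by_cases ha : a.1 = 0
  · obtain rfl : a = 0 := Subtype.ext ha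
    rw [map_zero]
    exact nearSupp_of_imp fun _ hσ => hσ
  · exact (D.supp_q k m h a).nearSupp ha

/-- The fundamental cycle: the image of the constant cochain `1` under `p`. -/
noncomputable def cycle : CoarseChain X n :=
  D.p 0 n (zero_add _) ⟨oneCochain X, oneCochain_mem⟩

theorem boundary_cycle : boundary D.cycle.1 = 0 := by
  rw [cycle, D.boundary_p (m := n - 1) (zero_add 1) (sub_add_cancel _ _) _ (add_sub_cancel _ _)]
  simp only [coboundary_oneCochain]
  exact congrArg Subtype.val (map_zero (D.p 1 (n - 1) _))

theorem q_cycle : (D.q 0 n (zero_add _) D.cycle).1 = oneCochain X := by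
  have hF : D.F (-1) ⟨oneCochain X, oneCochain_mem⟩ = 0 := Subtype.ext <| funext fun σ => by
    by_contra hσ
    have hdeg := (D.F (-1) ⟨oneCochain X, oneCochain_mem⟩).2 σ hσ
    omega
  have hd : Cochain.d (X := X) (-1 + 1) (-1 + 1 + 1) rfl ⟨oneCochain X, oneCochain_mem⟩ = 0 :=
    Subtype.ext coboundary_oneCochain
  have h := D.homotopy_F (-1) n (zero_add _) ⟨oneCochain X, oneCochain_mem⟩
  rw [hd, hF, map_zero, map_zero, add_zero, sub_eq_zero] at h
  exact congrArg Subtype.val h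

/-- The matrix entries of `q` in all degrees at once. -/
noncomputable def qEntry (σ τ : Simplex X) : ℤ :=
  matrixEntry (D.q (n - σ.1) σ.1 (sub_add_cancel _ _)) σ τ

variable {σ τ : Simplex X}

theorem matrixEntry_q {k m : ℤ} (h : k + m = n) (hσ : (σ.1 : ℤ) = m) (τ : Simplex X) :
    matrixEntry (D.q k m h) σ τ = D.qEntry σ τ := by
  subst hσ
  obtain rfl : k = n - σ.1 := by omega
  rfl

theorem dim_add_dim_of_qEntry_ne_zero (h : D.qEntry σ τ ≠ 0) : (σ.1 : ℤ) + τ.1 = n := by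
  have hdeg := (D.q _ _ (sub_add_cancel _ _) (deltaChain σ.1 σ)).2 τ h
  omega

theorem coboundary_qEntry (σ τ : Simplex X) :
    coboundary (D.qEntry σ) τ = coboundary (fun ρ => D.qEntry ρ τ) σ := by
  have hboundary (ρ : Simplex X) :
      boundary (deltaChain σ.1 σ).1 ρ = boundary (delta σ) ρ := by rw [coe_deltaChain rfl]
  calc coboundary (D.qEntry σ) τ
      = (D.q (n - σ.1 + 1) (σ.1 - 1) (by omega)
          ⟨boundary (deltaChain σ.1 σ).1,
            boundary_mem (sub_add_cancel _ _) (Subtype.prop _)⟩).1 τ :=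
        congrFun (D.coboundary_q rfl (sub_add_cancel _ _) (sub_add_cancel _ _) _ _) τ
    _ = ∑ᶠ ρ, boundary (deltaChain σ.1 σ).1 ρ * matrixEntry (D.q _ _ _) ρ τ :=
        apply_eq_finsum_of_finite _ _
          (by simpa only [hboundary] using finite_support_boundary_delta σ) τ
    _ = ∑ᶠ ρ, boundary (delta σ) ρ * D.qEntry ρ τ := finsum_congr fun ρ => by
        rw [hboundary]
        by_cases hρ : boundary (delta σ) ρ = 0
        · rw [hρ, zero_mul, zero_mul]
        · have hdim := (of_boundary_delta_ne_zero hρ).2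
          rw [D.matrixEntry_q _ (by omega)]
    _ = coboundary (fun ρ => D.qEntry ρ τ) σ := finsum_boundary_delta_mul σ _

theorem exists_within_of_qEntry_ne_zero {Y : Set X} (hY : LocFinite Y) (R : ℝ) :
    ∃ r, ∀ σ τ, verts σ ⊆ Y → verts τ ⊆ Y → Within R σ σ → Within R τ τ →
      D.qEntry σ τ ≠ 0 → Within r σ τ := by
  choose r hr using fun j : ℕ =>
    exists_within_of_mem_matrixSupport hY (D.nearSupp_q (k := n - j) (sub_add_cancel _ _)) R n
  obtain ⟨M, hM⟩ := ((Finset.range (n + 1)).image r).exists_le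
  refine ⟨M, fun σ τ hσY hτY hσR hτR h => ?_⟩
  have hdim := D.dim_add_dim_of_qEntry_ne_zero h
  have hσn : σ.1 ≤ n := by omega
  have hτn : τ.1 ≤ n := by omega
  exact (hr σ.1 (σ, τ) ⟨⟨hσY, hσR, hσn⟩, ⟨hτY, hτR, hτn⟩, h⟩).mono
    (hM _ (Finset.mem_image_of_mem r (Finset.mem_range.2 (Nat.lt_succ_of_le hσn))))

/-- The diagonal cocycle: the matrix of `q`, pulled back along a map `r`. The matrix is only
controlled on a locally finite set, and `r` will be a retraction onto such a set which moves points
a bounded distance. The signs turn the chain map `q` into a cocycle whose slant product with the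
fundamental cycle is `1`. -/
noncomputable def diagonal (r : X → X) (s : Simplex X × Simplex X) : ℤ :=
  slantSign n * slantSign s.1.1 * D.qEntry (mapSimplex r s.1) (mapSimplex r s.2)

variable {r : X → X}

theorem diagonal_mem {Y : Set X} (hY : LocFinite Y) {R₀ : ℝ} (hr : ∀ x, dist x (r x) ≤ R₀)
    (hrY : ∀ x, r x ∈ Y) : D.diagonal r ∈ TensorCochain X n := by
  refine mem_tensorCochain (fun s hs => D.dim_add_dim_of_qEntry_ne_zero
    (σ := mapSimplex r s.1) (τ := mapSimplex r s.2) (right_ne_zero_of_mul hs)) fun R => ?_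
  obtain ⟨M, hM⟩ := D.exists_within_of_qEntry_ne_zero hY (R₀ + R + R₀)
  exact ⟨_, fun σ τ h hσ hτ => within_of_mapSimplex hr <|
    hM _ _ (verts_mapSimplex_subset hrY σ) (verts_mapSimplex_subset hrY τ)
      (within_mapSimplex hr hσ) (within_mapSimplex hr hτ) (right_ne_zero_of_mul h)⟩

theorem coboundary_diagonal_left (r : X → X) (σ τ : Simplex X) :
    coboundary (fun ρ => D.diagonal r (ρ, τ)) σ = slantSign n * slantSign (σ.1 - 1) *
      coboundary (fun ρ => D.qEntry ρ (mapSimplex r τ)) (mapSimplex r σ) := by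
  rw [← coboundary_mapSimplex]
  exact congrFun (coboundary_dimScale (fun k => slantSign n * slantSign k) _) σ

theorem coboundary_diagonal_right (r : X → X) (σ τ : Simplex X) :
    coboundary (fun ρ => D.diagonal r (σ, ρ)) τ = slantSign n * slantSign σ.1 *
      coboundary (D.qEntry (mapSimplex r σ)) (mapSimplex r τ) := by
  rw [← coboundary_mapSimplex]
  exact congrFun (coboundary_dimScale (fun _ => slantSign n * slantSign σ.1) _) τ

theorem tensorCoboundary_diagonal (r : X → X) : tensorCoboundary (D.diagonal r) = 0 := by
  funext ⟨σ, τ⟩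
  change coboundary (fun ρ => D.diagonal r (ρ, τ)) σ +
    (-1) ^ σ.1 * coboundary (fun ρ => D.diagonal r (σ, ρ)) τ = 0
  rw [coboundary_diagonal_left, coboundary_diagonal_right, coboundary_qEntry]
  obtain ⟨_ | k, s⟩ := σ
  · rw [coboundary_eq_zero _ rfl, mul_zero, mul_zero, mul_zero, add_zero]
  · rw [Nat.add_sub_cancel, slantSign_succ, slantSign.eq_1 k]
    ring

theorem slant_diagonal (hr : ∀ x ∈ chainVerts D.cycle.1, r x = x) :
    slant (D.diagonal r) D.cycle.1 = oneCochain X := by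
  funext τ
  obtain ⟨R, hR⟩ := CoarseChain.exists_within D.cycle.2
  have hdim (σ) (hσ : D.cycle.1 σ ≠ 0) : σ.1 = n := by exact_mod_cast D.cycle.2.1 σ hσ
  calc slant (D.diagonal r) D.cycle.1 τ
      = ∑ᶠ σ, D.cycle.1 σ * matrixEntry (D.q 0 n (zero_add _)) σ (mapSimplex r τ) := by
        refine finsum_congr fun σ => ?_
        by_cases hσ : D.cycle.1 σ = 0
        · rw [hσ, zero_mul, zero_mul]
        · rw [D.matrixEntry_q _ (D.cycle.2.1 σ hσ), diagonal, hdim σ hσ, slantSign_mul_self,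
            one_mul, mapSimplex_of_eqOn fun v hv => hr v ⟨σ, hσ, hv⟩]
    _ = (D.q 0 n (zero_add _) D.cycle).1 (mapSimplex r τ) :=
        (apply_eq_finsum (locFinite_chainVerts D.cycle.2) _ _
          (fun σ hσ => ⟨fun v hv => ⟨σ, hσ, hv⟩, hR σ hσ, (hdim σ hσ).le⟩) _).symm
    _ = oneCochain X τ := congrFun D.q_cycle _

theorem exists_isOrientationPair (D : CoarseDuality X n) :
    ∃ (U : TensorCohomology X n) (z : CoarseHomology X n), IsOrientationPair (n : ℤ) U z := by
  obtain ⟨r, R₀, hr, hrY, hfix⟩ := exists_retraction_chainVerts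
    (D.q_cycle ▸ D.nearSupp_q (zero_add _) D.cycle)
  let U : (TensorCochain.d (X := X) n (n + 1) rfl).ker :=
    ⟨⟨D.diagonal r, D.diagonal_mem (locFinite_chainVerts D.cycle.2) hr hrY⟩,
      Subtype.ext (D.tensorCoboundary_diagonal r)⟩
  exact ⟨QuotientAddGroup.mk U, QuotientAddGroup.mk ⟨D.cycle, Subtype.ext D.boundary_cycle⟩,
    congrArg QuotientAddGroup.mk (Subtype.ext (Subtype.ext (D.slant_diagonal hfix)))⟩

end CoarseDuality

end CoarsePD

theorem theorem7p3 (X : Type*) [MetricSpace X] (n : ℕ) :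
    CoarsePD.IsCoarsePD X n ↔
      ∃ (U : CoarsePD.TensorCohomology X n) (z : CoarsePD.CoarseHomology X n),
        CoarsePD.IsOrientationPair (n : ℤ) U z :=
  ⟨fun ⟨D⟩ => D.exists_isOrientationPair,
    fun ⟨_, _, h⟩ => CoarsePD.isCoarsePD_of_isOrientationPair h⟩
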